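/- Let $d\ge 1$, $1<\alpha<2$, and let $\mu\in L_\infty(\mathbb R^d\times\mathbb R^d)$ be real-valued with, for a.e. $(x,y)$, $0<\mu_-\le\mu(x,y)\le\mu_+<\infty$, $\mu(x,y)=\mu(y,x)$ and $\mu(x+m,y+n)=\mu(x,y)$ for all $m,n\in\mathbb Z^d$. Put $\Omega=[0,1)^d$, and let $\widetilde H^{\alpha/2}(\Omega)$ be the space of $u\in L_2(\Omega)$ whose $\mathbb Z^d$-periodic extension (denoted again by $u$) lies in $H^{\alpha/2}_{\rm loc}(\mathbb R^d)$. For $\xi\in\mathbb R^d$ let $\mathbb A(\xi)$ be the self-adjoint operator in $L_2(\Omega)$ generated by the closed form $$a(\xi)[u,u]=\frac12\int_{\mathbb R^d}dy\int_\Omega dx\,\mu(x,y)\frac{|e^{i\langle\xi,x\rangle}u(x)-e^{i\langle\xi,y\rangle}u(y)|^2}{|x-y|^{d+\alpha}},\qquad u\in\widetilde H^{\alpha/2}(\Omega),$$ and let $P$ be the orthogonal projection of $L_2(\Omega)$ onto the constants. Put $$\mu^0=\int_\Omega\int_\Omega\mu(x,y)\,dx\,dy,\qquad c_0=\int_{\mathbb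 R^d}\frac{1-\cos z_1}{|z|^{d+\alpha}}\,dz,\qquad \mu_*(z)=\int_\Omega\mu(x,z+x)\,dx-\mu^0 .$$ For $k=1,\dots,d$ the problem of finding $v_k\in\widetilde H^{\alpha/2}(\Omega)$ with $\int_\Omega v_k\,dx=0$ and $$\int_{\mathbb R^d}dy\int_\Omega dx\,\frac{\mu(x,y)}{|x-y|^{d+\alpha}}\bigl(v_k(x)-v_k(y)+x_k-y_k\bigr)\overline{(\eta(x)-\eta(y))}=0\quad\text{for all }\eta\in\widetilde H^{\alpha/2}(\Omega)$$ has a unique solution (which is automatically real-valued). Let $g^0=\{g^0_{jk}\}$ be the real symmetric matrix with entries $$g^0_{jk}=\frac14\int_{\mathbb R^d}dy\int_\Omega dx\,\frac{\mu(x,y)}{|x-y|^{d+\alpha}}\Bigl((x_j-y_j)(v_k(x)-v_k(y))+(x_k-y_k)(v_j(x)-v_j(y))\Bigr)+\sum_{n\in\mathbb Z^d}\int_{\Omega+n}\frac{\mu_*(z)z_jz_k}{2|z|^{d+\alpha}}\,dz .$$ With $\omega_d$ the surface area of the unit sphere in $\mathbb R^d$, define $\delta_0=\pi\bigl(\mu_-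 /(3\mu_+)\bigr)^{1/\alpha}$, $d_0=\mu_-c_0\pi^\alpha$, $R=\sqrt d\,2^{1/(d+\alpha)}/(2^{1/(d+\alpha)}-1)$, $$c_3=\Bigl(\frac{\omega_d}{2(2-\alpha)}\Bigr)^{1/2}+\frac{\omega_d}{\alpha-1},\qquad c_4=\omega_d\Bigl(\frac{(R+\sqrt d)^{2-\alpha}}{2(2-\alpha)}+\frac{d+\alpha+1}{(\alpha-1)R^{\alpha-1}}\Bigr),$$ $$C_7=\Bigl(3+\frac{3\mu_+}{d_0}\Bigr)^2\frac{c_3^2}{\mu_+}\Bigl(1+\frac{\mu_++2d_0/3}{\mu_+}\Bigl(3+\frac{3\mu_+}{d_0}\Bigr)\Bigr)\frac{(2\pi+2)d_0^2}{9\pi},\qquad C_{12}=d\,C_7+c_4\mu_+,$$ $$\delta_*=\min\Bigl\{\delta_0,\ \Bigl(\frac{\mu^0c_0}{2C_{12}}\Bigr)^{1/(2-\alpha)}\Bigr\}.$$ Then there is a constant $C$ depending only on $d,\alpha,\mu_-,\mu_+$ such that for all $\varepsilon>0$ and all $\xi\in\mathbb R^d$ with $|\xi|\le\delta_*$ one has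 $\mu^0c_0|\xi|^\alpha+\langle g^0\xi,\xi\rangle+\varepsilon^\alpha>0$ and $$\Bigl\|(\mathbb A(\xi)+\varepsilon^\alpha I)^{-1}-\bigl(\mu^0c_0|\xi|^\alpha+\langle g^0\xi,\xi\rangle+\varepsilon^\alpha\bigr)^{-1}P\Bigr\|_{L_2(\Omega)\to L_2(\Omega)}\le C\,\varepsilon^{1-\alpha}.$$ -/

import Mathlib

open MeasureTheory Set

namespace LevyType

noncomputable section

/-- The space `ℝ^d` with its Euclidean norm. -/
abbrev Eu (d : ℕ) : Type := EuclideanSpace ℝ (Fin d)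

/-! ### The periodicity cell and the space of square integrable functions on it -/

/-- The cell `Ω = [0,1)^d`. -/
def unitCell (d : ℕ) : Set (Eu d) := {x | ∀ i, x i ∈ Ico (0 : ℝ) 1}

/-- Lebesgue measure on `Ω`. -/
def cellMeasure (d : ℕ) : Measure (Eu d) := volume.restrict (unitCell d)

/-- The complex Hilbert space `L₂(Ω)`. -/
abbrev L2Cell (d : ℕ) : Type := Lp ℂ 2 (cellMeasure d)

/-- A vector of the lattice `ℤ^d`, seen in `ℝ^d`. -/
def latticeVec {d : ℕ} (n : Fin d → ℤ) : Eu d := WithLp.toLp 2 (fun i => (n i : ℝ))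

/-- The representative of `x` modulo `ℤ^d` that lies in `Ω`. -/
def fractVec {d : ℕ} (x : Eu d) : Eu d := WithLp.toLp 2 (fun i => Int.fract (x i))

/-- The `ℤ^d`-periodic extension of (the restriction to `Ω` of) `u`. -/
def perExt {d : ℕ} (u : Eu d → ℂ) (x : Eu d) : ℂ := u (fractVec x)

lemma measurableSet_unitCell (d : ℕ) : MeasurableSet (unitCell d) := by
  have h : unitCell d = ⋂ i : Fin d, {x : Eu d | x i ∈ Ico (0 : ℝ) 1} := by
    ext x
    simp [unitCell]
  rw [h]
  refine MeasurableSet.iInter fun i => ?_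
  have hc : Continuous fun x : Eu d => x i := by fun_prop
  exact hc.measurable measurableSet_Ico

lemma fractVec_mem {d : ℕ} (x : Eu d) : fractVec x ∈ unitCell d :=
  fun i => ⟨Int.fract_nonneg _, Int.fract_lt_one _⟩

lemma fractVec_eq {d : ℕ} (x : Eu d) : fractVec x = x - latticeVec (fun i => ⌊x i⌋) := by
  ext i
  simp only [fractVec, latticeVec, PiLp.sub_apply]
  rfl

lemma unitCell_bounded (d : ℕ) : Bornology.IsBounded (unitCell d) := by
  refine (Metric.isBounded_iff_subset_closedBall (0 : Eu d)).2 ⟨Real.sqrt d, fun x hx => ?_⟩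
  rw [mem_closedBall_zero_iff, EuclideanSpace.norm_eq]
  refine Real.sqrt_le_sqrt ?_
  calc ∑ i, ‖x i‖ ^ 2 ≤ ∑ _i : Fin d, (1 : ℝ) := by
        refine Finset.sum_le_sum fun i _ => ?_
        have h := hx i
        rw [Real.norm_eq_abs, sq_abs]
        nlinarith [h.1, h.2]
    _ = d := by simp

instance cellMeasure_isFinite (d : ℕ) : IsFiniteMeasure (cellMeasure d) :=
  ⟨by
    rw [cellMeasure, Measure.restrict_apply_univ]
    exact (unitCell_bounded d).measure_lt_top⟩

/-- Null sets of `Ω` have null periodic extension, so that the periodic extension is well defined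
on classes of functions. -/
lemma ae_fractVec {d : ℕ} {p : Eu d → Prop} (h : ∀ᵐ x ∂(cellMeasure d), p x) :
    ∀ᵐ x : Eu d, p (fractVec x) := by
  rw [cellMeasure, ae_restrict_iff' (measurableSet_unitCell d)] at h
  have h2 : ∀ᵐ x : Eu d, ∀ n : Fin d → ℤ,
      x - latticeVec n ∈ unitCell d → p (x - latticeVec n) :=
    ae_all_iff.2 fun n =>
      (measurePreserving_sub_right volume (latticeVec n)).quasiMeasurePreserving.ae h
  filter_upwards [h2] with x hx
  have h3 := hx (fun i => ⌊x i⌋)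
  rw [← fractVec_eq] at h3
  exact h3 (fractVec_mem x)

lemma perExt_add {d : ℕ} (u v : L2Cell d) :
    ∀ᵐ x : Eu d, perExt (u + v : L2Cell d) x = perExt u x + perExt v x :=
  ae_fractVec (p := fun x => (u + v : L2Cell d) x = u x + v x) (Lp.coeFn_add u v)

lemma perExt_smul {d : ℕ} (c : ℂ) (u : L2Cell d) :
    ∀ᵐ x : Eu d, perExt (c • u : L2Cell d) x = c * perExt u x :=
  ae_fractVec (p := fun x => (c • u : L2Cell d) x = c * u x) (Lp.coeFn_smul c u)

lemma perExt_zero (d : ℕ) : ∀ᵐ x : Eu d, perExt (0 : L2Cell d) x = 0 :=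
  ae_fractVec (p := fun x => (0 : L2Cell d) x = 0) (Lp.coeFn_zero _ _ _)

lemma ae_fst {d : ℕ} {p : Eu d → Prop} (h : ∀ᵐ x : Eu d, p x) :
    ∀ᵐ z : Eu d × Eu d, p z.1 :=
  Measure.quasiMeasurePreserving_fst.ae h

lemma ae_snd {d : ℕ} {p : Eu d → Prop} (h : ∀ᵐ x : Eu d, p x) :
    ∀ᵐ z : Eu d × Eu d, p z.2 :=
  Measure.quasiMeasurePreserving_snd.ae h

/-! ### The periodic Sobolev space -/

/-- The Gagliardo difference quotient of order `s` of the periodic extension of `u`. -/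
def gagliardo {d : ℕ} (s : ℝ) (u : Eu d → ℂ) (p : Eu d × Eu d) : ℂ :=
  ((‖p.1 - p.2‖ ^ ((d : ℝ) / 2 + s))⁻¹ : ℝ) • (perExt u p.1 - perExt u p.2)

/-- For `0 < s < 1`, the space of all `u ∈ L₂(Ω)` whose `ℤ^d`-periodic extension lies in
`H^s_loc(ℝ^d)`: its Gagliardo seminorm
`∬_{B × B} |u(x) - u(y)|² / |x - y|^{d+2s} dx dy` is finite for every ball `B`. -/
def perSobolev (d : ℕ) (s : ℝ) : Submodule ℂ (L2Cell d) where
  carrier := {u | ∀ r : ℝ, 0 < r → MemLp (gagliardo s (u : Eu d → ℂ)) 2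
    (volume.restrict (Metric.ball (0 : Eu d) r ×ˢ Metric.ball (0 : Eu d) r))}
  add_mem' := by
    intro u v hu hv r hr
    refine ((hu r hr).add (hv r hr)).ae_eq ?_
    refine ae_restrict_of_ae ?_
    filter_upwards [ae_fst (perExt_add u v), ae_snd (perExt_add u v)] with p h1 h2
    simp only [gagliardo, Pi.add_apply, h1, h2, ← smul_add]
    congr 1
    ring
  zero_mem' := by
    intro r hr
    refine (MemLp.zero (ε := ℂ)).ae_eq ?_
    refine ae_restrict_of_ae ?_
    filter_upwards [ae_fst (perExt_zero d), ae_snd (perExt_zero d)] with p h1 h2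
    simp only [gagliardo, h1, h2, sub_zero, smul_zero, Pi.zero_apply]
  smul_mem' := by
    intro c u hu r hr
    refine ((hu r hr).const_smul c).ae_eq ?_
    refine ae_restrict_of_ae ?_
    filter_upwards [ae_fst (perExt_smul c u), ae_snd (perExt_smul c u)] with p h1 h2
    simp only [gagliardo, Pi.smul_apply, h1, h2, smul_comm c, smul_eq_mul, ← mul_sub]

/-! ### The quadratic forms and the fibre operators -/

/-- Lebesgue measure on `Ω × ℝ^d`. -/
def pairMeasure (d : ℕ) : Measure (Eu d × Eu d) := (cellMeasure d).prod volume

/-- `e^{i⟨ξ,x⟩} u(x) - e^{i⟨ξ,y⟩} u(y)` at `p = (x, y)`, with `u` extended periodically. -/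
def quasiDiff {d : ℕ} (ξ : Eu d) (u : Eu d → ℂ) (p : Eu d × Eu d) : ℂ :=
  Complex.exp (Complex.I * (inner ℝ ξ p.1 : ℝ)) * perExt u p.1
    - Complex.exp (Complex.I * (inner ℝ ξ p.2 : ℝ)) * perExt u p.2

/-- The Lévy kernel `μ(x,y) / |x - y|^{d+α}`. -/
def levyKernel {d : ℕ} (α : ℝ) (μ : Eu d × Eu d → ℝ) (p : Eu d × Eu d) : ℝ :=
  μ p / ‖p.1 - p.2‖ ^ ((d : ℝ) + α)

/-- The integrand of the sesquilinear form `a(ξ)[u,v]`. -/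
def formIntegrand {d : ℕ} (α : ℝ) (μ : Eu d × Eu d → ℝ) (ξ : Eu d) (u v : Eu d → ℂ)
    (p : Eu d × Eu d) : ℂ :=
  (levyKernel α μ p : ℂ) * (quasiDiff ξ u p * (starRingEnd ℂ) (quasiDiff ξ v p))

/-- The sesquilinear form `a(ξ)[u,v]`. -/
def fiberForm {d : ℕ} (α : ℝ) (μ : Eu d × Eu d → ℝ) (ξ : Eu d) (u v : Eu d → ℂ) : ℂ :=
  (1 / 2) * ∫ p, formIntegrand α μ ξ u v p ∂(pairMeasure d)

lemma pairMeasure_absolutelyContinuous (d : ℕ) :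
    pairMeasure d ≪ (volume : Measure (Eu d × Eu d)) :=
  Measure.AbsolutelyContinuous.prod Measure.restrict_le_self.absolutelyContinuous
    Measure.AbsolutelyContinuous.rfl

lemma formIntegrand_add {d : ℕ} (α : ℝ) (μ : Eu d × Eu d → ℝ) (ξ : Eu d) (u₁ u₂ : L2Cell d)
    (v : Eu d → ℂ) :
    formIntegrand α μ ξ (u₁ + u₂ : L2Cell d) v =ᵐ[pairMeasure d]
      fun p => formIntegrand α μ ξ u₁ v p + formIntegrand α μ ξ u₂ v p := by
  refine (pairMeasure_absolutelyContinuous d).ae_le ?_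
  filter_upwards [ae_fst (perExt_add u₁ u₂), ae_snd (perExt_add u₁ u₂)] with p h1 h2
  simp only [formIntegrand, quasiDiff, h1, h2]
  ring

lemma formIntegrand_smul {d : ℕ} (α : ℝ) (μ : Eu d × Eu d → ℝ) (ξ : Eu d) (c : ℂ)
    (u : L2Cell d) (v : Eu d → ℂ) :
    formIntegrand α μ ξ (c • u : L2Cell d) v =ᵐ[pairMeasure d]
      fun p => c * formIntegrand α μ ξ u v p := by
  refine (pairMeasure_absolutelyContinuous d).ae_le ?_
  filter_upwards [ae_fst (perExt_smul c u), ae_snd (perExt_smul c u)] with p h1 h2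
  simp only [formIntegrand, quasiDiff, h1, h2]
  ring

lemma formIntegrand_zero {d : ℕ} (α : ℝ) (μ : Eu d × Eu d → ℝ) (ξ : Eu d) (v : Eu d → ℂ) :
    formIntegrand α μ ξ (0 : L2Cell d) v =ᵐ[pairMeasure d] fun _ => 0 := by
  refine (pairMeasure_absolutelyContinuous d).ae_le ?_
  filter_upwards [ae_fst (perExt_zero d), ae_snd (perExt_zero d)] with p h1 h2
  simp only [formIntegrand, quasiDiff, h1, h2, mul_zero, sub_zero, zero_mul]

/-- The graph of the operator generated by the form `a(ξ)` with domain `H̃^{α/2}(Ω)`: the pairs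
`(u, f)` such that `u` is in the form domain and `a(ξ)[u,v] = (f,v)` for all `v` in the form
domain. (The integral defining the form converges absolutely on the form domain.) -/
def fiberGraph {d : ℕ} (α : ℝ) (μ : Eu d × Eu d → ℝ) (ξ : Eu d) :
    Submodule ℂ (L2Cell d × L2Cell d) where
  carrier := {w | w.1 ∈ perSobolev d (α / 2) ∧ ∀ v ∈ perSobolev d (α / 2),
    Integrable (formIntegrand α μ ξ w.1 v) (pairMeasure d) ∧
      fiberForm α μ ξ w.1 v = inner ℂ v w.2}
  add_mem' := by
    intro w₁ w₂ h₁ h₂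
    refine ⟨add_mem h₁.1 h₂.1, fun v hv => ?_⟩
    have e := formIntegrand_add α μ ξ w₁.1 w₂.1 v
    obtain ⟨i₁, f₁⟩ := h₁.2 v hv
    obtain ⟨i₂, f₂⟩ := h₂.2 v hv
    refine ⟨(i₁.add i₂).congr e.symm, ?_⟩
    simp only [fiberForm] at f₁ f₂ ⊢
    rw [Prod.fst_add, Prod.snd_add, inner_add_right, ← f₁, ← f₂, integral_congr_ae e,
      integral_add i₁ i₂, mul_add]
  zero_mem' := by
    refine ⟨zero_mem _, fun v _ => ?_⟩
    have e := formIntegrand_zero α μ ξ (v : Eu d → ℂ)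
    refine ⟨(integrable_zero _ _ _).congr e.symm, ?_⟩
    simp only [fiberForm]
    rw [Prod.fst_zero, Prod.snd_zero, inner_zero_right, integral_congr_ae e]
    simp
  smul_mem' := by
    intro c w h
    refine ⟨Submodule.smul_mem _ c h.1, fun v hv => ?_⟩
    have e := formIntegrand_smul α μ ξ c w.1 v
    obtain ⟨i, f⟩ := h.2 v hv
    refine ⟨(i.const_mul c).congr e.symm, ?_⟩
    simp only [fiberForm] at f ⊢
    rw [Prod.smul_fst, Prod.smul_snd, inner_smul_right, ← f, integral_congr_ae e,
      integral_const_mul]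
    ring

/-- The (unbounded) operator `𝔸(ξ)` in `L₂(Ω)` generated by the form `a(ξ)`. -/
def fiberOperator {d : ℕ} (α : ℝ) (μ : Eu d × Eu d → ℝ) (ξ : Eu d) : L2Cell d →ₗ.[ℂ] L2Cell d :=
  (fiberGraph α μ ξ).toLinearPMap

/-- The bounded operator `R` is the inverse `(A + c I)⁻¹` of the unbounded operator `A + c I`. -/
def IsShiftedInverse {H : Type*} [NormedAddCommGroup H] [NormedSpace ℂ H]
    (A : H →ₗ.[ℂ] H) (c : ℝ) (R : H →L[ℂ] H) : Prop :=
  (∀ u : A.domain, R (A u + (c : ℂ) • (u : H)) = u) ∧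
    ∀ f : H, ∃ h : R f ∈ A.domain, A ⟨R f, h⟩ + (c : ℂ) • R f = f

/-- The constant function `𝟏_Ω`. -/
def oneCell (d : ℕ) : L2Cell d := (memLp_const (1 : ℂ)).toLp (fun _ => (1 : ℂ))

/-- The orthogonal projection `P` of `L₂(Ω)` onto the constants. -/
def constProj (d : ℕ) : L2Cell d →L[ℂ] L2Cell d :=
  (Submodule.span ℂ {oneCell d}).starProjection

/-! ### The coefficient and the effective characteristics -/

/-- The conditions on the coefficient `μ ∈ L_∞(ℝ^d × ℝ^d)`. -/
structure IsCoefficient {d : ℕ} (μm μp : ℝ) (μ : Eu d × Eu d → ℝ) : Prop where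
  measurable : AEStronglyMeasurable μ volume
  bounds : ∀ᵐ p : Eu d × Eu d, μm ≤ μ p ∧ μ p ≤ μp
  symm : ∀ᵐ p : Eu d × Eu d, μ (p.2, p.1) = μ p
  periodic : ∀ m n : Fin d → ℤ, ∀ᵐ p : Eu d × Eu d,
    μ (p.1 + latticeVec m, p.2 + latticeVec n) = μ p

/-- `μ⁰`, the mean value of `μ` over `Ω × Ω`. -/
def muZero {d : ℕ} (μ : Eu d × Eu d → ℝ) : ℝ :=
  ∫ p, μ p ∂((cellMeasure d).prod (cellMeasure d))

/-- `c₀(d,α) = ∫ (1 - cos z₁) / |z|^{d+α} dz`. -/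
def cZero (d : ℕ) [NeZero d] (α : ℝ) : ℝ :=
  ∫ z : Eu d, (1 - Real.cos (z 0)) / ‖z‖ ^ ((d : ℝ) + α)

/-- `v` is a solution of the `k`-th cell problem: it belongs to `H̃^{α/2}(Ω)`, has zero mean, and
`∬ μ(x,y) |x-y|^{-d-α} (v(x) - v(y) + x_k - y_k) conj(η(x) - η(y)) dx dy = 0` over `Ω × ℝ^d` for
all `η ∈ H̃^{α/2}(Ω)`. -/
def IsCellSolution {d : ℕ} (α : ℝ) (μ : Eu d × Eu d → ℝ) (k : Fin d) (v : L2Cell d) : Prop :=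
  v ∈ perSobolev d (α / 2) ∧ ∫ x, v x ∂(cellMeasure d) = 0 ∧
    ∀ η ∈ perSobolev d (α / 2),
      ∫ p : Eu d × Eu d, (levyKernel α μ p : ℂ) *
        ((perExt v p.1 - perExt v p.2 + ((p.1 k - p.2 k : ℝ) : ℂ)) *
          (starRingEnd ℂ) (perExt η p.1 - perExt η p.2)) ∂(pairMeasure d) = 0

/-- `μ_*(z) = ∫_Ω μ(x, z + x) dx - μ⁰`. -/
def muStar {d : ℕ} (μ : Eu d × Eu d → ℝ) (z : Eu d) : ℝ :=
  (∫ x, μ (x, z + x) ∂(cellMeasure d)) - muZero μ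

/-- The shifted cell `Ω + n`. -/
def shiftedCell {d : ℕ} (n : Fin d → ℤ) : Set (Eu d) := {z | z - latticeVec n ∈ unitCell d}

/-- The matrix `g⁰`, computed from the solutions `v k` of the cell problems (which are real-valued);
the last integral over `ℝ^d` is the sum of the integrals over the cells `Ω + n`. -/
def gZero {d : ℕ} (α : ℝ) (μ : Eu d × Eu d → ℝ) (v : Fin d → L2Cell d) :
    Matrix (Fin d) (Fin d) ℝ :=
  Matrix.of fun j k =>
    (1 / 4) * (∫ p : Eu d × Eu d, levyKernel α μ p *
        ((p.1 j - p.2 j) * (perExt (v k) p.1 - perExt (v k) p.2).re +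
          (p.1 k - p.2 k) * (perExt (v j) p.1 - perExt (v j) p.2).re) ∂(pairMeasure d))
    + ∑' n : Fin d → ℤ,
        ∫ z in shiftedCell n, muStar μ z * z j * z k / (2 * ‖z‖ ^ ((d : ℝ) + α))

/-- The quadratic form `⟨g ξ, ξ⟩`. -/
def quadForm {d : ℕ} (g : Matrix (Fin d) (Fin d) ℝ) (ξ : Eu d) : ℝ :=
  ∑ j, ∑ k, g j k * ξ k * ξ j

/-- The number `μ⁰ c₀ |ξ|^α + ⟨g⁰ ξ, ξ⟩ + ε^α`. -/
def thresholdDenom {d : ℕ} [NeZero d] (α : ℝ) (μ : Eu d × Eu d → ℝ) (v : Fin d → L2Cell d)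
    (ξ : Eu d) (ε : ℝ) : ℝ :=
  muZero μ * cZero d α * ‖ξ‖ ^ α + quadForm (gZero α μ v) ξ + ε ^ α

/-! ### The radius `δ_*` -/

/-- `ω_d`, the surface area of the unit sphere of `ℝ^d`. -/
def sphereArea (d : ℕ) : ℝ := (volume : Measure (Eu d)).toSphere.real univ

/-- `δ₀ = π (μ₋ / (3 μ₊))^{1/α}`. -/
def deltaZero (α μm μp : ℝ) : ℝ := Real.pi * (μm / (3 * μp)) ^ (1 / α)

/-- `d₀ = μ₋ c₀ π^α`. -/
def dZero (d : ℕ) [NeZero d] (α μm : ℝ) : ℝ := μm * cZero d α * Real.pi ^ α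

/-- `c₃ = (ω_d / (2 (2 - α)))^{1/2} + ω_d / (α - 1)`. -/
def cThree (d : ℕ) (α : ℝ) : ℝ :=
  Real.sqrt (sphereArea d / (2 * (2 - α))) + sphereArea d / (α - 1)

/-- The constant bounding the corrector part of `g⁰`. -/
def cSeven (d : ℕ) [NeZero d] (α μm μp : ℝ) : ℝ :=
  (3 + 3 * μp / dZero d α μm) ^ 2 * cThree d α ^ 2 / μp *
    (1 + (μp + 2 * dZero d α μm / 3) * (3 + 3 * μp / dZero d α μm) / μp) *
    ((dZero d α μm * (2 * Real.pi + 2) / 3) * dZero d α μm / (3 * Real.pi))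

/-- `R = √d 2^{1/(d+α)} / (2^{1/(d+α)} - 1)`, the root of `(R / (R - √d))^{d+α} = 2`. -/
def bigR (d : ℕ) (α : ℝ) : ℝ :=
  Real.sqrt d * (2 : ℝ) ^ (1 / ((d : ℝ) + α)) / ((2 : ℝ) ^ (1 / ((d : ℝ) + α)) - 1)

/-- The constant bounding the part of `g⁰` that comes from `μ_*`. -/
def cFour (d : ℕ) (α : ℝ) : ℝ :=
  sphereArea d * ((bigR d α + Real.sqrt d) ^ (2 - α) / (2 * (2 - α)) +
    ((d : ℝ) + α + 1) / ((α - 1) * bigR d α ^ (α - 1)))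

/-- The constant `C` in `|⟨g⁰ ξ, ξ⟩| ≤ C |ξ|²`. -/
def cTwelve (d : ℕ) [NeZero d] (α μm μp : ℝ) : ℝ :=
  d * cSeven d α μm μp + cFour d α * μp

/-- `δ_* = min {δ₀, (μ⁰ c₀ / (2 C))^{1/(2-α)}}`. -/
def deltaStar {d : ℕ} [NeZero d] (α μm μp : ℝ) (μ : Eu d × Eu d → ℝ) : ℝ :=
  min (deltaZero α μm μp)
    ((muZero μ * cZero d α / (2 * cTwelve d α μm μp)) ^ (1 / (2 - α)))

end

end LevyType

open LevyType

namespace LevyType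

noncomputable section

set_option linter.unusedSectionVars false

/-! ### Periodic functions and the unit torus -/

/-! The form is a square: `a(ξ)[u,v]` is the scalar product of `T(ξ)u` and `T(ξ)v`, where `T(ξ)u` is
the root of half the Lévy kernel times `u(x) - exp(i⟨ξ,y-x⟩)u(y)` (`Setting.formMap`). This map is
closed on the periodic Sobolev space, so `exists_riesz` supplies both the resolvent and the cell
solutions; afterwards only the weak equation for `u = (𝔸(ξ) + ε^α)⁻¹ f` is used.

Parseval in `x` for each fixed `z = y - x` diagonalizes the energy with kernel `|x-y|^{-d-α}`, with
symbol `2c₀|2πn+ξ|^α` (`lintegral_twistDiff`). Hence, for `|ξ| ≤ π`, the form is at least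
`μ₋c₀|ξ|^α‖u‖²`, and at least `d₀‖u‖²` on functions of zero mean. Only the direction of the
constants degenerates, and the proof is a Schur complement onto it.

The coupling `a(ξ)[𝟏,η]` is a functional linear in `ξ` plus `O(|ξ|^α‖η‖)` (`norm_form_one_sub_le`).
Since `α > 1`, the linear part dominates; the corrector `ψ = i∑ξ_k v_k` cancels it. Write `u = c𝟏 +
cψ + r`, where `c` is the mean of `u`. Testing with `r` gives `r = O(‖f‖)`; testing with `𝟏` gives
`cD = (f,𝟏) + O(|ξ|‖f‖)`, where `D` is the threshold denominator, equal to `‖T(ξ)𝟏‖² - ‖T(0)ψ‖² +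
ε^α` up to `O(|ξ|^{1+α})` (`norm_resolvent_sub_le`).

To evaluate `‖T(ξ)𝟏‖²`, integrate `(μ⁰ + μ_*(z))(1 - cos⟨ξ,z⟩)/|z|^{d+α}`. The mean gives
`μ⁰c₀|ξ|^α` by rotation and scaling. In the `μ_*` part the cosine is expanded to second order; the
quadratic kernel is not integrable at infinity, but `μ_*` is periodic with zero mean, so each cell
integral only sees the oscillation of the kernel and the cell sums converge (`CellDominated.cell`).
The quadratic term, together with `-‖T(0)ψ‖²`, is `⟨g⁰ξ,ξ⟩`.

The radius `δ_*` keeps `D` above a multiple of `|ξ|^α + ε^α`, and `|ξ| ≤ ε^{1-α}(|ξ|^α + ε^α)` turns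
the error `O(|ξ|/D)` into `O(ε^{1-α})`. The remaining `O(‖f‖)` is admissible for `ε ≤ 1`; for `ε ≥
1` both operators are already of norm at most `ε^{-α}`. -/

lemma continuous_coord {d : ℕ} (i : Fin d) : Continuous fun x : Eu d => x i := by fun_prop

lemma measurable_fractVec (d : ℕ) : Measurable (fractVec : Eu d → Eu d) := by
  refine (WithLp.measurable_toLp 2 (Fin d → ℝ)).comp (measurable_pi_lambda _ fun i => ?_)
  exact measurable_fract.comp (continuous_coord i).measurable

lemma fractVec_of_mem {d : ℕ} {x : Eu d} (hx : x ∈ unitCell d) : fractVec x = x := by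
  ext i
  exact Int.fract_eq_self.2 (hx i)

/-- The projection of `ℝ^d` onto the unit torus. -/
def torusMk {d : ℕ} (x : Eu d) : UnitAddTorus (Fin d) := fun i => (x i : UnitAddCircle)

/-- The section of the projection onto the unit torus with values in `Ω`. -/
def torusSec {d : ℕ} (t : UnitAddTorus (Fin d)) : Eu d :=
  WithLp.toLp 2 fun i => (AddCircle.equivIco 1 0 (t i) : ℝ)

lemma measurable_torusMk (d : ℕ) : Measurable (torusMk : Eu d → UnitAddTorus (Fin d)) :=
  measurable_pi_lambda _ fun i => AddCircle.measurable_mk'.comp (continuous_coord i).measurable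

lemma measurable_torusSec (d : ℕ) : Measurable (torusSec : UnitAddTorus (Fin d) → Eu d) := by
  refine (WithLp.measurable_toLp 2 (Fin d → ℝ)).comp (measurable_pi_lambda _ fun i => ?_)
  exact measurable_subtype_coe.comp
    ((AddCircle.measurableEquivIco 1 0).measurable.comp (measurable_pi_apply i))

lemma torusSec_torusMk {d : ℕ} (x : Eu d) : torusSec (torusMk x) = fractVec x := by
  ext i
  simp only [torusSec, torusMk, fractVec]
  rw [AddCircle.coe_equivIco_mk_apply]
  simp

lemma torusMk_add {d : ℕ} (x y : Eu d) : torusMk (x + y) = torusMk x + torusMk y := by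
  ext i
  simp [torusMk]

lemma torusMk_torusSec {d : ℕ} (t : UnitAddTorus (Fin d)) : torusMk (torusSec t) = t := by
  ext i
  simp only [torusSec, torusMk]
  exact (AddCircle.equivIco 1 0).symm_apply_apply (t i)

/-- The Haar probability measure of the unit torus. -/
abbrev torusMeasure (d : ℕ) : Measure (UnitAddTorus (Fin d)) :=
  Measure.pi fun _ => (AddCircle.haarAddCircle : Measure UnitAddCircle)

lemma measurePreserving_torusMk (d : ℕ) :
    MeasurePreserving (torusMk : Eu d → UnitAddTorus (Fin d)) (cellMeasure d) (torusMeasure d) := by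
  have h1 : MeasurePreserving (WithLp.ofLp : Eu d → Fin d → ℝ) (cellMeasure d)
      (Measure.pi fun _ => volume.restrict (Ioc (0 : ℝ) (0 + 1))) := by
    have h := (PiLp.volume_preserving_ofLp (Fin d)).restrict_preimage
      (s := univ.pi fun _ => Ico (0 : ℝ) 1) (MeasurableSet.univ_pi fun _ => measurableSet_Ico)
    have e : (WithLp.ofLp : Eu d → Fin d → ℝ) ⁻¹' (univ.pi fun _ => Ico (0 : ℝ) 1) =
        unitCell d := by
      ext x
      simp [unitCell]
    rw [e, volume_pi, Measure.restrict_pi_pi] at h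
    rw [zero_add, ← Measure.restrict_congr_set Ico_ae_eq_Ioc]
    exact h
  have h2 : MeasurePreserving (fun (x : Fin d → ℝ) i => (x i : UnitAddCircle))
      (Measure.pi fun _ => volume.restrict (Ioc (0 : ℝ) (0 + 1)))
      (torusMeasure d) := by
    refine measurePreserving_pi _ _ fun _ => ?_
    have h := UnitAddCircle.measurePreserving_mk 0
    rwa [AddCircle.volume_eq_smul_haarAddCircle, ENNReal.ofReal_one, one_smul] at h
  exact h2.comp h1

lemma measurePreserving_torusSec (d : ℕ) :
    MeasurePreserving (torusSec : UnitAddTorus (Fin d) → Eu d) (torusMeasure d) (cellMeasure d) := by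
  refine ⟨measurable_torusSec d, ?_⟩
  rw [← (measurePreserving_torusMk d).map_eq,
    Measure.map_map (measurable_torusSec d) (measurable_torusMk d)]
  have : (torusSec ∘ torusMk : Eu d → Eu d) =ᵐ[cellMeasure d] id := by
    filter_upwards [ae_restrict_mem (measurableSet_unitCell d)] with x hx
    rw [Function.comp_apply, torusSec_torusMk, fractVec_of_mem hx, id]
  rw [Measure.map_congr this, Measure.map_id]

/-- Modulo the lattice this is a translation of the torus, which preserves Haar measure; the torus
serves only for this invariance and for Fourier series. -/
lemma measurePreserving_fractVec_add {d : ℕ} (z : Eu d) :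
    MeasurePreserving (fun x => fractVec (x + z)) (cellMeasure d) (cellMeasure d) := by
  have h := (measurePreserving_torusSec d).comp
    ((measurePreserving_add_right (torusMeasure d) (torusMk z)).comp (measurePreserving_torusMk d))
  convert h using 1
  ext1 x
  simp only [Function.comp_apply, ← torusMk_add, torusSec_torusMk]

instance cellMeasure_isProbability (d : ℕ) : IsProbabilityMeasure (cellMeasure d) := by
  have h := (measurePreserving_torusMk d).measure_preimage (s := univ) MeasurableSet.univ.nullMeasurableSet
  refine ⟨?_⟩
  rw [preimage_univ] at h
  rw [h]
  exact measure_univ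

/-! ### Integration over `Ω × ℝ^d` -/

lemma integral_comp_of_measurePreserving {X Y E : Type*} [MeasurableSpace X] [MeasurableSpace Y]
    [NormedAddCommGroup E] [NormedSpace ℝ E] {m : Measure X} {n : Measure Y} {f : X → Y}
    (hf : MeasurePreserving f m n) {g : Y → E} (hg : AEStronglyMeasurable g n) :
    ∫ x, g (f x) ∂m = ∫ y, g y ∂n := by
  have h : AEStronglyMeasurable g (m.map f) := hf.map_eq.symm ▸ hg
  rw [← integral_map hf.aemeasurable h, hf.map_eq]

lemma measurePreserving_shear (d : ℕ) :
    MeasurePreserving (fun p : Eu d × Eu d => (p.1, p.1 + p.2)) (pairMeasure d) (pairMeasure d) :=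
  measurePreserving_prod_add (cellMeasure d) volume

/-- Substitute `y = x + z`, a measure preserving shear, and apply Tonelli. With the displacement `z`
outermost, the kernel is constant in the inner integral. -/
lemma lintegral_pair {d : ℕ} {F : Eu d × Eu d → ENNReal} (hF : AEMeasurable F (pairMeasure d)) :
    ∫⁻ p, F p ∂(pairMeasure d) = ∫⁻ z, ∫⁻ x, F (x, x + z) ∂(cellMeasure d) := by
  rw [← (measurePreserving_shear d).lintegral_comp_emb
    (MeasurableEquiv.shearAddRight (Eu d)).measurableEmbedding]
  have h : AEMeasurable (fun p : Eu d × Eu d => F (p.1, p.1 + p.2)) (pairMeasure d) :=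
    hF.comp_quasiMeasurePreserving (measurePreserving_shear d).quasiMeasurePreserving
  exact lintegral_prod_symm _ h

lemma lintegral_pair_fst {d : ℕ} {G h : Eu d → ENNReal} (hG : Measurable G) (hh : Measurable h) :
    ∫⁻ p, G (p.2 - p.1) * h p.1 ∂(pairMeasure d) =
      (∫⁻ z, G z) * ∫⁻ x, h x ∂(cellMeasure d) := by
  rw [lintegral_pair (by fun_prop)]
  simp only [add_sub_cancel_left]
  simp_rw [lintegral_const_mul _ hh]
  exact lintegral_mul_const _ hG

/-- For fixed displacement the second point, reduced to the cell, is again uniformly distributed in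
`Ω`, so it contributes exactly as the first one does. -/
lemma lintegral_pair_snd {d : ℕ} {G h : Eu d → ENNReal} (hG : Measurable G) (hh : Measurable h) :
    ∫⁻ p, G (p.2 - p.1) * h (fractVec p.2) ∂(pairMeasure d) =
      (∫⁻ z, G z) * ∫⁻ x, h x ∂(cellMeasure d) := by
  have := measurable_fractVec d
  rw [lintegral_pair (by fun_prop)]
  simp only [add_sub_cancel_left]
  rw [← lintegral_mul_const _ hG]
  refine lintegral_congr fun z => ?_
  rw [lintegral_const_mul _ (by fun_prop)]
  congr 1
  exact (measurePreserving_fractVec_add z).lintegral_comp hh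

/-! ### The radial kernel -/

/-- The kernel `|z|^{-d-α}`. -/
def radialKernel {d : ℕ} (α : ℝ) (z : Eu d) : ℝ := (‖z‖ ^ ((d : ℝ) + α))⁻¹

lemma radialKernel_nonneg {d : ℕ} (α : ℝ) (z : Eu d) : 0 ≤ radialKernel α z := by
  unfold radialKernel; positivity

@[fun_prop]
lemma measurable_radialKernel {d : ℕ} (α : ℝ) : Measurable (radialKernel α : Eu d → ℝ) := by
  unfold radialKernel; fun_prop

lemma levyKernel_eq {d : ℕ} (α : ℝ) (μ : Eu d × Eu d → ℝ) (p : Eu d × Eu d) :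
    levyKernel α μ p = μ p * radialKernel α (p.2 - p.1) := by
  rw [levyKernel, radialKernel, norm_sub_rev, div_eq_mul_inv]

section Radial

variable {d : ℕ} [NeZero d]

instance : Nontrivial (Eu d) :=
  inferInstanceAs (Nontrivial (WithLp 2 (Fin d → ℝ)))

lemma sphereArea_eq (d : ℕ) : sphereArea d = d * (volume : Measure (Eu d)).real (Metric.ball 0 1) := by
  rw [sphereArea, Measure.toSphere_real_apply_univ, finrank_euclideanSpace_fin]

lemma sphereArea_pos (d : ℕ) [NeZero d] : 0 < sphereArea d := by
  rw [sphereArea_eq]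
  have h : 0 < (volume : Measure (Eu d)).real (Metric.ball 0 1) :=
    ENNReal.toReal_pos (Metric.measure_ball_pos _ _ one_pos).ne' measure_ball_lt_top.ne
  have : 0 < (d : ℝ) := by exact_mod_cast NeZero.pos d
  positivity

/-! ### Polar coordinates, scaling and rotation invariance of the kernel -/

lemma pow_smul_indicator_rpow {s : Set ℝ} (hs : s ⊆ Ioi 0) (β : ℝ) :
    (fun y : ℝ => y ^ (d - 1) • s.indicator (fun y => y ^ (β - d)) y) =
      s.indicator fun y => y ^ (β - 1) := by
  ext y
  by_cases hy : y ∈ s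
  · have h0 : 0 < y := hs hy
    rw [indicator_of_mem hy, indicator_of_mem hy, smul_eq_mul, ← Real.rpow_natCast,
      ← Real.rpow_add h0, Nat.cast_sub (NeZero.one_le)]
    congr 1
    push_cast
    ring
  · rw [indicator_of_notMem hy, indicator_of_notMem hy, smul_zero]

/-- Polar coordinates. The exponent is written `β - d` so that the Jacobian `y^{d-1}` turns it into
`β - 1`, whatever the dimension. -/
lemma radial_indicator {s : Set ℝ} (hs : s ⊆ Ioi 0) (hm : MeasurableSet s) (β : ℝ)
    (hi : IntegrableOn (fun y : ℝ => y ^ (β - 1)) s) :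
    Integrable (fun z : Eu d => s.indicator (fun y => y ^ (β - d)) ‖z‖) ∧
      ∫ z : Eu d, s.indicator (fun y => y ^ (β - d)) ‖z‖ =
        sphereArea d * ∫ y in s, y ^ (β - 1) := by
  have e := pow_smul_indicator_rpow (d := d) hs β
  have hss : Ioi 0 ∩ s = s := inter_eq_right.2 hs
  constructor
  · rw [integrable_fun_norm_addHaar (volume : Measure (Eu d)) (f := s.indicator fun y => y ^ (β - d)),
      finrank_euclideanSpace_fin, e]
    exact ((integrable_indicator_iff hm).2 hi).integrableOn
  · rw [integral_fun_norm_addHaar (volume : Measure (Eu d)) (s.indicator fun y => y ^ (β - d)),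
      finrank_euclideanSpace_fin, e, setIntegral_indicator hm, hss, sphereArea_eq, nsmul_eq_mul,
      smul_eq_mul, mul_assoc]

variable {α : ℝ}

lemma norm_sq_mul_radialKernel (z : Eu d) (hz : z ≠ 0) :
    ‖z‖ ^ 2 * radialKernel α z = ‖z‖ ^ ((2 - α) - d) := by
  have h0 : 0 < ‖z‖ := norm_pos_iff.2 hz
  rw [radialKernel, ← Real.rpow_natCast, ← Real.rpow_neg h0.le, ← Real.rpow_add h0]
  congr 1
  push_cast
  ring

lemma norm_mul_radialKernel (z : Eu d) (hz : z ≠ 0) :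
    ‖z‖ * radialKernel α z = ‖z‖ ^ ((1 - α) - d) := by
  have h0 : 0 < ‖z‖ := norm_pos_iff.2 hz
  nth_rw 1 [← Real.rpow_one ‖z‖]
  rw [radialKernel, ← Real.rpow_neg h0.le, ← Real.rpow_add h0]
  congr 1
  ring

/-- The second moment of the kernel at the origin: this is where `α < 2` is needed. -/
lemma radial_near (hα : α < 2) {r : ℝ} (hr : 0 < r) :
    IntegrableOn (fun z : Eu d => ‖z‖ ^ 2 * radialKernel α z) (Metric.ball 0 r) ∧
      ∫ z in Metric.ball (0 : Eu d) r, ‖z‖ ^ 2 * radialKernel α z =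
        sphereArea d * (r ^ (2 - α) / (2 - α)) := by
  have hi : IntegrableOn (fun y : ℝ => y ^ ((2 - α) - 1)) (Ioo 0 r) := by
    refine IntegrableOn.mono_set ?_ Ioo_subset_Ioc_self
    rw [← intervalIntegrable_iff_integrableOn_Ioc_of_le hr.le]
    exact intervalIntegral.intervalIntegrable_rpow' (by linarith)
  have h := radial_indicator (d := d) (s := Ioo 0 r) (fun y hy => hy.1) measurableSet_Ioo (2 - α) hi
  have e : (fun z : Eu d => (Ioo 0 r).indicator (fun y => y ^ ((2 - α) - d)) ‖z‖) =ᵐ[volume]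
      (Metric.ball 0 r).indicator fun z : Eu d => ‖z‖ ^ 2 * radialKernel α z := by
    filter_upwards [compl_mem_ae_iff.2 (measure_singleton (0 : Eu d))] with z hz
    have h0 : 0 < ‖z‖ := norm_pos_iff.2 hz
    by_cases hzr : ‖z‖ < r
    · rw [indicator_of_mem (show ‖z‖ ∈ Ioo 0 r from ⟨h0, hzr⟩), indicator_of_mem (mem_ball_zero_iff.2 hzr),
        norm_sq_mul_radialKernel z hz]
    · rw [indicator_of_notMem fun h => hzr h.2,
        indicator_of_notMem fun h => hzr (mem_ball_zero_iff.1 h)]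
  refine ⟨(integrable_indicator_iff measurableSet_ball).1 (h.1.congr e), ?_⟩
  rw [← integral_indicator measurableSet_ball, ← integral_congr_ae e, h.2,
    ← integral_Ioc_eq_integral_Ioo, ← intervalIntegral.integral_of_le hr.le,
    integral_rpow (Or.inl (by linarith))]
  congr 1
  rw [show 2 - α - 1 + 1 = 2 - α by ring, Real.zero_rpow (by linarith), sub_zero]

/-- The first moment at infinity: this is where `α > 1` is needed. -/
lemma radial_far (hα : 1 < α) {r : ℝ} (hr : 0 < r) :
    IntegrableOn (fun z : Eu d => ‖z‖ * radialKernel α z) (Metric.ball 0 r)ᶜ ∧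
      ∫ z in (Metric.ball (0 : Eu d) r)ᶜ, ‖z‖ * radialKernel α z =
        sphereArea d * (r ^ (1 - α) / (α - 1)) := by
  have hi : IntegrableOn (fun y : ℝ => y ^ ((1 - α) - 1)) (Ici r) := by
    rw [integrableOn_Ici_iff_integrableOn_Ioi]
    exact integrableOn_Ioi_rpow_of_lt (by linarith) hr
  have h := radial_indicator (d := d) (s := Ici r) (fun y hy => hr.trans_le hy) measurableSet_Ici
    (1 - α) hi
  have e : (fun z : Eu d => (Ici r).indicator (fun y => y ^ ((1 - α) - d)) ‖z‖) =ᵐ[volume]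
      (Metric.ball 0 r)ᶜ.indicator fun z : Eu d => ‖z‖ * radialKernel α z := by
    filter_upwards [compl_mem_ae_iff.2 (measure_singleton (0 : Eu d))] with z hz
    by_cases hzr : ‖z‖ < r
    · rw [indicator_of_notMem (by simpa using hzr), indicator_of_notMem (by simpa using hzr)]
    · rw [indicator_of_mem (by simpa using hzr), indicator_of_mem (by simpa using hzr),
        norm_mul_radialKernel z hz]
  refine ⟨(integrable_indicator_iff measurableSet_ball.compl).1 (h.1.congr e), ?_⟩
  rw [← integral_indicator measurableSet_ball.compl, ← integral_congr_ae e, h.2,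
    integral_Ici_eq_integral_Ioi, integral_Ioi_rpow_of_lt (by linarith) hr]
  congr 1
  rw [show 1 - α - 1 + 1 = -(α - 1) by ring, show 1 - α = -(α - 1) by ring, neg_div_neg_eq]

/-- The function `min (t², t)`, which dominates the Taylor remainders. -/
def quadLin (t : ℝ) : ℝ := min (t ^ 2) t

lemma quadLin_nonneg {t : ℝ} (ht : 0 ≤ t) : 0 ≤ quadLin t := le_min (sq_nonneg t) ht

@[fun_prop]
lemma continuous_quadLin : Continuous quadLin := by unfold quadLin; fun_prop

lemma integrable_quadLin (hα₁ : 1 < α) (hα₂ : α < 2) :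
    Integrable fun z : Eu d => quadLin ‖z‖ * radialKernel α z := by
  have hm : AEStronglyMeasurable (fun z : Eu d => quadLin ‖z‖ * radialKernel α z) volume := by
    refine Measurable.aestronglyMeasurable ?_
    fun_prop
  rw [← integrableOn_univ, ← union_compl_self (Metric.ball (0 : Eu d) 1)]
  refine IntegrableOn.union ?_ ?_
  · refine (radial_near hα₂ one_pos).1.mono' hm.restrict (ae_of_all _ fun z => ?_)
    rw [Real.norm_of_nonneg (mul_nonneg (quadLin_nonneg (norm_nonneg _)) (radialKernel_nonneg _ _))]
    exact mul_le_mul_of_nonneg_right (min_le_left _ _) (radialKernel_nonneg _ _)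
  · refine (radial_far hα₁ one_pos).1.mono' hm.restrict (ae_of_all _ fun z => ?_)
    rw [Real.norm_of_nonneg (mul_nonneg (quadLin_nonneg (norm_nonneg _)) (radialKernel_nonneg _ _))]
    exact mul_le_mul_of_nonneg_right (min_le_right _ _) (radialKernel_nonneg _ _)

/-- The integral `∫ min (|z|², |z|) |z|^{-d-α} dz`. -/
def quadLinMass (d : ℕ) (α : ℝ) : ℝ := ∫ z : Eu d, quadLin ‖z‖ * radialKernel α z

lemma quadLinMass_nonneg (d : ℕ) (α : ℝ) : 0 ≤ quadLinMass d α :=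
  integral_nonneg fun z => mul_nonneg (quadLin_nonneg (norm_nonneg z)) (radialKernel_nonneg α z)

lemma radialKernel_smul {s : ℝ} (hs : 0 < s) (z : Eu d) :
    radialKernel α z = s ^ ((d : ℝ) + α) * radialKernel α (s • z) := by
  rw [radialKernel, radialKernel, norm_smul, Real.norm_of_nonneg hs.le,
    Real.mul_rpow hs.le (norm_nonneg _), mul_inv, ← mul_assoc,
    mul_inv_cancel₀ (Real.rpow_pos_of_pos hs _).ne', one_mul]

/-- The kernel is homogeneous of degree `-d-α` and the Jacobian takes back `d` powers. Every power
`|ξ|^α` in the estimates arises from this scaling. -/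
lemma integral_scale {s : ℝ} (hs : 0 < s) (g : Eu d → ℝ) :
    ∫ z : Eu d, g (s • z) * radialKernel α z = s ^ α * ∫ z : Eu d, g z * radialKernel α z := by
  have : ∀ z : Eu d, g (s • z) * radialKernel α z =
      s ^ ((d : ℝ) + α) * (fun z => g z * radialKernel α z) (s • z) := fun z => by
    rw [radialKernel_smul hs z]
    ring
  simp_rw [this]
  rw [integral_const_mul,
    Measure.integral_comp_smul volume (fun z : Eu d => g z * radialKernel α z) s, finrank_euclideanSpace_fin, smul_eq_mul,
    ← mul_assoc, abs_of_pos (by positivity), Real.rpow_add hs, Real.rpow_natCast]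
  field_simp

lemma integrable_scale {s : ℝ} (hs : 0 < s) {g : Eu d → ℝ}
    (hg : Integrable fun z : Eu d => g z * radialKernel α z) :
    Integrable fun z : Eu d => g (s • z) * radialKernel α z := by
  have : ∀ z : Eu d, g (s • z) * radialKernel α z =
      s ^ ((d : ℝ) + α) * (fun z => g z * radialKernel α z) (s • z) := fun z => by
    rw [radialKernel_smul hs z]
    ring
  simp_rw [this]
  exact (hg.comp_smul hs.ne').const_mul _

lemma quadLin_scale (hα₁ : 1 < α) (hα₂ : α < 2) {s : ℝ} (hs : 0 ≤ s) :
    Integrable (fun z : Eu d => quadLin (s * ‖z‖) * radialKernel α z) ∧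
      ∫ z : Eu d, quadLin (s * ‖z‖) * radialKernel α z = s ^ α * quadLinMass d α := by
  rcases hs.eq_or_lt with rfl | hs
  · simp [quadLin, Real.zero_rpow (by linarith : α ≠ 0)]
  have e : ∀ z : Eu d, quadLin (s * ‖z‖) = (fun z : Eu d => quadLin ‖z‖) (s • z) := fun z => by
    simp [norm_smul, abs_of_pos hs]
  simp_rw [e]
  exact ⟨integrable_scale hs (integrable_quadLin hα₁ hα₂),
    integral_scale hs fun z : Eu d => quadLin ‖z‖⟩

/-- The reflection in the hyperplane orthogonal to `k - l` maps `k` to `l` because their lengths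
agree, and it preserves both norm and Lebesgue measure. -/
lemma integral_norm_inner {f : ℝ → ℝ → ℝ} (k l : Eu d) (h : ‖k‖ = ‖l‖) :
    ∫ z : Eu d, f ‖z‖ (inner ℝ k z) = ∫ z : Eu d, f ‖z‖ (inner ℝ l z) := by
  set T := (Submodule.span ℝ {k - l})ᗮ.reflection
  have hT : T k = l := Submodule.reflection_sub h
  rw [← T.measurePreserving.integral_comp T.toHomeomorph.measurableEmbedding
    fun z => f ‖z‖ (inner ℝ l z)]
  refine integral_congr_ae (ae_of_all _ fun z => ?_)
  simp only [LinearIsometryEquiv.norm_map]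
  rw [← hT, LinearIsometryEquiv.inner_map_map]

lemma abs_one_sub_cos_le (t : ℝ) : |1 - Real.cos t| ≤ 2 * quadLin |t| := by
  have h1 := Real.one_sub_sq_div_two_le_cos (x := t)
  have h2 := Real.cos_le_one t
  have h3 := Real.neg_one_le_cos t
  rw [abs_of_nonneg (by linarith), quadLin, sq_abs]
  rcases le_total (t ^ 2) |t| with h | h
  · rw [min_eq_left h]; nlinarith [sq_nonneg t]
  · rw [min_eq_right h]
    rcases (abs_nonneg t).eq_or_lt with h0 | h0
    · have : t = 0 := abs_eq_zero.1 h0.symm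
      simp [this]
    · have : 1 ≤ |t| := by
        rw [← sq_abs] at h
        nlinarith
      linarith

lemma quadLin_mono {a b : ℝ} (ha : 0 ≤ a) (hab : a ≤ b) : quadLin a ≤ quadLin b :=
  min_le_min (pow_le_pow_left₀ ha hab 2) hab

lemma integrable_one_sub_cos (hα₁ : 1 < α) (hα₂ : α < 2) (k : Eu d) :
    Integrable fun z : Eu d => (1 - Real.cos (inner ℝ k z)) * radialKernel α z := by
  refine ((quadLin_scale (d := d) hα₁ hα₂ (norm_nonneg k)).1.const_mul 2).mono' ?_
    (ae_of_all _ fun z => ?_)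
  · refine Measurable.aestronglyMeasurable ?_
    fun_prop
  · rw [norm_mul, Real.norm_eq_abs, Real.norm_of_nonneg (radialKernel_nonneg _ _), ← mul_assoc]
    refine mul_le_mul_of_nonneg_right ((abs_one_sub_cos_le _).trans ?_) (radialKernel_nonneg _ _)
    gcongr
    exact quadLin_mono (abs_nonneg _) (abs_real_inner_le_norm k z)

lemma inner_single_zero (r : ℝ) (z : Eu d) :
    inner ℝ (EuclideanSpace.single (0 : Fin d) r) z = r * z 0 := by
  rw [EuclideanSpace.inner_single_left]
  simp

lemma cZero_eq (d : ℕ) [NeZero d] (α : ℝ) :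
    cZero d α = ∫ z : Eu d, (1 - Real.cos (inner ℝ (EuclideanSpace.single (0 : Fin d) (1 : ℝ)) z)) *
      radialKernel α z := by
  simp only [inner_single_zero, one_mul]
  rfl

/-- Rotate `k` onto a multiple of the first basis vector, then scale its length away. -/
lemma integral_one_sub_cos (hα₁ : 1 < α) (k : Eu d) :
    ∫ z : Eu d, (1 - Real.cos (inner ℝ k z)) * radialKernel α z = cZero d α * ‖k‖ ^ α := by
  rcases eq_or_ne k 0 with rfl | hk
  · simp [Real.zero_rpow (by linarith : α ≠ 0)]
  have hk' : 0 < ‖k‖ := norm_pos_iff.2 hk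
  have h := integral_norm_inner (f := fun r t => (1 - Real.cos t) * (r ^ ((d : ℝ) + α))⁻¹)
    k (‖k‖ • EuclideanSpace.single (0 : Fin d) (1 : ℝ)) (by simp [norm_smul])
  have h2 := integral_scale (α := α) hk'
    fun z : Eu d => 1 - Real.cos (inner ℝ (EuclideanSpace.single (0 : Fin d) (1 : ℝ)) z)
  simp only [radialKernel] at h2 ⊢
  rw [h]
  simp only [inner_smul_right] at h2
  simp only [inner_smul_left, conj_trivial]
  rw [h2, mul_comm, cZero_eq]
  rfl

/-- The integrand is nonnegative and strictly positive on the open slab `0 < z₀ < 1`. -/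
lemma cZero_pos (hα₁ : 1 < α) (hα₂ : α < 2) : 0 < cZero d α := by
  rw [cZero_eq]
  have hn : 0 ≤ fun z : Eu d => (1 - Real.cos (inner ℝ (EuclideanSpace.single (0 : Fin d) (1 : ℝ)) z)) *
      radialKernel α z := fun z =>
    mul_nonneg (sub_nonneg.2 (Real.cos_le_one _)) (radialKernel_nonneg _ _)
  rw [integral_pos_iff_support_of_nonneg hn (integrable_one_sub_cos hα₁ hα₂ _)]
  have ho : IsOpen {z : Eu d | z 0 ∈ Ioo (0 : ℝ) 1} := isOpen_Ioo.preimage (continuous_coord 0)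
  refine (ho.measure_pos volume ⟨EuclideanSpace.single 0 (1 / 2), ?_⟩).trans_le (measure_mono ?_)
  · simp only [mem_ofPred_eq, PiLp.single_apply]
    norm_num
  · intro z hz
    have hz' : z 0 ∈ Ioo (0 : ℝ) 1 := hz
    have hz0 : z ≠ 0 := by
      rintro rfl
      simp at hz'
    simp only [Function.mem_support, inner_single_zero, one_mul]
    refine mul_ne_zero (sub_pos.2 ?_).ne' ?_
    · have := Real.cos_lt_cos_of_nonneg_of_le_pi le_rfl
        (by linarith [hz'.2, Real.pi_gt_three] : z 0 ≤ Real.pi) hz'.1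
      simpa using this
    · have : 0 < ‖z‖ := norm_pos_iff.2 hz0
      unfold radialKernel
      positivity

/-- The second moment of a rotation invariant density. -/
lemma integral_mul_inner_sq {h : ℝ → ℝ} (ξ : Eu d)
    (hi : Integrable fun z : Eu d => h ‖z‖ * ‖z‖ ^ 2) (hm : Measurable h) :
    Integrable (fun z : Eu d => h ‖z‖ * (inner ℝ ξ z) ^ 2) ∧
    ∫ z : Eu d, h ‖z‖ * (inner ℝ ξ z) ^ 2 = ‖ξ‖ ^ 2 / d * ∫ z : Eu d, h ‖z‖ * ‖z‖ ^ 2 := by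
  have hint : ∀ ξ : Eu d, Integrable fun z : Eu d => h ‖z‖ * (inner ℝ ξ z) ^ 2 := fun ξ => by
    refine (hi.norm.const_mul (‖ξ‖ ^ 2)).mono' (Measurable.aestronglyMeasurable (by fun_prop))
      (ae_of_all _ fun z => ?_)
    rw [norm_mul, norm_mul, Real.norm_of_nonneg (sq_nonneg (inner ℝ ξ z)),
      Real.norm_of_nonneg (sq_nonneg ‖z‖)]
    have := pow_le_pow_left₀ (abs_nonneg _) (abs_real_inner_le_norm ξ z) 2
    rw [sq_abs] at this
    calc ‖h ‖z‖‖ * (inner ℝ ξ z) ^ 2 ≤ ‖h ‖z‖‖ * (‖ξ‖ * ‖z‖) ^ 2 := by gcongr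
      _ = _ := by ring
  refine ⟨hint ξ, ?_⟩
  have hrot : ∀ ξ : Eu d, ∫ z : Eu d, h ‖z‖ * (inner ℝ ξ z) ^ 2 = ‖ξ‖ ^ 2 *
      ∫ z : Eu d, h ‖z‖ * (inner ℝ (EuclideanSpace.single (0 : Fin d) (1 : ℝ)) z) ^ 2 := fun ξ => by
    rw [integral_norm_inner (f := fun r t => h r * t ^ 2) ξ
      (‖ξ‖ • EuclideanSpace.single (0 : Fin d) (1 : ℝ)) (by simp [norm_smul]),
      ← integral_const_mul]
    refine integral_congr_ae (ae_of_all _ fun z => ?_)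
    simp only [inner_smul_left, conj_trivial]
    ring
  -- The squares of the `d` coordinates add up to `|z|²` and have equal integrals by rotation; this
  -- produces the factor `1/d`.
  have hsum : ∫ z : Eu d, h ‖z‖ * ‖z‖ ^ 2 = d *
      ∫ z : Eu d, h ‖z‖ * (inner ℝ (EuclideanSpace.single (0 : Fin d) (1 : ℝ)) z) ^ 2 := by
    have e : ∀ z : Eu d, h ‖z‖ * ‖z‖ ^ 2 =
        ∑ i, h ‖z‖ * (inner ℝ (EuclideanSpace.single i (1 : ℝ)) z) ^ 2 := fun z => by
      rw [← Finset.mul_sum, EuclideanSpace.norm_sq_eq]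
      congr 1
      refine Finset.sum_congr rfl fun i _ => ?_
      rw [EuclideanSpace.inner_single_left]
      simp
    simp_rw [e]
    rw [integral_finsetSum _ fun i _ => hint _]
    rw [Finset.sum_congr rfl fun i _ => hrot (EuclideanSpace.single i 1)]
    simp
  have hd : (d : ℝ) ≠ 0 := Nat.cast_ne_zero.2 (NeZero.ne d)
  rw [hrot, hsum]
  field_simp

end Radial

/-! ### Fourier coefficients of periodic functions -/

/-- The exponential `x ↦ exp (i⟨k, x⟩)`. -/
def wave {d : ℕ} (k x : Eu d) : ℂ := Complex.exp (Complex.I * (inner ℝ k x : ℝ))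

lemma wave_add_right {d : ℕ} (k x y : Eu d) : wave k (x + y) = wave k x * wave k y := by
  rw [wave, wave, wave, inner_add_right, ← Complex.exp_add]
  push_cast
  ring_nf

lemma wave_add_left {d : ℕ} (k l x : Eu d) : wave (k + l) x = wave k x * wave l x := by
  rw [wave, wave, wave, inner_add_left, ← Complex.exp_add]
  push_cast
  ring_nf

lemma norm_wave {d : ℕ} (k x : Eu d) : ‖wave k x‖ = 1 := by
  rw [wave, mul_comm, Complex.norm_exp_ofReal_mul_I]

@[fun_prop]
lemma continuous_wave {d : ℕ} (k : Eu d) : Continuous (wave k) := by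
  unfold wave; fun_prop

@[fun_prop]
lemma measurable_wave {d : ℕ} (k : Eu d) : Measurable (wave k) := (continuous_wave k).measurable

lemma wave_mul_conj {d : ℕ} (k x : Eu d) : wave k x * (starRingEnd ℂ) (wave k x) = 1 := by
  rw [Complex.mul_conj, Complex.normSq_eq_norm_sq, norm_wave]
  simp

lemma wave_zero_left {d : ℕ} (x : Eu d) : wave 0 x = 1 := by simp [wave]

/-- The dual lattice vector `2πn`. -/
def dualVec {d : ℕ} (n : Fin d → ℤ) : Eu d := (2 * Real.pi) • latticeVec n

lemma wave_dualVec {d : ℕ} (n : Fin d → ℤ) (x : Eu d) :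
    wave (dualVec n) x = UnitAddTorus.mFourier n (torusMk x) := by
  simp only [wave, dualVec, UnitAddTorus.mFourier, ContinuousMap.coe_mk, torusMk]
  simp_rw [fourier_coe_apply]
  rw [← Complex.exp_sum]
  congr 1
  rw [inner_smul_left, PiLp.inner_apply]
  simp only [latticeVec, RCLike.inner_apply, conj_trivial]
  push_cast
  rw [Finset.mul_sum, Finset.mul_sum]
  refine Finset.sum_congr rfl fun i _ => ?_
  ring

lemma wave_dualVec_fractVec {d : ℕ} (n : Fin d → ℤ) (x : Eu d) :
    wave (dualVec n) (fractVec x) = wave (dualVec n) x := by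
  rw [wave_dualVec, wave_dualVec, ← torusSec_torusMk, torusMk_torusSec]

lemma one_le_norm_latticeVec {d : ℕ} {n : Fin d → ℤ} (hn : n ≠ 0) : 1 ≤ ‖(latticeVec n : Eu d)‖ := by
  obtain ⟨i, hi⟩ := Function.ne_iff.1 hn
  refine le_trans ?_ (PiLp.norm_apply_le (latticeVec n : Eu d) i)
  simp only [latticeVec]
  rw [Real.norm_eq_abs]
  exact_mod_cast Int.one_le_abs hi

/-- Nonzero dual vectors have length at least `2π`, and the shift costs at most `π`. This is the gap
that separates the constants from the other modes. -/
lemma pi_le_norm_dualVec_add {d : ℕ} {n : Fin d → ℤ} (hn : n ≠ 0) {ξ : Eu d} (hξ : ‖ξ‖ ≤ Real.pi) :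
    Real.pi ≤ ‖dualVec n + ξ‖ := by
  have h1 : 2 * Real.pi ≤ ‖dualVec n‖ := by
    rw [dualVec, norm_smul, Real.norm_of_nonneg (by positivity)]
    nlinarith [one_le_norm_latticeVec hn, Real.pi_pos]
  have h2 := norm_sub_le (dualVec n + ξ) ξ
  rw [add_sub_cancel_right] at h2
  linarith

/-- The Fourier coefficients of a function on `Ω`. -/
def fourierCell {d : ℕ} (w : Eu d → ℂ) (n : Fin d → ℤ) : ℂ :=
  ∫ x, (starRingEnd ℂ) (wave (dualVec n) x) * w x ∂(cellMeasure d)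

lemma fourierCell_eq {d : ℕ} {w : Eu d → ℂ} (hw : AEStronglyMeasurable w (cellMeasure d))
    (n : Fin d → ℤ) :
    fourierCell w n = UnitAddTorus.mFourierCoeff (fun t => w (torusSec t)) n := by
  rw [fourierCell, ← (measurePreserving_torusSec d).map_eq,
    integral_map (measurable_torusSec d).aemeasurable]
  · refine integral_congr_ae (μ := torusMeasure d) (ae_of_all _ fun t => ?_)
    simp only [wave_dualVec, torusMk_torusSec, UnitAddTorus.mFourier_neg, smul_eq_mul]
  · rw [(measurePreserving_torusSec d).map_eq]
    exact AEStronglyMeasurable.mul (Measurable.aestronglyMeasurable (by fun_prop)) hw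

/-- **Parseval's identity** on `Ω`. -/
lemma hasSum_fourierCell {d : ℕ} {w : Eu d → ℂ} (hw : MemLp w 2 (cellMeasure d)) :
    HasSum (fun n => ‖fourierCell w n‖ ^ 2) (∫ x, ‖w x‖ ^ 2 ∂(cellMeasure d)) := by
  have hp := measurePreserving_torusSec d
  have hw' : MemLp (w ∘ torusSec) 2 (torusMeasure d) := hw.comp_measurePreserving hp
  have h := UnitAddTorus.hasSum_sq_mFourierCoeff (hw'.toLp _)
  have e1 : ∀ n, UnitAddTorus.mFourierCoeff (hw'.toLp _) n = fourierCell w n := fun n => by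
    rw [fourierCell_eq hw.1]
    refine integral_congr_ae (μ := torusMeasure d) ?_
    filter_upwards [hw'.coeFn_toLp] with t ht
    rw [ht]
    rfl
  simp_rw [e1] at h
  convert h using 1
  have h2 : AEStronglyMeasurable (fun x => ‖w x‖ ^ 2) ((torusMeasure d).map torusSec) :=
    hp.map_eq.symm ▸ hw.1.norm.pow 2
  rw [← hp.map_eq, integral_map hp.aemeasurable h2]
  refine integral_congr_ae (μ := torusMeasure d) ?_
  filter_upwards [hw'.coeFn_toLp] with t ht
  rw [ht]
  rfl

lemma lintegral_enorm_sq_eq {α : Type*} [MeasurableSpace α] {m : Measure α} {w : α → ℂ}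
    (hw : MemLp w 2 m) : ∫⁻ x, ‖w x‖ₑ ^ 2 ∂m = ENNReal.ofReal (∫ x, ‖w x‖ ^ 2 ∂m) := by
  rw [ofReal_integral_eq_lintegral_ofReal ((memLp_two_iff_integrable_sq_norm hw.1).1 hw)
    (ae_of_all _ fun x => by positivity)]
  refine lintegral_congr fun x => ?_
  rw [← ofReal_norm, ENNReal.ofReal_pow (norm_nonneg _)]

lemma tsum_fourierCell {d : ℕ} {w : Eu d → ℂ} (hw : MemLp w 2 (cellMeasure d)) :
    ∑' n, ‖fourierCell w n‖ₑ ^ 2 = ∫⁻ x, ‖w x‖ₑ ^ 2 ∂(cellMeasure d) := by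
  have h := hasSum_fourierCell hw
  rw [lintegral_enorm_sq_eq hw, ← h.tsum_eq, ENNReal.ofReal_tsum_of_nonneg (fun n => by positivity)
    h.summable]
  refine tsum_congr fun n => ?_
  rw [← ofReal_norm, ENNReal.ofReal_pow (norm_nonneg _)]

lemma memLp_coe {d : ℕ} (u : L2Cell d) : MemLp u 2 (cellMeasure d) := Lp.memLp u

lemma measurable_coe {d : ℕ} (u : L2Cell d) : Measurable u := (Lp.stronglyMeasurable u).measurable

lemma measurable_perExt {d : ℕ} (u : L2Cell d) : Measurable (perExt u) :=
  (measurable_coe u).comp (measurable_fractVec d)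

lemma perExt_of_mem {d : ℕ} (u : Eu d → ℂ) {x : Eu d} (hx : x ∈ unitCell d) : perExt u x = u x := by
  rw [perExt, fractVec_of_mem hx]

lemma ae_mem_unitCell (d : ℕ) : ∀ᵐ x ∂(cellMeasure d), x ∈ unitCell d :=
  ae_restrict_mem (measurableSet_unitCell d)

lemma eq_zero_of_fourierCell {d : ℕ} (u : L2Cell d) (h : ∀ n, fourierCell u n = 0) : u = 0 := by
  have h1 := hasSum_fourierCell (memLp_coe u)
  simp only [h, norm_zero, ne_eq, OfNat.ofNat_ne_zero, not_false_eq_true, zero_pow] at h1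
  have h2 := h1.unique hasSum_zero
  rw [integral_eq_zero_iff_of_nonneg (fun x => by positivity)
    ((memLp_two_iff_integrable_sq_norm (memLp_coe u).1).1 (memLp_coe u))] at h2
  rw [Lp.eq_zero_iff_ae_eq_zero]
  filter_upwards [h2] with x hx
  simpa using hx

lemma memLp_perExt_add {d : ℕ} (u : L2Cell d) (z : Eu d) :
    MemLp (fun x => perExt u (x + z)) 2 (cellMeasure d) :=
  (memLp_coe u).comp_measurePreserving (measurePreserving_fractVec_add z)

lemma fourierCell_perExt_add {d : ℕ} (u : L2Cell d) (z : Eu d) (n : Fin d → ℤ) :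
    fourierCell (fun x => perExt u (x + z)) n = wave (dualVec n) z * fourierCell u n := by
  have hp := measurePreserving_fractVec_add z
  have hm : AEStronglyMeasurable (fun x => (starRingEnd ℂ) (wave (dualVec n) x) * u x)
      (cellMeasure d) :=
    AEStronglyMeasurable.mul (Measurable.aestronglyMeasurable (by fun_prop)) (memLp_coe u).1
  unfold fourierCell
  rw [← integral_comp_of_measurePreserving hp hm, ← integral_const_mul]
  refine integral_congr_ae (ae_of_all _ fun x => ?_)
  simp only [perExt, wave_dualVec_fractVec, wave_add_right, map_mul]
  linear_combination (-((starRingEnd ℂ) (wave (dualVec n) x) * u (fractVec (x + z)))) *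
    wave_mul_conj (dualVec n) z

/-! ### The spectral lower bound for the forms -/

/-- The difference `u(x) - exp (i⟨ξ, y - x⟩) u(y)` at `p = (x, y)`, with `u` extended
periodically. -/
def twistDiff {d : ℕ} (ξ : Eu d) (u : Eu d → ℂ) (p : Eu d × Eu d) : ℂ :=
  perExt u p.1 - wave ξ (p.2 - p.1) * perExt u p.2

lemma measurable_twistDiff {d : ℕ} (ξ : Eu d) (u : L2Cell d) : Measurable (twistDiff ξ u) := by
  have := measurable_perExt u
  unfold twistDiff
  fun_prop

lemma norm_one_sub_wave_sq {d : ℕ} (k z : Eu d) :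
    ‖1 - wave k z‖ ^ 2 = 2 * (1 - Real.cos (inner ℝ k z)) := by
  rw [wave, mul_comm Complex.I, Complex.exp_mul_I, ← Complex.ofReal_cos, ← Complex.ofReal_sin,
    ← Complex.normSq_eq_norm_sq, Complex.normSq_apply]
  simp only [Complex.sub_re, Complex.one_re, Complex.add_re, Complex.ofReal_re, Complex.mul_re,
    Complex.ofReal_im, Complex.I_re, Complex.I_im, Complex.sub_im, Complex.one_im, Complex.add_im,
    Complex.mul_im]
  linear_combination Real.sin_sq_add_cos_sq (inner ℝ k z)

lemma fourierCell_twistDiff {d : ℕ} (ξ : Eu d) (u : L2Cell d) (z : Eu d) (n : Fin d → ℤ) :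
    fourierCell (fun x => u x - wave ξ z * perExt u (x + z)) n =
      (1 - wave (dualVec n + ξ) z) * fourierCell u n := by
  have h1 : Integrable (fun x => (starRingEnd ℂ) (wave (dualVec n) x) * u x) (cellMeasure d) := by
    refine ((memLp_coe u).integrable one_le_two).bdd_mul (c := 1)
      (Measurable.aestronglyMeasurable (by fun_prop)) (ae_of_all _ fun x => ?_)
    rw [RCLike.norm_conj, norm_wave]
  have h2 : Integrable (fun x => (starRingEnd ℂ) (wave (dualVec n) x) * perExt u (x + z))
      (cellMeasure d) := by
    refine ((memLp_perExt_add u z).integrable one_le_two).bdd_mul (c := 1)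
      (Measurable.aestronglyMeasurable (by fun_prop)) (ae_of_all _ fun x => ?_)
    rw [RCLike.norm_conj, norm_wave]
  have h3 := fourierCell_perExt_add u z n
  rw [wave_add_left, sub_mul, one_mul, mul_right_comm, ← h3]
  unfold fourierCell
  rw [← integral_mul_const, ← integral_sub h1 (h2.mul_const _)]
  refine integral_congr_ae (ae_of_all _ fun x => ?_)
  simp only
  ring

/-- For fixed `z`, the function `x ↦ u(x) - exp(i⟨ξ,z⟩)u(x+z)` has Fourier coefficients `(1 -
exp(i⟨2πn+ξ,z⟩))û_n`. Parseval in `x`, then integration of `2(1 - cos)` against the kernel in `z`,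
diagonalizes the energy. -/
lemma lintegral_twistDiff {d : ℕ} [NeZero d] {α : ℝ} (hα₁ : 1 < α) (hα₂ : α < 2) (ξ : Eu d)
    (u : L2Cell d) :
    ∫⁻ p, ENNReal.ofReal (radialKernel α (p.2 - p.1)) * ‖twistDiff ξ u p‖ₑ ^ 2 ∂(pairMeasure d) =
      ∑' n, ENNReal.ofReal (2 * (cZero d α * ‖dualVec n + ξ‖ ^ α)) * ‖fourierCell u n‖ₑ ^ 2 := by
  have hm := measurable_twistDiff ξ u
  rw [lintegral_pair (by fun_prop)]
  have h1 : ∀ z : Eu d, ∫⁻ x, ENNReal.ofReal (radialKernel α ((x, x + z).2 - (x, x + z).1)) *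
      ‖twistDiff ξ u (x, x + z)‖ₑ ^ 2 ∂(cellMeasure d) =
      ∑' n, ENNReal.ofReal (2 * ((1 - Real.cos (inner ℝ (dualVec n + ξ) z)) * radialKernel α z)) *
        ‖fourierCell u n‖ₑ ^ 2 := fun z => by
    simp only [add_sub_cancel_left]
    rw [lintegral_const_mul _ (by fun_prop)]
    have h2 : ∫⁻ x, ‖twistDiff ξ u (x, x + z)‖ₑ ^ 2 ∂(cellMeasure d) =
        ∫⁻ x, ‖u x - wave ξ z * perExt u (x + z)‖ₑ ^ 2 ∂(cellMeasure d) := by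
      refine lintegral_congr_ae ?_
      filter_upwards [ae_mem_unitCell d] with x hx
      simp only [twistDiff, perExt_of_mem _ hx, add_sub_cancel_left]
    have h3 := tsum_fourierCell ((memLp_coe u).sub ((memLp_perExt_add u z).const_mul (wave ξ z)))
    simp only [Pi.sub_def] at h3
    rw [h2, ← h3, ← ENNReal.tsum_mul_left]
    refine tsum_congr fun n => ?_
    rw [fourierCell_twistDiff, enorm_mul, mul_pow, ← mul_assoc]
    congr 1
    rw [← ofReal_norm, ← ENNReal.ofReal_pow (norm_nonneg _), norm_one_sub_wave_sq,
      ← ENNReal.ofReal_mul (radialKernel_nonneg _ _)]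
    congr 1
    ring
  simp_rw [h1]
  rw [lintegral_tsum fun n => Measurable.aemeasurable (by fun_prop)]
  refine tsum_congr fun n => ?_
  rw [lintegral_mul_const _ (by fun_prop)]
  congr 1
  rw [← ofReal_integral_eq_lintegral_ofReal ((integrable_one_sub_cos hα₁ hα₂ _).const_mul 2)
    (ae_of_all _ fun z => ?_), integral_const_mul, integral_one_sub_cos hα₁]
  exact mul_nonneg zero_le_two
    (mul_nonneg (sub_nonneg.2 (Real.cos_le_one _)) (radialKernel_nonneg _ _))

/-- The alternative in the hypothesis lets modes absent from `u` be ignored: with `n = 0` absent one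
may take `ρ = π`, otherwise only `ρ = |ξ|`. -/
lemma le_lintegral_twistDiff {d : ℕ} [NeZero d] {α : ℝ} (hα₁ : 1 < α) (hα₂ : α < 2) (ξ : Eu d)
    (u : L2Cell d) {ρ : ℝ} (hρ : 0 ≤ ρ)
    (h : ∀ n, fourierCell u n = 0 ∨ ρ ≤ ‖dualVec n + ξ‖) :
    ENNReal.ofReal (2 * (cZero d α * ρ ^ α)) * ENNReal.ofReal (‖u‖ ^ 2) ≤
    ∫⁻ p, ENNReal.ofReal (radialKernel α (p.2 - p.1)) * ‖twistDiff ξ u p‖ₑ ^ 2 ∂(pairMeasure d) := by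
  rw [lintegral_twistDiff hα₁ hα₂]
  have e : ENNReal.ofReal (‖u‖ ^ 2) = ∑' n, ‖fourierCell u n‖ₑ ^ 2 := by
    rw [tsum_fourierCell (memLp_coe u), ENNReal.ofReal_pow (norm_nonneg _), ofReal_norm,
      Lp.enorm_def, eLpNorm_eq_lintegral_rpow_enorm_toReal two_ne_zero ENNReal.ofNat_ne_top]
    simp only [ENNReal.toReal_ofNat, ENNReal.rpow_ofNat, one_div]
    rw [← ENNReal.rpow_two, ← ENNReal.rpow_mul]
    norm_num
  rw [e, ← ENNReal.tsum_mul_left]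
  refine ENNReal.tsum_le_tsum fun n => ?_
  rcases h n with h | h
  · simp [h]
  · have := (cZero_pos (d := d) hα₁ hα₂).le
    gcongr

/-! ### The Gagliardo energy -/

section Energy

variable {d : ℕ} [NeZero d] {α : ℝ}

/-- The unweighted energy `∬ |u(x) - exp (i⟨ξ, y - x⟩) u(y)|² / |x - y|^{d+α} dx dy`. -/
def energy {d : ℕ} (α : ℝ) (ξ : Eu d) (u : Eu d → ℂ) : ENNReal :=
  ∫⁻ p, ENNReal.ofReal (radialKernel α (p.2 - p.1)) * ‖twistDiff ξ u p‖ₑ ^ 2 ∂(pairMeasure d)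

lemma enorm_add_sq_le (a b : ℂ) : ‖a + b‖ₑ ^ 2 ≤ 2 * (‖a‖ₑ ^ 2 + ‖b‖ₑ ^ 2) := by
  simp only [← ofReal_norm, ← ENNReal.ofReal_pow (norm_nonneg _)]
  rw [← ENNReal.ofReal_add (by positivity) (by positivity),
    show (2 : ENNReal) = ENNReal.ofReal 2 by simp, ← ENNReal.ofReal_mul zero_le_two]
  refine ENNReal.ofReal_le_ofReal ?_
  have := norm_add_le a b
  calc ‖a + b‖ ^ 2 ≤ (‖a‖ + ‖b‖) ^ 2 := by gcongr
    _ ≤ _ := by nlinarith [sq_nonneg (‖a‖ - ‖b‖)]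

lemma lintegral_enorm_sq_coe {X : Type*} [MeasurableSpace X] {m : Measure X} (u : Lp ℂ 2 m) :
    ∫⁻ x, ‖u x‖ₑ ^ 2 ∂m = ENNReal.ofReal (‖u‖ ^ 2) := by
  rw [ENNReal.ofReal_pow (norm_nonneg _), ofReal_norm,
      Lp.enorm_def, eLpNorm_eq_lintegral_rpow_enorm_toReal two_ne_zero ENNReal.ofNat_ne_top]
  simp only [ENNReal.toReal_ofNat, ENNReal.rpow_ofNat, one_div]
  rw [← ENNReal.rpow_two, ← ENNReal.rpow_mul]
  norm_num

lemma norm_one_sub_wave_sq_le (k z : Eu d) : ‖1 - wave k z‖ ^ 2 ≤ 4 * quadLin (‖k‖ * ‖z‖) := by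
  rw [norm_one_sub_wave_sq]
  have h1 := (le_abs_self _).trans (abs_one_sub_cos_le (inner ℝ k z))
  have h2 := quadLin_mono (abs_nonneg _) (abs_real_inner_le_norm k z)
  linarith

lemma lintegral_quadLin (hα₁ : 1 < α) (hα₂ : α < 2) {s : ℝ} (hs : 0 ≤ s) :
    ∫⁻ z : Eu d, ENNReal.ofReal (quadLin (s * ‖z‖) * radialKernel α z) =
      ENNReal.ofReal (s ^ α * quadLinMass d α) := by
  have h := quadLin_scale (d := d) hα₁ hα₂ hs
  rw [← h.2, ofReal_integral_eq_lintegral_ofReal h.1 (ae_of_all _ fun z =>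
    mul_nonneg (quadLin_nonneg (by positivity)) (radialKernel_nonneg _ _))]

/-- The perturbation `(1 - exp (i⟨ξ, y - x⟩)) u(y)` has energy of order `|ξ|^α`. -/
lemma lintegral_one_sub_wave (hα₁ : 1 < α) (hα₂ : α < 2) (ξ : Eu d) (u : L2Cell d) :
    ∫⁻ p, ENNReal.ofReal (radialKernel α (p.2 - p.1)) *
      ‖(1 - wave ξ (p.2 - p.1)) * perExt u p.2‖ₑ ^ 2 ∂(pairMeasure d) ≤
      ENNReal.ofReal (4 * (‖ξ‖ ^ α * quadLinMass d α) * ‖u‖ ^ 2) := by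
  have hu := measurable_coe u
  have hG : Measurable fun z : Eu d =>
    ENNReal.ofReal (4 * (quadLin (‖ξ‖ * ‖z‖) * radialKernel α z)) := by fun_prop
  have h := lintegral_pair_snd (d := d) (h := fun x => ‖u x‖ₑ ^ 2) hG (by fun_prop)
  have h4 : ∫⁻ z : Eu d, ENNReal.ofReal (4 * (quadLin (‖ξ‖ * ‖z‖) * radialKernel α z)) =
      ENNReal.ofReal (4 * (‖ξ‖ ^ α * quadLinMass d α)) := by
    simp_rw [ENNReal.ofReal_mul zero_le_four]
    rw [lintegral_const_mul _ (by fun_prop), lintegral_quadLin hα₁ hα₂ (norm_nonneg ξ)]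
  rw [ENNReal.ofReal_mul (by have := quadLinMass_nonneg d α; positivity), ← lintegral_enorm_sq_coe,
    ← h4, ← h]
  refine lintegral_mono fun p => ?_
  rw [enorm_mul, mul_pow, ← mul_assoc]
  simp only [perExt]
  gcongr
  rw [← ofReal_norm, ← ENNReal.ofReal_pow (norm_nonneg _),
    ← ENNReal.ofReal_mul (radialKernel_nonneg _ _)]
  refine ENNReal.ofReal_le_ofReal ?_
  have := norm_one_sub_wave_sq_le ξ (p.2 - p.1)
  nlinarith [radialKernel_nonneg α (p.2 - p.1)]

lemma twistDiff_eq_add (ξ : Eu d) (u : Eu d → ℂ) (p : Eu d × Eu d) :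
    twistDiff ξ u p = twistDiff 0 u p + (1 - wave ξ (p.2 - p.1)) * perExt u p.2 := by
  simp only [twistDiff, wave_zero_left]
  ring

/-- The two differences differ by `(1 - exp(i⟨ξ,y-x⟩))u(y)`, whose energy is finite for every `u` in
`L₂(Ω)`. Hence the form domain does not depend on `ξ`. -/
lemma energy_lt_top_iff (hα₁ : 1 < α) (hα₂ : α < 2) (ξ : Eu d) (u : L2Cell d) :
    energy α ξ u < ⊤ ↔ energy α 0 u < ⊤ := by
  have hb := (lintegral_one_sub_wave hα₁ hα₂ ξ u).trans_lt ENNReal.ofReal_lt_top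
  have hu := measurable_perExt u
  have key : ∀ f g : Eu d × Eu d → ℂ, Measurable f → Measurable g →
      ∫⁻ p, ENNReal.ofReal (radialKernel α (p.2 - p.1)) * ‖f p‖ₑ ^ 2 ∂(pairMeasure d) < ⊤ →
      ∫⁻ p, ENNReal.ofReal (radialKernel α (p.2 - p.1)) * ‖g p‖ₑ ^ 2 ∂(pairMeasure d) < ⊤ →
      ∫⁻ p, ENNReal.ofReal (radialKernel α (p.2 - p.1)) * ‖f p + g p‖ₑ ^ 2 ∂(pairMeasure d) < ⊤ := by
    intro f g hfm hgm hf hg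
    refine lt_of_le_of_lt (lintegral_mono (g := fun p =>
      2 * (ENNReal.ofReal (radialKernel α (p.2 - p.1)) * ‖f p‖ₑ ^ 2 +
        ENNReal.ofReal (radialKernel α (p.2 - p.1)) * ‖g p‖ₑ ^ 2)) fun p => ?_) ?_
    · calc _ ≤ ENNReal.ofReal (radialKernel α (p.2 - p.1)) *
            (2 * (‖f p‖ₑ ^ 2 + ‖g p‖ₑ ^ 2)) := by gcongr; exact enorm_add_sq_le _ _
        _ = _ := by ring
    · rw [lintegral_const_mul _ (by fun_prop), lintegral_add_left (by fun_prop)]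
      exact ENNReal.mul_lt_top (by simp) (ENNReal.add_lt_top.2 ⟨hf, hg⟩)
  have hd : Measurable fun p : Eu d × Eu d => (1 - wave ξ (p.2 - p.1)) * perExt u p.2 := by fun_prop
  constructor
  · intro h
    have h2 := key _ (fun p => -((1 - wave ξ (p.2 - p.1)) * perExt u p.2)) (measurable_twistDiff ξ u)
      hd.neg h (by simpa only [enorm_neg] using hb)
    refine lt_of_le_of_lt (le_of_eq ?_) h2
    refine lintegral_congr fun p => ?_
    rw [twistDiff_eq_add ξ, add_neg_cancel_right]
  · intro h
    have h2 := key _ _ (measurable_twistDiff 0 u) hd h hb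
    refine lt_of_le_of_lt (le_of_eq ?_) h2
    refine lintegral_congr fun p => ?_
    rw [twistDiff_eq_add ξ]

/-! ### Local Sobolev regularity and finite energy are equivalent -/

lemma enorm_gagliardo_sq (u : Eu d → ℂ) (p : Eu d × Eu d) :
    ‖gagliardo (α / 2) u p‖ₑ ^ 2 =
      ENNReal.ofReal (radialKernel α (p.2 - p.1)) * ‖twistDiff 0 u p‖ₑ ^ 2 := by
  have h0 : 0 ≤ (‖p.1 - p.2‖ ^ ((d : ℝ) / 2 + α / 2))⁻¹ := by positivity
  rw [gagliardo, enorm_smul, mul_pow, ← ofReal_norm, ← ENNReal.ofReal_pow (norm_nonneg _),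
    Real.norm_of_nonneg h0, radialKernel, norm_sub_rev p.2]
  congr 2
  · rw [inv_pow, ← Real.rpow_natCast, ← Real.rpow_mul (norm_nonneg _)]
    congr 2
    push_cast
    ring
  · simp [twistDiff, wave_zero_left]

lemma measurable_gagliardo (s : ℝ) (u : L2Cell d) : Measurable (gagliardo s u) := by
  have := measurable_perExt u
  unfold gagliardo
  fun_prop

lemma memLp_two_iff_lintegral {X : Type*} [MeasurableSpace X] {m : Measure X} {f : X → ℂ}
    (hf : AEStronglyMeasurable f m) : MemLp f 2 m ↔ ∫⁻ x, ‖f x‖ₑ ^ 2 ∂m < ⊤ := by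
  rw [MemLp, and_iff_right hf,
    eLpNorm_lt_top_iff_lintegral_rpow_enorm_lt_top two_ne_zero ENNReal.ofNat_ne_top]
  simp

lemma mem_perSobolev_iff_gagliardo (u : L2Cell d) : u ∈ perSobolev d (α / 2) ↔
    ∀ r : ℝ, 0 < r → ∫⁻ p in Metric.ball (0 : Eu d) r ×ˢ Metric.ball (0 : Eu d) r,
      ENNReal.ofReal (radialKernel α (p.2 - p.1)) * ‖twistDiff 0 u p‖ₑ ^ 2 < ⊤ := by
  refine forall₂_congr fun r _ => ?_
  rw [memLp_two_iff_lintegral (measurable_gagliardo _ u).aestronglyMeasurable]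
  simp only [enorm_gagliardo_sq]

lemma norm_le_of_mem_unitCell {x : Eu d} (hx : x ∈ unitCell d) : ‖x‖ ≤ √d := by
  rw [EuclideanSpace.norm_eq]
  refine Real.sqrt_le_sqrt ?_
  calc ∑ i, ‖x i‖ ^ 2 ≤ ∑ _i : Fin d, (1 : ℝ) := by
        refine Finset.sum_le_sum fun i _ => ?_
        have h := hx i
        rw [Real.norm_eq_abs, sq_abs]
        nlinarith [h.1, h.2]
    _ = d := by simp

lemma lintegral_far (hα₁ : 1 < α) :
    ∫⁻ z in (Metric.ball (0 : Eu d) 1)ᶜ, ENNReal.ofReal (radialKernel α z) < ⊤ := by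
  refine lt_of_le_of_lt ?_ (radial_far (d := d) hα₁ one_pos).1.lintegral_lt_top
  refine setLIntegral_mono' measurableSet_ball.compl fun z hz => ?_
  refine ENNReal.ofReal_le_ofReal ?_
  have : 1 ≤ ‖z‖ := by simpa using hz
  exact le_mul_of_one_le_left (radialKernel_nonneg _ _) this

/-- Pairs at distance less than `1` with `x` in `Ω` lie in a fixed ball, where the local seminorm
applies; for the other pairs the kernel is integrable and the `L₂` norm suffices. -/
lemma energy_lt_top_of_mem (hα₁ : 1 < α) {u : L2Cell d} (hu : u ∈ perSobolev d (α / 2)) :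
    energy α 0 u < ⊤ := by
  have hm := measurable_twistDiff 0 u
  have hmu := measurable_coe u
  rw [mem_perSobolev_iff_gagliardo] at hu
  -- The cell has radius at most `√d`, the second point is less than `1` further away, and another
  -- unit makes the inclusion in the open ball strict.
  set r := √d + 2 with hr
  have hr0 : 0 < r := by positivity
  set B := Metric.ball (0 : Eu d) r with hB
  set F := fun p : Eu d × Eu d => ENNReal.ofReal (radialKernel α (p.2 - p.1)) * ‖twistDiff 0 u p‖ₑ ^ 2
  set G := (Metric.ball (0 : Eu d) 1)ᶜ.indicator fun z => ENNReal.ofReal (radialKernel α z)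
  have hGm : Measurable G := Measurable.indicator (by fun_prop) measurableSet_ball.compl
  have hG : ∫⁻ z, G z < ⊤ := by
    rw [lintegral_indicator measurableSet_ball.compl]
    exact lintegral_far hα₁
  have hle : ∀ᵐ p ∂(pairMeasure d), F p ≤ (B ×ˢ B).indicator F p +
      2 * (G (p.2 - p.1) * ‖u p.1‖ₑ ^ 2 + G (p.2 - p.1) * ‖u (fractVec p.2)‖ₑ ^ 2) := by
    have h1 : ∀ᵐ p ∂(pairMeasure d), p.1 ∈ unitCell d :=
      Measure.quasiMeasurePreserving_fst.ae (ae_mem_unitCell d)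
    filter_upwards [h1] with p hp
    by_cases hz : ‖p.2 - p.1‖ < 1
    · have hn := norm_le_of_mem_unitCell hp
      have hp1 : p.1 ∈ B := mem_ball_zero_iff.2 (by linarith)
      have hp2 : p.2 ∈ B := mem_ball_zero_iff.2 (by
        have := norm_add_le (p.2 - p.1) p.1
        rw [sub_add_cancel] at this
        linarith)
      rw [indicator_of_mem (show p ∈ B ×ˢ B from ⟨hp1, hp2⟩)]
      exact le_self_add
    · have hz' : p.2 - p.1 ∈ (Metric.ball (0 : Eu d) 1)ᶜ := by simpa using hz
      refine le_trans ?_ le_add_self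
      simp only [F, G, indicator_of_mem hz', ← mul_add]
      rw [mul_left_comm]
      gcongr
      have := enorm_add_sq_le (perExt u p.1) (-(perExt u p.2))
      simp only [twistDiff, wave_zero_left, one_mul]
      rw [enorm_neg, ← sub_eq_add_neg, perExt_of_mem _ hp] at this
      rw [perExt_of_mem _ hp]
      exact this
  have hfr := measurable_fractVec d
  have hFm : Measurable F := by fun_prop
  refine (lintegral_mono_ae hle).trans_lt ?_
  have hu1 := hu r hr0
  have hBm : MeasurableSet (B ×ˢ B) := measurableSet_ball.prod measurableSet_ball
  have ha := lintegral_pair_fst (h := fun x => ‖u x‖ₑ ^ 2) hGm (by fun_prop)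
  have hb := lintegral_pair_snd (h := fun x => ‖u x‖ₑ ^ 2) hGm (by fun_prop)
  rw [lintegral_add_left (hFm.indicator hBm), lintegral_const_mul _ (by fun_prop),
    lintegral_add_left (by fun_prop), ha, hb, lintegral_indicator hBm]
  have hfin : (∫⁻ z, G z) * ∫⁻ x, ‖u x‖ₑ ^ 2 ∂(cellMeasure d) < ⊤ := by
    rw [lintegral_enorm_sq_coe]
    exact ENNReal.mul_lt_top hG ENNReal.ofReal_lt_top
  refine ENNReal.add_lt_top.2 ⟨lt_of_le_of_lt ?_ hu1, ENNReal.mul_lt_top (by simp)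
    (ENNReal.add_lt_top.2 ⟨hfin, hfin⟩)⟩
  refine lintegral_mono' (Measure.restrict_mono le_rfl ?_) le_rfl
  rw [pairMeasure, cellMeasure, Measure.volume_eq_prod, ← Measure.restrict_univ (μ := volume),
    Measure.prod_restrict, Measure.restrict_univ]
  exact Measure.restrict_le_self

lemma fractVec_add_latticeVec (x : Eu d) (n : Fin d → ℤ) : fractVec (x + latticeVec n) = fractVec x := by
  ext i
  simp [fractVec, latticeVec]

/-- Instead of covering the ball by finitely many cells, average over base points `x` in `Ω`: if
`|y| < r`, then `y - x` always lies in the ball of radius `r + √d`, so the convolution identity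
`lintegral_pair_snd` gives the bound. -/
lemma lintegral_ball_fractVec {h : Eu d → ENNReal} (hm : Measurable h)
    (hf : ∫⁻ x, h x ∂(cellMeasure d) < ⊤) (r : ℝ) :
    ∫⁻ x in Metric.ball (0 : Eu d) r, h (fractVec x) < ⊤ := by
  have hfr := measurable_fractVec d
  have hG : Measurable ((Metric.ball (0 : Eu d) (r + √d)).indicator fun _ => (1 : ENNReal)) :=
    measurable_const.indicator measurableSet_ball
  have h1 := lintegral_pair_snd hG hm
  rw [lintegral_indicator measurableSet_ball, setLIntegral_one] at h1
  refine lt_of_le_of_lt ?_ (ENNReal.mul_lt_top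
    (measure_ball_lt_top (μ := (volume : Measure (Eu d))) (x := 0) (r := r + √d)) hf)
  rw [← h1, pairMeasure, lintegral_prod _ (by fun_prop)]
  calc ∫⁻ x in Metric.ball (0 : Eu d) r, h (fractVec x)
      = ∫⁻ _ : Eu d, (∫⁻ x in Metric.ball (0 : Eu d) r, h (fractVec x)) ∂(cellMeasure d) := by
        rw [lintegral_const, measure_univ, mul_one]
    _ ≤ _ := by
        refine lintegral_mono_ae ?_
        filter_upwards [ae_mem_unitCell d] with x hx
        rw [← lintegral_indicator measurableSet_ball]
        refine lintegral_mono fun y => ?_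
        by_cases hy : y ∈ Metric.ball (0 : Eu d) r
        · have h3 : y - x ∈ Metric.ball (0 : Eu d) (r + √d) := by
            rw [mem_ball_zero_iff] at hy ⊢
            have := norm_sub_le y x
            have := norm_le_of_mem_unitCell hx
            linarith
          simp [indicator_of_mem hy, indicator_of_mem h3]
        · simp [indicator_of_notMem hy]

/-- The inner integral over all `y` is a periodic function of `x`, because a common lattice shift of
both points changes nothing. Integrability over the cell therefore extends to every ball. -/
lemma mem_of_energy_lt_top {u : L2Cell d} (hu : energy α 0 u < ⊤) : u ∈ perSobolev d (α / 2) := by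
  rw [mem_perSobolev_iff_gagliardo]
  intro r _
  have hm := measurable_twistDiff 0 u
  set F := fun p : Eu d × Eu d => ENNReal.ofReal (radialKernel α (p.2 - p.1)) * ‖twistDiff 0 u p‖ₑ ^ 2
    with hF
  have hFm : Measurable F := by fun_prop
  set g := fun x : Eu d => ∫⁻ y, F (x, y) with hg
  have hgm : Measurable g := hFm.lintegral_prod_right'
  have hgp : ∀ x, g (fractVec x) = g x := fun x => by
    obtain ⟨n, hn⟩ : ∃ n : Fin d → ℤ, fractVec x = x + latticeVec n := by
      refine ⟨fun i => -⌊x i⌋, ?_⟩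
      ext i
      simp [fractVec, latticeVec, Int.fract, sub_eq_add_neg]
    simp only [hg]
    rw [hn, ← lintegral_add_right_eq_self _ (latticeVec n)]
    refine lintegral_congr fun y => ?_
    simp only [hF, twistDiff, perExt, fractVec_add_latticeVec, wave_zero_left,
      add_sub_add_right_eq_sub]
  have hgi : ∫⁻ x, g x ∂(cellMeasure d) < ⊤ := by
    rw [energy, pairMeasure, lintegral_prod _ hFm.aemeasurable] at hu
    exact hu
  have h := lintegral_ball_fractVec hgm hgi r
  simp only [hgp] at h
  refine lt_of_le_of_lt ?_ h
  rw [Measure.volume_eq_prod, ← Measure.prod_restrict, lintegral_prod _ hFm.aemeasurable]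
  exact lintegral_mono fun x => lintegral_mono' Measure.restrict_le_self le_rfl

lemma mem_perSobolev_iff (hα₁ : 1 < α) (hα₂ : α < 2) (ξ : Eu d) (u : L2Cell d) :
    u ∈ perSobolev d (α / 2) ↔ energy α ξ u < ⊤ := by
  rw [energy_lt_top_iff hα₁ hα₂]
  exact ⟨energy_lt_top_of_mem hα₁, mem_of_energy_lt_top⟩

/-! ### Exponentials belong to the Sobolev space -/

lemma memLp_wave (k : Eu d) : MemLp (wave k) 2 (cellMeasure d) := by
  refine MemLp.of_bound (Measurable.aestronglyMeasurable (by fun_prop)) 1 (ae_of_all _ fun x => ?_)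
  rw [norm_wave]

/-- The periodic exponential `x ↦ exp (2πi⟨n, x⟩)` as an element of `L₂(Ω)`. -/
def waveCell {d : ℕ} [NeZero d] (n : Fin d → ℤ) : L2Cell d := (memLp_wave (dualVec n)).toLp

lemma perExt_waveCell (n : Fin d → ℤ) :
    ∀ᵐ x : Eu d, perExt (waveCell n) x = wave (dualVec n) x := by
  have h := ae_fractVec (MemLp.coeFn_toLp (memLp_wave (d := d) (dualVec n)))
  filter_upwards [h] with x hx
  rw [perExt, ← wave_dualVec_fractVec]
  exact hx

lemma ae_pair {p : Eu d × Eu d → Prop} (h : ∀ᵐ z : Eu d × Eu d, p z) : ∀ᵐ z ∂(pairMeasure d), p z :=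
  (pairMeasure_absolutelyContinuous d).ae_le h

/-- Up to a unimodular factor the difference at `(x,y)` depends only on `y - x`, so the energy is
one integral of `|1 - exp|²` against the kernel. -/
lemma waveCell_mem (hα₁ : 1 < α) (hα₂ : α < 2) (n : Fin d → ℤ) :
    waveCell n ∈ perSobolev d (α / 2) := by
  rw [mem_perSobolev_iff hα₁ hα₂ 0]
  have h := lintegral_pair_fst (d := d) (G := fun z => ENNReal.ofReal
    (4 * (quadLin (‖(dualVec n : Eu d)‖ * ‖z‖) * radialKernel α z))) (h := fun _ => 1) (by fun_prop) (by fun_prop)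
  simp only [mul_one, lintegral_const, measure_univ] at h
  simp_rw [ENNReal.ofReal_mul zero_le_four] at h
  rw [lintegral_const_mul _ (by fun_prop), lintegral_const_mul _ (by fun_prop),
    lintegral_quadLin hα₁ hα₂ (norm_nonneg _)] at h
  refine lt_of_le_of_lt (lintegral_mono_ae ?_) ((lintegral_const_mul _ (by fun_prop)).trans
    h |>.trans_lt (ENNReal.mul_lt_top (by simp) ENNReal.ofReal_lt_top))
  filter_upwards [ae_pair (ae_fst (perExt_waveCell n)), ae_pair (ae_snd (perExt_waveCell n))]
    with p h1 h2
  have h3 : twistDiff 0 (waveCell n) p = wave (dualVec n) p.1 * (1 - wave (dualVec n) (p.2 - p.1)) := by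
    rw [twistDiff, h1, h2, wave_zero_left, one_mul, mul_sub, mul_one, ← wave_add_right,
      add_sub_cancel]
  rw [h3, ← ofReal_norm, norm_mul, norm_wave, one_mul, ← ENNReal.ofReal_pow (norm_nonneg _),
    ← ENNReal.ofReal_mul (radialKernel_nonneg _ _), ← ENNReal.ofReal_mul zero_le_four]
  refine ENNReal.ofReal_le_ofReal ?_
  have := norm_one_sub_wave_sq_le (dualVec n) (p.2 - p.1)
  nlinarith [radialKernel_nonneg α (p.2 - p.1)]

lemma inner_waveCell (n : Fin d → ℤ) (u : L2Cell d) : inner ℂ (waveCell n) u = fourierCell u n := by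
  rw [L2.inner_def, fourierCell]
  refine integral_congr_ae ?_
  filter_upwards [MemLp.coeFn_toLp (memLp_wave (d := d) (dualVec n))] with x hx
  rw [waveCell, hx, RCLike.inner_apply, mul_comm]

lemma oneCell_eq : oneCell d = waveCell 0 := by
  refine MemLp.toLp_congr _ _ (ae_of_all _ fun x => ?_)
  rw [show (dualVec 0 : Eu d) = 0 by ext i; simp [dualVec, latticeVec], wave_zero_left]

lemma oneCell_mem (hα₁ : 1 < α) (hα₂ : α < 2) : oneCell d ∈ perSobolev d (α / 2) :=
  oneCell_eq (d := d) ▸ waveCell_mem hα₁ hα₂ 0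

/-- The form domain contains all periodic exponentials, which are complete. This density makes the
operator of the form single valued. -/
lemma eq_zero_of_inner_perSobolev (hα₁ : 1 < α) (hα₂ : α < 2) (f : L2Cell d)
    (h : ∀ v ∈ perSobolev d (α / 2), inner ℂ v f = 0) : f = 0 :=
  eq_zero_of_fourierCell f fun n => by
    rw [← inner_waveCell]
    exact h _ (waveCell_mem hα₁ hα₂ n)

lemma norm_oneCell : ‖oneCell d‖ = 1 := by
  have h : inner ℂ (oneCell d) (oneCell d) = (1 : ℂ) := by
    rw [L2.inner_def]
    have : (fun x => inner ℂ (oneCell d x) (oneCell d x)) =ᵐ[cellMeasure d] fun _ => (1 : ℂ) := by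
      filter_upwards [MemLp.coeFn_toLp (memLp_const (μ := cellMeasure d) (p := 2) (1 : ℂ))] with x hx
      rw [oneCell, hx]
      simp
    rw [integral_congr_ae this]
    simp
  have h2 := congrArg RCLike.re h
  rw [inner_self_eq_norm_sq, RCLike.one_re] at h2
  exact (pow_eq_one_iff_of_nonneg (norm_nonneg _) two_ne_zero).1 h2

lemma inner_oneCell (u : L2Cell d) : inner ℂ (oneCell d) u = ∫ x, u x ∂(cellMeasure d) := by
  rw [L2.inner_def]
  refine integral_congr_ae ?_
  filter_upwards [MemLp.coeFn_toLp (memLp_const (μ := cellMeasure d) (p := 2) (1 : ℂ))] with x hx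
  rw [oneCell, hx]
  simp

lemma constProj_apply (u : L2Cell d) : constProj d u = inner ℂ (oneCell d) u • oneCell d :=
  Submodule.starProjection_unit_singleton ℂ norm_oneCell u

end Energy

/-! ### Closed forms in Hilbert space -/

section Abstract

open Filter Topology

variable {H H' : Type*} [NormedAddCommGroup H] [InnerProductSpace ℂ H] [CompleteSpace H]
  [NormedAddCommGroup H'] [InnerProductSpace ℂ H'] [CompleteSpace H']

/-- The linear map `T`, defined on the subspace `V` of `H`, is closed. -/
def IsClosedMapOn (V : Submodule ℂ H) (T : V →ₗ[ℂ] H') : Prop :=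
  ∀ (u : ℕ → V) (a : H) (b : H'), Tendsto (fun n => (u n : H)) atTop (𝓝 a) →
    Tendsto (fun n => T (u n)) atTop (𝓝 b) → ∃ h : a ∈ V, T ⟨a, h⟩ = b

variable {V : Submodule ℂ H} {T : V →ₗ[ℂ] H'} {B : H →L[ℂ] H} {κ : ℝ}

/-- The map `u ↦ (B u, T u)` from the form domain. -/
def graphMap (T : V →ₗ[ℂ] H') (B : H →L[ℂ] H) : V →ₗ[ℂ] WithLp 2 (H × H') :=
  (WithLp.linearEquiv 2 ℂ (H × H')).symm.toLinearMap ∘ₗ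
    ((B.toLinearMap ∘ₗ V.subtype).prod T)

lemma graphMap_apply (v : V) : graphMap T B v = WithLp.toLp 2 (B v, T v) := rfl

lemma inner_graphMap (u v : V) :
    inner ℂ (graphMap T B u) (graphMap T B v) = inner ℂ (B u) (B v) + inner ℂ (T u) (T v) := rfl

lemma norm_le_graphMap (hκ : 0 ≤ κ) (hb : ∀ v : V, ‖v‖ ≤ κ * (‖B v‖ + ‖T v‖)) (v : V) :
    ‖v‖ ≤ 2 * κ * ‖graphMap T B v‖ := by
  have h1 : ‖B v‖ ≤ ‖graphMap T B v‖ := WithLp.norm_fst_le H (graphMap T B v)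
  have h2 : ‖T v‖ ≤ ‖graphMap T B v‖ := WithLp.norm_snd_le H (graphMap T B v)
  calc ‖v‖ ≤ κ * (‖B v‖ + ‖T v‖) := hb v
    _ ≤ κ * (‖graphMap T B v‖ + ‖graphMap T B v‖) := by gcongr
    _ = _ := by ring

/-- The bound `hb` makes preimages of a convergent sequence Cauchy in `H`; closedness of `T` and
continuity of `B` then identify the limit. -/
lemma isComplete_range_graphMap (hT : IsClosedMapOn V T) (hκ : 0 ≤ κ)
    (hb : ∀ v : V, ‖v‖ ≤ κ * (‖B v‖ + ‖T v‖)) :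
    IsComplete ((graphMap T B).range : Set (WithLp 2 (H × H'))) := by
  refine IsClosed.isComplete (IsSeqClosed.isClosed fun x y hx hy => ?_)
  choose u hu using hx
  have hc : CauchySeq fun n => (u n : H) := by
    have hy' := hy.cauchySeq
    rw [Metric.cauchySeq_iff'] at hy' ⊢
    intro ε hε
    -- The added `1` covers the case `κ = 0`.
    obtain ⟨N, hN⟩ := hy' (ε / (2 * κ + 1)) (by positivity)
    refine ⟨N, fun n hn => ?_⟩
    have h1 := hN n hn
    rw [dist_eq_norm, ← hu, ← hu, ← map_sub, lt_div_iff₀ (by positivity)] at h1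
    have h2 := norm_le_graphMap (B := B) hκ hb (u n - u N)
    rw [dist_eq_norm]
    have h3 : ‖(u n : H) - u N‖ = ‖u n - u N‖ := rfl
    nlinarith [norm_nonneg (graphMap T B (u n - u N))]
  obtain ⟨a, ha⟩ := cauchySeq_tendsto_of_complete hc
  have hy2 : Tendsto (fun n => T (u n)) atTop (𝓝 y.snd) := by
    have : Tendsto (fun n => (x n).snd) atTop (𝓝 y.snd) :=
      ((WithLp.prod_continuous_ofLp 2 H H').snd.tendsto y).comp hy
    refine this.congr fun n => ?_
    rw [← hu n]
    rfl
  have hy1 : Tendsto (fun n => B (u n)) atTop (𝓝 y.fst) := by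
    have : Tendsto (fun n => (x n).fst) atTop (𝓝 y.fst) :=
      ((WithLp.prod_continuous_ofLp 2 H H').fst.tendsto y).comp hy
    refine this.congr fun n => ?_
    rw [← hu n]
    rfl
  obtain ⟨hV, hTa⟩ := hT u a y.snd ha hy2
  refine ⟨⟨a, hV⟩, ?_⟩
  rw [graphMap_apply, hTa]
  have : B a = y.fst := tendsto_nhds_unique ((B.continuous.tendsto a).comp ha) hy1
  simp only [this]
  rfl

/-- The Riesz representation theorem in the form domain, for a functional and for the embedding. -/
lemma exists_riesz (hT : IsClosedMapOn V T) (hκ : 0 ≤ κ)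
    (hb : ∀ v : V, ‖v‖ ≤ κ * (‖B v‖ + ‖T v‖)) :
    (∀ (φ : V →ₗ[ℂ] ℂ) (M : ℝ), (∀ v, ‖φ v‖ ≤ M * (‖v‖ + ‖T v‖)) → 0 ≤ M →
      ∃ u : V, ∀ v : V, inner ℂ (B u) (B v) + inner ℂ (T u) (T v) = φ v) ∧
    ∃ R : H →L[ℂ] H, ∀ f : H, ∃ h : R f ∈ V, ∀ v : V,
      inner ℂ (B (R f)) (B v) + inner ℂ (T ⟨R f, h⟩) (T v) = inner ℂ f (v : H) := by
  have hinj : Function.Injective (graphMap T B) := by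
    rw [injective_iff_map_eq_zero]
    intro v hv
    have := norm_le_graphMap (B := B) hκ hb v
    rw [hv, norm_zero, mul_zero] at this
    exact norm_le_zero_iff.1 this
  set G := (graphMap T B).range
  have hG : CompleteSpace G := (isComplete_range_graphMap (B := B) hT hκ hb).completeSpace_coe
  set e := LinearEquiv.ofInjective (graphMap T B) hinj
  have he : ∀ v, ((e v : G) : WithLp 2 (H × H')) = graphMap T B v := fun v => rfl
  have hes : ∀ g : G, ‖e.symm g‖ ≤ 2 * κ * ‖g‖ := fun g => by
    have := norm_le_graphMap (B := B) hκ hb (e.symm g)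
    rwa [← he, e.apply_symm_apply] at this
  have hTs : ∀ g : G, ‖T (e.symm g)‖ ≤ ‖g‖ := fun g => by
    have h2 : ‖T (e.symm g)‖ ≤ ‖graphMap T B (e.symm g)‖ :=
      WithLp.norm_snd_le H (graphMap T B (e.symm g))
    rwa [← he, e.apply_symm_apply] at h2
  constructor
  · intro φ M hφ hM
    let ψ : StrongDual ℂ G := (φ ∘ₗ e.symm.toLinearMap).mkContinuous (M * (2 * κ + 1)) fun g => by
      calc ‖φ (e.symm g)‖ ≤ M * (‖e.symm g‖ + ‖T (e.symm g)‖) := hφ _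
        _ ≤ M * (2 * κ * ‖g‖ + ‖g‖) := by gcongr; exacts [hes g, hTs g]
        _ = _ := by ring
    refine ⟨e.symm ((InnerProductSpace.toDual ℂ G).symm ψ), fun v => ?_⟩
    have h := InnerProductSpace.toDual_symm_apply (𝕜 := ℂ) (x := e v) (y := ψ)
    rw [← inner_graphMap, ← he, ← he, e.apply_symm_apply]
    refine h.trans ?_
    simp [ψ]
  · let ι : G →L[ℂ] H := (V.subtype ∘ₗ e.symm.toLinearMap).mkContinuous (2 * κ) hes
    -- With `ι` the embedding into `H` of the form domain in its graph norm, `(ι*f, v) = (f, ιv)` is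
    -- already the weak equation; composing with `ι` returns to `H`.
    refine ⟨ι ∘L ContinuousLinearMap.adjoint ι, fun f => ?_⟩
    have e1 : (ι ∘L ContinuousLinearMap.adjoint ι) f =
        (e.symm (ContinuousLinearMap.adjoint ι f) : H) := rfl
    refine ⟨e1 ▸ (e.symm _).2, fun v => ?_⟩
    have h := ContinuousLinearMap.adjoint_inner_left ι (e v) f
    have e2 : ι (e v) = v := congrArg Subtype.val (e.symm_apply_apply v)
    rw [e2] at h
    rw [← h]
    have h3 := inner_graphMap (T := T) (B := B) (e.symm (ContinuousLinearMap.adjoint ι f)) v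
    rw [← he, ← he, e.apply_symm_apply] at h3
    exact h3.symm

end Abstract

/-! ### The form map -/

/-- The standing assumptions on the order and on the coefficient. -/
structure Setting (d : ℕ) (α μm μp : ℝ) (μ : Eu d × Eu d → ℝ) : Prop where
  one_lt : 1 < α
  lt_two : α < 2
  pos : 0 < μm
  coeff : IsCoefficient μm μp μ

/-- The square root of half of the Lévy kernel. -/
def formWeight {d : ℕ} (α : ℝ) (μ : Eu d × Eu d → ℝ) (p : Eu d × Eu d) : ℝ :=
  √(levyKernel α μ p / 2)

/-- The function whose squared norm in `L₂(Ω × ℝ^d)` is `a(ξ)[u,u]`. -/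
def formFun {d : ℕ} (α : ℝ) (μ : Eu d × Eu d → ℝ) (ξ : Eu d) (u : Eu d → ℂ) (p : Eu d × Eu d) : ℂ :=
  (formWeight α μ p : ℂ) * twistDiff ξ u p

lemma twistDiff_add {d : ℕ} [NeZero d] (ξ : Eu d) (u v : L2Cell d) :
    ∀ᵐ p ∂(pairMeasure d), twistDiff ξ (u + v : L2Cell d) p = twistDiff ξ u p + twistDiff ξ v p := by
  filter_upwards [ae_pair (ae_fst (perExt_add u v)), ae_pair (ae_snd (perExt_add u v))] with p h1 h2
  simp only [twistDiff, h1, h2]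
  ring

lemma twistDiff_smul {d : ℕ} [NeZero d] (ξ : Eu d) (c : ℂ) (u : L2Cell d) :
    ∀ᵐ p ∂(pairMeasure d), twistDiff ξ (c • u : L2Cell d) p = c * twistDiff ξ u p := by
  filter_upwards [ae_pair (ae_fst (perExt_smul c u)), ae_pair (ae_snd (perExt_smul c u))]
    with p h1 h2
  simp only [twistDiff, h1, h2]
  ring

namespace Setting

variable {d : ℕ} [NeZero d] {α μm μp : ℝ} {μ : Eu d × Eu d → ℝ}

lemma ae_bounds (S : Setting d α μm μp μ) : ∀ᵐ p ∂(pairMeasure d), μm ≤ μ p ∧ μ p ≤ μp :=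
  ae_pair S.coeff.bounds

lemma le_upper (S : Setting d α μm μp μ) : μm ≤ μp := by
  obtain ⟨p, hp⟩ := S.coeff.bounds.exists
  exact hp.1.trans hp.2

lemma upper_pos (S : Setting d α μm μp μ) : 0 < μp := S.pos.trans_le S.le_upper

lemma aemeasurable (S : Setting d α μm μp μ) : AEMeasurable μ (pairMeasure d) :=
  (S.coeff.measurable.mono_ac (pairMeasure_absolutelyContinuous d)).aemeasurable

lemma aemeasurable_levyKernel (S : Setting d α μm μp μ) :
    AEMeasurable (levyKernel α μ) (pairMeasure d) := by
  have h := S.aemeasurable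
  simp_rw [funext (levyKernel_eq α μ)]
  exact h.mul (Measurable.aemeasurable (by fun_prop))

lemma aemeasurable_formWeight (S : Setting d α μm μp μ) :
    AEMeasurable (formWeight α μ) (pairMeasure d) :=
  Real.continuous_sqrt.measurable.comp_aemeasurable (S.aemeasurable_levyKernel.div_const 2)

lemma levyKernel_nonneg (S : Setting d α μm μp μ) :
    ∀ᵐ p ∂(pairMeasure d), 0 ≤ levyKernel α μ p := by
  filter_upwards [S.ae_bounds] with p hp
  rw [levyKernel_eq]
  exact mul_nonneg (S.pos.le.trans hp.1) (radialKernel_nonneg _ _)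

lemma formWeight_sq (S : Setting d α μm μp μ) :
    ∀ᵐ p ∂(pairMeasure d), formWeight α μ p ^ 2 = levyKernel α μ p / 2 := by
  filter_upwards [S.levyKernel_nonneg] with p hp
  rw [formWeight, Real.sq_sqrt (by positivity)]

lemma enorm_formWeight_mul_sq (S : Setting d α μm μp μ) (f : Eu d × Eu d → ℂ) :
    ∀ᵐ p ∂(pairMeasure d), ‖(formWeight α μ p : ℂ) * f p‖ₑ ^ 2 =
      ENNReal.ofReal (μ p / 2) * (ENNReal.ofReal (radialKernel α (p.2 - p.1)) * ‖f p‖ₑ ^ 2) := by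
  filter_upwards [S.formWeight_sq, S.ae_bounds] with p h1 h2
  have h0 : 0 ≤ μ p / 2 := by linarith [S.pos, h2.1]
  rw [enorm_mul, mul_pow, ← mul_assoc, ← ENNReal.ofReal_mul h0]
  congr 1
  rw [← ofReal_norm, ← ENNReal.ofReal_pow (norm_nonneg _), Complex.norm_real, Real.norm_eq_abs,
    sq_abs, h1, levyKernel_eq]
  congr 1
  ring

lemma lintegral_formWeight_le (S : Setting d α μm μp μ) (f : Eu d × Eu d → ℂ) :
    ∫⁻ p, ‖(formWeight α μ p : ℂ) * f p‖ₑ ^ 2 ∂(pairMeasure d) ≤ ENNReal.ofReal (μp / 2) *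
      ∫⁻ p, ENNReal.ofReal (radialKernel α (p.2 - p.1)) * ‖f p‖ₑ ^ 2 ∂(pairMeasure d) := by
  rw [← lintegral_const_mul' _ _ ENNReal.ofReal_ne_top]
  refine lintegral_mono_ae ?_
  filter_upwards [S.enorm_formWeight_mul_sq f, S.ae_bounds] with p h1 h2
  rw [h1]
  gcongr
  exact h2.2

lemma le_lintegral_formWeight (S : Setting d α μm μp μ) (f : Eu d × Eu d → ℂ) :
    ENNReal.ofReal (μm / 2) *
      ∫⁻ p, ENNReal.ofReal (radialKernel α (p.2 - p.1)) * ‖f p‖ₑ ^ 2 ∂(pairMeasure d) ≤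
    ∫⁻ p, ‖(formWeight α μ p : ℂ) * f p‖ₑ ^ 2 ∂(pairMeasure d) := by
  rw [← lintegral_const_mul' _ _ ENNReal.ofReal_ne_top]
  refine lintegral_mono_ae ?_
  filter_upwards [S.enorm_formWeight_mul_sq f, S.ae_bounds] with p h1 h2
  rw [h1]
  gcongr
  exact h2.1

lemma aestronglyMeasurable_formWeight_mul (S : Setting d α μm μp μ) {f : Eu d × Eu d → ℂ}
    (hf : Measurable f) :
    AEStronglyMeasurable (fun p => (formWeight α μ p : ℂ) * f p) (pairMeasure d) :=
  ((Complex.measurable_ofReal.comp_aemeasurable S.aemeasurable_formWeight).mul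
    hf.aemeasurable).aestronglyMeasurable

/-- The two-sided bounds on `μ` make the weighted and the unweighted energies comparable, so square
integrability characterizes the form domain at every `ξ`. -/
lemma memLp_formFun_iff (S : Setting d α μm μp μ) (ξ : Eu d) (u : L2Cell d) :
    MemLp (formFun α μ ξ u) 2 (pairMeasure d) ↔ u ∈ perSobolev d (α / 2) := by
  rw [mem_perSobolev_iff S.one_lt S.lt_two ξ, memLp_two_iff_lintegral
    (f := formFun α μ ξ u) (S.aestronglyMeasurable_formWeight_mul (measurable_twistDiff ξ u))]
  have h1 := S.lintegral_formWeight_le (twistDiff ξ u)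
  have h2 := S.le_lintegral_formWeight (twistDiff ξ u)
  constructor
  · intro h
    have h3 := h2.trans_lt h
    refine ENNReal.lt_top_of_mul_ne_top_right h3.ne ?_
    simpa using S.pos
  · intro h
    exact h1.trans_lt (ENNReal.mul_lt_top ENNReal.ofReal_lt_top h)

lemma memLp_formFun (S : Setting d α μm μp μ) (ξ : Eu d) (u : perSobolev d (α / 2)) :
    MemLp (formFun α μ ξ (u : L2Cell d)) 2 (pairMeasure d) := (S.memLp_formFun_iff ξ u).2 u.2

/-- The map `T(ξ)` with `a(ξ)[u,v] = (T(ξ)u, T(ξ)v)`. -/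
def formMap (S : Setting d α μm μp μ) (ξ : Eu d) :
    perSobolev d (α / 2) →ₗ[ℂ] Lp ℂ 2 (pairMeasure d) where
  toFun u := (S.memLp_formFun ξ u).toLp
  map_add' u v := by
    rw [← MemLp.toLp_add]
    refine MemLp.toLp_congr _ _ ?_
    filter_upwards [twistDiff_add ξ (u : L2Cell d) v] with p hp
    simp only [Pi.add_apply, formFun, Submodule.coe_add, hp]
    ring
  map_smul' c u := by
    rw [RingHom.id_apply, ← MemLp.toLp_const_smul]
    refine MemLp.toLp_congr _ _ ?_
    filter_upwards [twistDiff_smul ξ c (u : L2Cell d)] with p hp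
    simp only [Pi.smul_apply, formFun, Submodule.coe_smul, hp, smul_eq_mul]
    ring

lemma coeFn_formMap (S : Setting d α μm μp μ) (ξ : Eu d) (u : perSobolev d (α / 2)) :
    S.formMap ξ u =ᵐ[pairMeasure d] formFun α μ ξ (u : L2Cell d) :=
  MemLp.coeFn_toLp (S.memLp_formFun ξ u)

lemma inner_formMap (S : Setting d α μm μp μ) (ξ : Eu d) (u v : perSobolev d (α / 2)) :
    Integrable (formIntegrand α μ ξ (u : L2Cell d) (v : L2Cell d)) (pairMeasure d) ∧
      fiberForm α μ ξ (u : L2Cell d) (v : L2Cell d) = inner ℂ (S.formMap ξ v) (S.formMap ξ u) := by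
  have e : (fun p => (2 : ℂ) * inner ℂ (S.formMap ξ v p) (S.formMap ξ u p)) =ᵐ[pairMeasure d]
      formIntegrand α μ ξ (u : L2Cell d) (v : L2Cell d) := by
    filter_upwards [S.coeFn_formMap ξ u, S.coeFn_formMap ξ v, S.formWeight_sq] with p h1 h2 h3
    -- The two differences agree up to `exp(i⟨ξ,x⟩)`, which has modulus one and drops out of the
    -- sesquilinear product.
    have hq : ∀ w : Eu d → ℂ, quasiDiff ξ w p = wave ξ p.1 * twistDiff ξ w p := fun w => by
      rw [quasiDiff, twistDiff, mul_sub, ← mul_assoc, ← wave_add_right, add_sub_cancel]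
      rfl
    rw [h1, h2, formIntegrand, hq, hq, formFun, formFun, RCLike.inner_apply, map_mul, map_mul,
      Complex.conj_ofReal]
    have h4 : (levyKernel α μ p : ℂ) = 2 * (formWeight α μ p : ℂ) ^ 2 := by
      rw [← Complex.ofReal_pow, h3]
      push_cast
      ring
    rw [h4]
    linear_combination (-2 * (formWeight α μ p : ℂ) ^ 2 * twistDiff ξ (u : L2Cell d) p *
      (starRingEnd ℂ) (twistDiff ξ (v : L2Cell d) p)) * wave_mul_conj ξ p.1
  have hi := L2.integrable_inner (𝕜 := ℂ) (S.formMap ξ v) (S.formMap ξ u)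
  refine ⟨(hi.const_mul 2).congr e, ?_⟩
  rw [fiberForm, ← integral_congr_ae e, integral_const_mul, L2.inner_def]
  ring

lemma ofReal_norm_formMap_sq (S : Setting d α μm μp μ) (ξ : Eu d) (u : perSobolev d (α / 2)) :
    ENNReal.ofReal (‖S.formMap ξ u‖ ^ 2) =
      ∫⁻ p, ‖formFun α μ ξ (u : L2Cell d) p‖ₑ ^ 2 ∂(pairMeasure d) := by
  rw [← lintegral_enorm_sq_coe]
  refine lintegral_congr_ae ?_
  filter_upwards [S.coeFn_formMap ξ u] with p hp
  rw [hp]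

lemma le_norm_formMap_sq (S : Setting d α μm μp μ) (ξ : Eu d) (u : perSobolev d (α / 2)) {ρ : ℝ}
    (hρ : 0 ≤ ρ) (h : ∀ n, fourierCell (u : L2Cell d) n = 0 ∨ ρ ≤ ‖dualVec n + ξ‖) :
    μm * cZero d α * ρ ^ α * ‖(u : L2Cell d)‖ ^ 2 ≤ ‖S.formMap ξ u‖ ^ 2 := by
  have hc := (cZero_pos (d := d) S.one_lt S.lt_two).le
  have h1 := le_lintegral_twistDiff S.one_lt S.lt_two ξ (u : L2Cell d) hρ h
  have h2 := S.le_lintegral_formWeight (twistDiff ξ (u : L2Cell d))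
  rw [← ENNReal.ofReal_le_ofReal_iff (by positivity), ofReal_norm_formMap_sq]
  refine le_trans ?_ h2
  refine le_trans (le_of_eq ?_) (mul_le_mul_right h1 _)
  have := S.pos.le
  rw [← ENNReal.ofReal_mul (by positivity), ← ENNReal.ofReal_mul (by positivity)]
  congr 1
  ring

/-- Coercivity of the forms on the whole form domain. -/
lemma le_norm_formMap_sq_of_norm_le (S : Setting d α μm μp μ) {ξ : Eu d} (hξ : ‖ξ‖ ≤ Real.pi)
    (u : perSobolev d (α / 2)) :
    μm * cZero d α * ‖ξ‖ ^ α * ‖(u : L2Cell d)‖ ^ 2 ≤ ‖S.formMap ξ u‖ ^ 2 := by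
  refine S.le_norm_formMap_sq ξ u (norm_nonneg _) fun n => Or.inr ?_
  rcases eq_or_ne n 0 with rfl | hn
  · rw [show (dualVec 0 : Eu d) = 0 by ext i; simp [dualVec, latticeVec], zero_add]
  · exact hξ.trans (pi_le_norm_dualVec_add hn hξ)

/-- Coercivity of the forms on functions of zero mean. -/
lemma dZero_mul_le (S : Setting d α μm μp μ) {ξ : Eu d} (hξ : ‖ξ‖ ≤ Real.pi)
    (u : perSobolev d (α / 2)) (hu : inner ℂ (oneCell d) (u : L2Cell d) = 0) :
    dZero d α μm * ‖(u : L2Cell d)‖ ^ 2 ≤ ‖S.formMap ξ u‖ ^ 2 := by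
  refine S.le_norm_formMap_sq ξ u Real.pi_pos.le fun n => ?_
  rcases eq_or_ne n 0 with rfl | hn
  · left
    rwa [← inner_waveCell, ← oneCell_eq]
  · exact Or.inr (pi_le_norm_dualVec_add hn hξ)

/-- The forms at `ξ` and at `0` differ by a bounded perturbation of order `|ξ|^α`. -/
lemma norm_formMap_sub_sq_le (S : Setting d α μm μp μ) (ξ : Eu d) (u : perSobolev d (α / 2)) :
    ‖S.formMap ξ u - S.formMap 0 u‖ ^ 2 ≤
      2 * μp * quadLinMass d α * ‖ξ‖ ^ α * ‖(u : L2Cell d)‖ ^ 2 := by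
  have hQ := quadLinMass_nonneg d α
  have hp := S.upper_pos.le
  rw [← ENNReal.ofReal_le_ofReal_iff (by positivity), ← lintegral_enorm_sq_coe]
  have e : ∫⁻ p, ‖(S.formMap ξ u - S.formMap 0 u : Lp ℂ 2 (pairMeasure d)) p‖ₑ ^ 2 ∂(pairMeasure d) =
      ∫⁻ p, ‖(formWeight α μ p : ℂ) * ((1 - wave ξ (p.2 - p.1)) * perExt (u : L2Cell d) p.2)‖ₑ ^ 2
        ∂(pairMeasure d) := by
    refine lintegral_congr_ae ?_
    filter_upwards [S.coeFn_formMap ξ u, S.coeFn_formMap 0 u,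
      Lp.coeFn_sub (S.formMap ξ u) (S.formMap 0 u)] with p h1 h2 h3
    rw [h3, Pi.sub_apply, h1, h2, formFun, formFun, twistDiff_eq_add ξ]
    ring_nf
  rw [e]
  refine (S.lintegral_formWeight_le _).trans ?_
  refine (mul_le_mul_right (lintegral_one_sub_wave S.one_lt S.lt_two ξ (u : L2Cell d)) _).trans ?_
  rw [← ENNReal.ofReal_mul (by positivity)]
  refine le_of_eq (congrArg _ ?_)
  ring

/-- After passing to subsequences both convergences hold almost everywhere. As `T(ξ)u` is computed
pointwise from `u`, the limit must be the function attached to `a`; being in `L₂`, it places `a` in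
the form domain. -/
lemma isClosedMapOn_formMap (S : Setting d α μm μp μ) (ξ : Eu d) :
    IsClosedMapOn (perSobolev d (α / 2)) (S.formMap ξ) := by
  intro u a b hu hT
  obtain ⟨n₁, hn₁, h1⟩ := (tendstoInMeasure_of_tendsto_Lp hu).exists_seq_tendsto_ae
  obtain ⟨n₂, hn₂, h2⟩ :=
    (tendstoInMeasure_of_tendsto_Lp (hT.comp hn₁.tendsto_atTop)).exists_seq_tendsto_ae
  have h3 := ae_fractVec h1
  have h4 : ∀ᵐ p ∂(pairMeasure d), ∀ k, S.formMap ξ (u k) p = formFun α μ ξ (u k : L2Cell d) p :=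
    ae_all_iff.2 fun k => S.coeFn_formMap ξ (u k)
  have key : b =ᵐ[pairMeasure d] formFun α μ ξ a := by
    filter_upwards [ae_pair (ae_fst h3), ae_pair (ae_snd h3), h2, h4] with p q1 q2 q3 q4
    refine tendsto_nhds_unique q3 ?_
    simp only [Function.comp_apply, q4, formFun, twistDiff, perExt]
    exact ((q1.comp hn₂.tendsto_atTop).sub ((q2.comp hn₂.tendsto_atTop).const_mul _)).const_mul _
  have hb : MemLp (formFun α μ ξ a) 2 (pairMeasure d) := (memLp_congr_ae key).1 (Lp.memLp b)
  have ha := (S.memLp_formFun_iff ξ a).1 hb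
  refine ⟨ha, Lp.ext ?_⟩
  exact (S.coeFn_formMap ξ ⟨a, ha⟩).trans key.symm

/-! ### The resolvent -/

lemma fiberGraph_iff (S : Setting d α μm μp μ) (ξ : Eu d) (u f : L2Cell d) :
    (u, f) ∈ fiberGraph α μ ξ ↔ ∃ h : u ∈ perSobolev d (α / 2), ∀ v : perSobolev d (α / 2),
      inner ℂ (S.formMap ξ v) (S.formMap ξ ⟨u, h⟩) = inner ℂ (v : L2Cell d) f := by
  constructor
  · rintro ⟨h, h2⟩
    refine ⟨h, fun v => ?_⟩
    rw [← (S.inner_formMap ξ ⟨u, h⟩ v).2]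
    exact (h2 v v.2).2
  · rintro ⟨h, h2⟩
    refine ⟨h, fun v hv => ?_⟩
    have h3 := S.inner_formMap ξ ⟨u, h⟩ ⟨v, hv⟩
    exact ⟨h3.1, h3.2.trans (h2 ⟨v, hv⟩)⟩

/-- Needed for `toLinearPMap` to have the given subspace as its graph; it follows from density of
the form domain. -/
lemma fiberGraph_functional (S : Setting d α μm μp μ) (ξ : Eu d) :
    ∀ w ∈ fiberGraph α μ ξ, w.1 = 0 → w.2 = 0 := by
  rintro ⟨u, f⟩ hw hu
  simp only at hu
  subst hu
  obtain ⟨h, h2⟩ := (S.fiberGraph_iff ξ _ _).1 hw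
  refine eq_zero_of_inner_perSobolev S.one_lt S.lt_two f fun v hv => ?_
  rw [← h2 ⟨v, hv⟩]
  have : (⟨0, h⟩ : perSobolev d (α / 2)) = 0 := rfl
  rw [this, map_zero, inner_zero_right]

/-- Existence of the resolvent, with its variational characterization. -/
lemma exists_resolvent (S : Setting d α μm μp μ) (ξ : Eu d) {e : ℝ} (he : 0 < e) :
    ∃ R : L2Cell d →L[ℂ] L2Cell d, IsShiftedInverse (fiberOperator α μ ξ) e R ∧
      ∀ f, ∃ h : R f ∈ perSobolev d (α / 2), ∀ v : perSobolev d (α / 2),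
        inner ℂ (S.formMap ξ v) (S.formMap ξ ⟨R f, h⟩) + e * inner ℂ (v : L2Cell d) (R f) =
          inner ℂ (v : L2Cell d) f := by
  have hse : 0 < √e := Real.sqrt_pos.2 he
  -- With `B = √e` times the identity, the graph scalar product is the form plus `e` times the `L₂`
  -- product.
  obtain ⟨R, hR⟩ := (exists_riesz (S.isClosedMapOn_formMap ξ)
    (B := ((√e : ℝ) : ℂ) • ContinuousLinearMap.id ℂ (L2Cell d)) (κ := (√e)⁻¹) (by positivity)
    fun v => by
      have : ‖(((√e : ℝ) : ℂ) • ContinuousLinearMap.id ℂ (L2Cell d)) v‖ = √e * ‖v‖ := by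
        change ‖((√e : ℝ) : ℂ) • (v : L2Cell d)‖ = _
        rw [norm_smul, Complex.norm_real, Real.norm_of_nonneg hse.le]
        rfl
      rw [this, mul_add, inv_mul_cancel_left₀ hse.ne']
      have : 0 ≤ (√e)⁻¹ * ‖S.formMap ξ v‖ := by positivity
      linarith).2
  have hR' : ∀ f, ∃ h : R f ∈ perSobolev d (α / 2), ∀ v : perSobolev d (α / 2),
      inner ℂ (S.formMap ξ v) (S.formMap ξ ⟨R f, h⟩) + e * inner ℂ (v : L2Cell d) (R f) =
        inner ℂ (v : L2Cell d) f := fun f => by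
    obtain ⟨h, h2⟩ := hR f
    refine ⟨h, fun v => ?_⟩
    have h3 := congrArg (starRingEnd ℂ) (h2 v)
    simp only [map_add, inner_conj_symm, smul_apply,
      ContinuousLinearMap.id_apply, inner_smul_left, inner_smul_right, Complex.conj_ofReal] at h3
    rw [← h3, ← mul_assoc, ← Complex.ofReal_mul, Real.mul_self_sqrt he.le, add_comm]
    simp only [map_mul, Complex.conj_ofReal, inner_conj_symm]
  have hmem : ∀ f, (R f, f - (e : ℂ) • R f) ∈ fiberGraph α μ ξ := fun f => by
    obtain ⟨h, h2⟩ := hR' f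
    refine (S.fiberGraph_iff ξ _ _).2 ⟨h, fun v => ?_⟩
    rw [inner_sub_right, inner_smul_right, ← h2 v, add_sub_cancel_right]
  have hgr := Submodule.toLinearPMap_graph_eq (fiberGraph α μ ξ) (S.fiberGraph_functional ξ)
  -- The difference of two solutions solves the homogeneous equation; tested with itself it gives
  -- `‖T(ξ)(Rf - w)‖² = -e‖Rf - w‖²`, hence zero.
  have huniq : ∀ w g, (w, g) ∈ fiberGraph α μ ξ → R (g + (e : ℂ) • w) = w := fun w g hw => by
    have h1 := Submodule.sub_mem _ (hmem (g + (e : ℂ) • w)) hw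
    set f := g + (e : ℂ) • w
    obtain ⟨h, h2⟩ := (S.fiberGraph_iff ξ _ _).1 h1
    have h3 := h2 ⟨_, h⟩
    simp only at h3
    have h4 : f - (e : ℂ) • R f - g = -((e : ℂ) • (R f - w)) := by
      simp only [f, smul_sub]
      abel
    rw [h4, inner_neg_right, inner_smul_right, inner_self_eq_norm_sq_to_K,
      inner_self_eq_norm_sq_to_K] at h3
    have h5 := congrArg Complex.re h3
    have h6 : ‖S.formMap ξ ⟨R f - w, h⟩‖ ^ 2 = -(e * ‖R f - w‖ ^ 2) := by
      have := h5
      simp only [Complex.coe_algebraMap, ← Complex.ofReal_pow, Complex.ofReal_re, Complex.neg_re,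
        Complex.re_ofReal_mul] at this
      exact this
    have h7 : ‖R f - w‖ ^ 2 = 0 := by
      nlinarith [sq_nonneg ‖S.formMap ξ ⟨R f - w, h⟩‖, sq_nonneg ‖R f - w‖]
    exact sub_eq_zero.1 (norm_eq_zero.1 (pow_eq_zero_iff two_ne_zero |>.1 h7))
  refine ⟨R, ⟨fun u => ?_, fun f => ?_⟩, hR'⟩
  · refine huniq _ _ ?_
    exact Submodule.mem_graph_toLinearPMap (S.fiberGraph_functional ξ) u
  · have h := hmem f
    rw [← hgr, LinearPMap.mem_graph_iff] at h
    obtain ⟨⟨y, hy⟩, h1, h2⟩ := h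
    simp only at h1
    subst h1
    exact ⟨hy, (congrArg (· + (e : ℂ) • R f) h2).trans (sub_add_cancel _ _)⟩

end Setting

/-! ### The first order functional and the cell problems -/

section PairBound

variable {d : ℕ} [NeZero d]

lemma lintegral_enorm_le_norm (η : L2Cell d) :
    ∫⁻ x, ‖η x‖ₑ ∂(cellMeasure d) ≤ ENNReal.ofReal ‖η‖ := by
  rw [← eLpNorm_one_eq_lintegral_enorm, ofReal_norm, Lp.enorm_def]
  exact eLpNorm_le_eLpNorm_of_exponent_le one_le_two (memLp_coe η).1

/-- A bound for integrals over `Ω × ℝ^d` by a convolution kernel. -/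
lemma lintegral_pair_le {E : Type*} [NormedAddCommGroup E] {G : Eu d → ℝ} (hm : Measurable G)
    (hG : ∀ z, 0 ≤ G z) (hi : Integrable G)
    {a b : ℝ} (ha : 0 ≤ a) (hb : 0 ≤ b) (η : L2Cell d) {F : Eu d × Eu d → E}
    (h : ∀ᵐ p ∂(pairMeasure d),
      ‖F p‖ ≤ G (p.2 - p.1) * (a * ‖perExt η p.1‖ + b * ‖perExt η p.2‖)) :
    ∫⁻ p, ‖F p‖ₑ ∂(pairMeasure d) ≤ ENNReal.ofReal ((a + b) * (∫ z, G z) * ‖η‖) := by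
  have hη := measurable_coe η
  have hfr := measurable_fractVec d
  have hG0 : 0 ≤ ∫ z, G z := integral_nonneg hG
  set g := fun z => ENNReal.ofReal (G z)
  have hgm : Measurable g := by fun_prop
  have hg : ∫⁻ z, g z = ENNReal.ofReal (∫ z, G z) :=
    (ofReal_integral_eq_lintegral_ofReal hi (ae_of_all _ hG)).symm
  have h1 : ∀ᵐ p ∂(pairMeasure d), ‖F p‖ₑ ≤ ENNReal.ofReal a * (g (p.2 - p.1) * ‖η p.1‖ₑ) +
      ENNReal.ofReal b * (g (p.2 - p.1) * ‖η (fractVec p.2)‖ₑ) := by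
    have h0 : ∀ᵐ p ∂(pairMeasure d), p.1 ∈ unitCell d :=
      Measure.quasiMeasurePreserving_fst.ae (ae_mem_unitCell d)
    filter_upwards [h, h0] with p hp hp0
    rw [perExt_of_mem _ hp0, perExt] at hp
    rw [← ofReal_norm]
    refine (ENNReal.ofReal_le_ofReal hp).trans (le_of_eq ?_)
    rw [mul_add, ENNReal.ofReal_add (mul_nonneg (hG _) (by positivity))
      (mul_nonneg (hG _) (by positivity)), ENNReal.ofReal_mul (hG _), ENNReal.ofReal_mul (hG _),
      ENNReal.ofReal_mul ha, ENNReal.ofReal_mul hb, ofReal_norm, ofReal_norm]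
    ring
  refine (lintegral_mono_ae h1).trans ?_
  have e1 := lintegral_pair_fst (h := fun x => ‖η x‖ₑ) hgm (by fun_prop)
  have e2 := lintegral_pair_snd (h := fun x => ‖η x‖ₑ) hgm (by fun_prop)
  rw [lintegral_add_left (by fun_prop), lintegral_const_mul _ (by fun_prop),
    lintegral_const_mul _ (by fun_prop), e1, e2, ← add_mul, ← ENNReal.ofReal_add ha hb, hg,
    ← mul_assoc, ← ENNReal.ofReal_mul (by positivity),
    ENNReal.ofReal_mul (p := (a + b) * ∫ z, G z) (by positivity)]
  gcongr
  exact lintegral_enorm_le_norm η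

lemma norm_integral_pair_le {E : Type*} [NormedAddCommGroup E] [NormedSpace ℝ E] {G : Eu d → ℝ}
    (hm : Measurable G) (hG : ∀ z, 0 ≤ G z) (hi : Integrable G)
    {a b : ℝ} (ha : 0 ≤ a) (hb : 0 ≤ b) (η : L2Cell d) {F : Eu d × Eu d → E}
    (h : ∀ᵐ p ∂(pairMeasure d),
      ‖F p‖ ≤ G (p.2 - p.1) * (a * ‖perExt η p.1‖ + b * ‖perExt η p.2‖)) :
    ‖∫ p, F p ∂(pairMeasure d)‖ ≤ (a + b) * (∫ z, G z) * ‖η‖ := by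
  have h0 : 0 ≤ ∫ z, G z := integral_nonneg hG
  refine (norm_integral_le_lintegral_norm _).trans ?_
  refine ENNReal.toReal_le_of_le_ofReal (by positivity) ?_
  simp only [ofReal_norm]
  exact lintegral_pair_le hm hG hi ha hb η h

end PairBound

/-- The integrand of the functional `linForm`. -/
def linIntegrand {d : ℕ} (α : ℝ) (μ : Eu d × Eu d → ℝ) (ξ : Eu d) (η : Eu d → ℂ)
    (p : Eu d × Eu d) : ℂ :=
  (levyKernel α μ p : ℂ) * ((inner ℝ ξ (p.1 - p.2) : ℝ) * (starRingEnd ℂ) (twistDiff 0 η p))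

/-- The functional `∬ μ(x,y) ⟨ξ, x - y⟩ conj (η(x) - η(y)) / |x - y|^{d+α} dx dy`. -/
def linForm {d : ℕ} (α : ℝ) (μ : Eu d × Eu d → ℝ) (ξ : Eu d) (η : Eu d → ℂ) : ℂ :=
  ∫ p, linIntegrand α μ ξ η p ∂(pairMeasure d)

/-- The Taylor bound of order `t²` serves for `|t| ≤ 1` and the triangle inequality, of order `|t|`,
for large `t`. The minimum of both is integrable against the kernel. -/
lemma norm_wave_sub_le {d : ℕ} (ξ z : Eu d) :
    ‖1 - wave ξ z + Complex.I * (inner ℝ ξ z : ℝ)‖ ≤ 2 * quadLin (‖ξ‖ * ‖z‖) := by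
  set t : ℝ := inner ℝ ξ z with ht
  have hw : wave ξ z = Complex.exp (t * Complex.I) := by rw [wave, mul_comm]
  have h2 : ‖1 - wave ξ z + Complex.I * (t : ℝ)‖ ≤ 2 * |t| := by
    calc ‖1 - wave ξ z + Complex.I * (t : ℝ)‖ ≤ ‖1 - wave ξ z‖ + ‖Complex.I * (t : ℝ)‖ :=
          norm_add_le _ _
      _ ≤ |t| + |t| := by
          gcongr
          · rw [norm_sub_rev, hw, mul_comm]
            exact Real.norm_exp_I_mul_ofReal_sub_one_le
          · simp
      _ = _ := by ring
  have h1 : ‖1 - wave ξ z + Complex.I * (t : ℝ)‖ ≤ 2 * t ^ 2 := by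
    rcases le_or_gt |t| 1 with h | h
    · have h3 := Complex.norm_exp_sub_one_sub_id_le (x := t * Complex.I) (by simpa using h)
      rw [← hw, ← norm_neg] at h3
      have e : -(wave ξ z - 1 - t * Complex.I) = 1 - wave ξ z + Complex.I * (t : ℝ) := by ring
      rw [e] at h3
      refine h3.trans ?_
      simp only [norm_mul, Complex.norm_real, Complex.norm_I, mul_one, Real.norm_eq_abs, sq_abs]
      nlinarith [sq_nonneg t]
    · refine h2.trans ?_
      rw [← sq_abs]
      nlinarith
  calc _ ≤ 2 * quadLin |t| := by
        rw [quadLin, sq_abs, mul_min_of_nonneg _ _ zero_le_two]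
        exact le_min h1 h2
    _ ≤ _ := by
        gcongr
        exact quadLin_mono (abs_nonneg _) (abs_real_inner_le_norm ξ z)

namespace Setting

variable {d : ℕ} [NeZero d] {α μm μp : ℝ} {μ : Eu d × Eu d → ℝ}

lemma aestronglyMeasurable_linIntegrand (S : Setting d α μm μp μ) (ξ : Eu d) (η : L2Cell d) :
    AEStronglyMeasurable (linIntegrand α μ ξ η) (pairMeasure d) := by
  have h1 := measurable_twistDiff 0 η
  refine ((Complex.measurable_ofReal.comp_aemeasurable S.aemeasurable_levyKernel).mul
    (Measurable.aemeasurable ?_)).aestronglyMeasurable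
  fun_prop

/-- The integral defining `linForm` converges absolutely on the form domain. -/
lemma lintegral_linIntegrand_le (S : Setting d α μm μp μ) (ξ : Eu d) (η : perSobolev d (α / 2)) :
    ∫⁻ p, ‖linIntegrand α μ ξ (η : L2Cell d) p‖ₑ ∂(pairMeasure d) ≤
      ENNReal.ofReal (2 * ‖ξ‖ * (√(μp * (sphereArea d / (2 * (2 - α)))) * ‖S.formMap 0 η‖ +
        μp * (sphereArea d / (α - 1)) * ‖(η : L2Cell d)‖)) := by
  have h1 := S.one_lt
  have h2 := S.lt_two
  have hω := (sphereArea_pos d).le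
  have hp := S.upper_pos.le
  have hα1 : 0 < α - 1 := by linarith
  have hα2 : 0 < 2 - α := by linarith
  set N : Set (Eu d × Eu d) := {p | ‖p.2 - p.1‖ < 1} with hN
  have hNm : MeasurableSet N := measurableSet_lt (by fun_prop) measurable_const
  have hηm := measurable_perExt (η : L2Cell d)
  have htw := measurable_twistDiff 0 (η : L2Cell d)
  -- Cauchy–Schwarz: one root of the kernel goes with `⟨ξ,x-y⟩`, whose second moment near the
  -- diagonal is finite, the other forms `T(0)η`.
  have near : ∫⁻ p in N, ‖linIntegrand α μ ξ (η : L2Cell d) p‖ₑ ∂(pairMeasure d) ≤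
      ENNReal.ofReal (2 * ‖ξ‖ * (√(μp * (sphereArea d / (2 * (2 - α)))) * ‖S.formMap 0 η‖)) := by
    set f := fun p : Eu d × Eu d => N.indicator
      (fun p => ‖((formWeight α μ p * inner ℝ ξ (p.1 - p.2) : ℝ) : ℂ)‖ₑ) p
    set g := fun p => ‖formFun α μ 0 (η : L2Cell d) p‖ₑ
    have hwm := S.aemeasurable_formWeight
    have hwm2 : AEMeasurable (fun p => formWeight α μ p * inner ℝ ξ (p.1 - p.2)) (pairMeasure d) :=
      hwm.mul (Measurable.aemeasurable (by fun_prop))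
    have hf : AEMeasurable f (pairMeasure d) :=
      AEMeasurable.indicator (Complex.measurable_ofReal.comp_aemeasurable hwm2).enorm hNm
    have hg : AEMeasurable g (pairMeasure d) := (S.memLp_formFun 0 η).1.enorm
    have e1 : ∫⁻ p in N, ‖linIntegrand α μ ξ (η : L2Cell d) p‖ₑ ∂(pairMeasure d) =
        ENNReal.ofReal 2 * ∫⁻ p, (f * g) p ∂(pairMeasure d) := by
      rw [← lintegral_indicator hNm, ← lintegral_const_mul' _ _ ENNReal.ofReal_ne_top]
      refine lintegral_congr_ae ?_
      filter_upwards [S.formWeight_sq] with p hp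
      by_cases hpN : p ∈ N
      · simp only [f, g, Pi.mul_apply, indicator_of_mem hpN]
        rw [← enorm_mul, show ENNReal.ofReal 2 = ‖(2 : ℂ)‖ₑ by
          rw [← ofReal_norm]; simp, ← enorm_mul, linIntegrand, ← RCLike.enorm_conj]
        congr 1
        have h4 : (levyKernel α μ p : ℂ) = 2 * (formWeight α μ p : ℂ) ^ 2 := by
          rw [← Complex.ofReal_pow, hp]
          push_cast
          ring
        rw [map_mul, map_mul, Complex.conj_ofReal, Complex.conj_ofReal, Complex.conj_conj, h4,
          formFun]
        push_cast
        ring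
      · simp only [f, Pi.mul_apply, indicator_of_notMem hpN, zero_mul, mul_zero]
    have hhol := ENNReal.lintegral_mul_le_Lp_mul_Lq (pairMeasure d)
      (Real.HolderConjugate.two_two) hf hg
    have hgn : ∫⁻ p, g p ^ (2 : ℝ) ∂(pairMeasure d) = ENNReal.ofReal (‖S.formMap 0 η‖ ^ 2) := by
      rw [S.ofReal_norm_formMap_sq]
      simp only [g, ENNReal.rpow_two]
    have hfn : ∫⁻ p, f p ^ (2 : ℝ) ∂(pairMeasure d) ≤
        ENNReal.ofReal (‖ξ‖ ^ 2 * (μp * (sphereArea d / (2 * (2 - α))))) := by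
      have hb := radial_near (d := d) h2 one_pos
      set G := (Metric.ball (0 : Eu d) 1).indicator
        fun z => ENNReal.ofReal (‖z‖ ^ 2 * radialKernel α z)
      have hGm : Measurable G := Measurable.indicator (by fun_prop) measurableSet_ball
      have hG : ∫⁻ z, G z = ENNReal.ofReal (sphereArea d * (1 ^ (2 - α) / (2 - α))) := by
        rw [lintegral_indicator measurableSet_ball, ← hb.2, ofReal_integral_eq_lintegral_ofReal hb.1]
        exact ae_of_all _ fun z => mul_nonneg (sq_nonneg _) (radialKernel_nonneg _ _)
      have hpair := lintegral_pair_fst (h := fun _ => 1) hGm measurable_const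
      simp only [mul_one, lintegral_const, measure_univ] at hpair
      calc ∫⁻ p, f p ^ (2 : ℝ) ∂(pairMeasure d)
          ≤ ∫⁻ p, ENNReal.ofReal (‖ξ‖ ^ 2 * (μp / 2)) * G (p.2 - p.1) ∂(pairMeasure d) := by
            refine lintegral_mono_ae ?_
            filter_upwards [S.formWeight_sq, S.ae_bounds] with p hp1 hp2
            by_cases hpN : p ∈ N
            · have hz : p.2 - p.1 ∈ Metric.ball (0 : Eu d) 1 := mem_ball_zero_iff.2 hpN
              simp only [f, G, indicator_of_mem hpN, indicator_of_mem hz, ENNReal.rpow_two]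
              rw [← ofReal_norm, ← ENNReal.ofReal_pow (norm_nonneg _),
                ← ENNReal.ofReal_mul (by positivity)]
              refine ENNReal.ofReal_le_ofReal ?_
              rw [Complex.norm_real, Real.norm_eq_abs, sq_abs, mul_pow, hp1, levyKernel_eq]
              have hin : (inner ℝ ξ (p.1 - p.2)) ^ 2 ≤ (‖ξ‖ * ‖p.2 - p.1‖) ^ 2 := by
                rw [← sq_abs, norm_sub_rev]
                exact pow_le_pow_left₀ (abs_nonneg _) (abs_real_inner_le_norm _ _) 2
              have hr := radialKernel_nonneg α (p.2 - p.1)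
              have hμ0 : 0 ≤ μ p := S.pos.le.trans hp2.1
              calc μ p * radialKernel α (p.2 - p.1) / 2 * (inner ℝ ξ (p.1 - p.2)) ^ 2
                  ≤ μp * radialKernel α (p.2 - p.1) / 2 * (‖ξ‖ * ‖p.2 - p.1‖) ^ 2 := by
                    gcongr; exact hp2.2
                _ = _ := by ring
            · simp only [f, indicator_of_notMem hpN]
              simp
        _ = _ := by
            rw [lintegral_const_mul _ (by fun_prop), hpair, hG,
              ← ENNReal.ofReal_mul (by positivity), Real.one_rpow]
            congr 1
            field_simp
    rw [e1, mul_assoc 2 ‖ξ‖,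
      ENNReal.ofReal_mul zero_le_two]
    gcongr
    refine hhol.trans ?_
    rw [hgn]
    refine (mul_le_mul_left (ENNReal.rpow_le_rpow hfn (by norm_num)) _).trans (le_of_eq ?_)
    rw [ENNReal.ofReal_rpow_of_nonneg (by positivity) (by norm_num),
      ENNReal.ofReal_rpow_of_nonneg (by positivity) (by norm_num), ← ENNReal.ofReal_mul (by positivity),
      ← Real.sqrt_eq_rpow, ← Real.sqrt_eq_rpow, Real.sqrt_sq (norm_nonneg _),
      Real.sqrt_mul (sq_nonneg _), Real.sqrt_sq (norm_nonneg _), mul_assoc]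
  -- Away from the diagonal the first moment of the kernel is finite, so `|η(x)| + |η(y)|` is
  -- enough.
  have far : ∫⁻ p in Nᶜ, ‖linIntegrand α μ ξ (η : L2Cell d) p‖ₑ ∂(pairMeasure d) ≤
      ENNReal.ofReal (2 * ‖ξ‖ * (μp * (sphereArea d / (α - 1)) * ‖(η : L2Cell d)‖)) := by
    have hb := radial_far (d := d) h1 one_pos
    set G := (Metric.ball (0 : Eu d) 1)ᶜ.indicator
      fun z => ‖ξ‖ * μp * (‖z‖ * radialKernel α z)
    have hGm : Measurable G := Measurable.indicator (by fun_prop) measurableSet_ball.compl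
    have hG0 : ∀ z, 0 ≤ G z := fun z => indicator_nonneg (fun z _ => by
      have := radialKernel_nonneg α z
      positivity) z
    have hGi : Integrable G :=
      (integrable_indicator_iff measurableSet_ball.compl).2 (hb.1.const_mul _)
    have hG : ∫ z, G z = ‖ξ‖ * μp * (sphereArea d * (1 ^ (1 - α) / (α - 1))) := by
      rw [integral_indicator measurableSet_ball.compl, integral_const_mul, hb.2]
    rw [← lintegral_indicator hNm.compl]
    have hF : ∀ᵐ p ∂(pairMeasure d), ‖Nᶜ.indicator (linIntegrand α μ ξ (η : L2Cell d)) p‖ ≤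
        G (p.2 - p.1) * (1 * ‖perExt (η : L2Cell d) p.1‖ + 1 * ‖perExt (η : L2Cell d) p.2‖) := by
      filter_upwards [S.ae_bounds] with p hp2
      by_cases hpN : p ∈ Nᶜ
      · have hz : p.2 - p.1 ∈ (Metric.ball (0 : Eu d) 1)ᶜ := by simpa [hN] using hpN
        simp only [G, indicator_of_mem hpN, indicator_of_mem hz, one_mul]
        have hr := radialKernel_nonneg α (p.2 - p.1)
        have hμ0 : 0 ≤ μ p := S.pos.le.trans hp2.1
        rw [linIntegrand, norm_mul, norm_mul, RCLike.norm_conj, Complex.norm_real, Complex.norm_real,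
          levyKernel_eq, Real.norm_of_nonneg (mul_nonneg hμ0 hr), Real.norm_eq_abs]
        have hin : |inner ℝ ξ (p.1 - p.2)| ≤ ‖ξ‖ * ‖p.2 - p.1‖ := by
          rw [norm_sub_rev]
          exact abs_real_inner_le_norm _ _
        have htd : ‖twistDiff 0 (η : L2Cell d) p‖ ≤
            ‖perExt (η : L2Cell d) p.1‖ + ‖perExt (η : L2Cell d) p.2‖ := by
          rw [twistDiff, wave_zero_left, one_mul]
          exact norm_sub_le _ _
        calc μ p * radialKernel α (p.2 - p.1) * (|inner ℝ ξ (p.1 - p.2)| *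
              ‖twistDiff 0 (η : L2Cell d) p‖)
            ≤ μp * radialKernel α (p.2 - p.1) * (‖ξ‖ * ‖p.2 - p.1‖ *
              (‖perExt (η : L2Cell d) p.1‖ + ‖perExt (η : L2Cell d) p.2‖)) := by
              gcongr; exact hp2.2
          _ = _ := by ring
      · rw [indicator_of_notMem hpN, norm_zero]
        have := hG0 (p.2 - p.1)
        positivity
    have := lintegral_pair_le hGm hG0 hGi zero_le_one zero_le_one (η : L2Cell d) hF
    rw [hG, Real.one_rpow] at this
    simp only [enorm_indicator_eq_indicator_enorm] at this
    refine this.trans (le_of_eq (congrArg _ ?_))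
    ring
  rw [← lintegral_add_compl _ hNm, mul_add, ENNReal.ofReal_add (by positivity) (by positivity)]
  exact add_le_add near far

lemma integrable_linIntegrand (S : Setting d α μm μp μ) (ξ : Eu d) (η : perSobolev d (α / 2)) :
    Integrable (linIntegrand α μ ξ (η : L2Cell d)) (pairMeasure d) :=
  ⟨S.aestronglyMeasurable_linIntegrand ξ _,
    (S.lintegral_linIntegrand_le ξ η).trans_lt ENNReal.ofReal_lt_top⟩

lemma norm_linForm_le (S : Setting d α μm μp μ) (ξ : Eu d) (η : perSobolev d (α / 2)) :
    ‖linForm α μ ξ (η : L2Cell d)‖ ≤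
      2 * ‖ξ‖ * (√(μp * (sphereArea d / (2 * (2 - α)))) * ‖S.formMap 0 η‖ +
        μp * (sphereArea d / (α - 1)) * ‖(η : L2Cell d)‖) := by
  have h1 := S.one_lt
  have hω := (sphereArea_pos d).le
  have hp := S.upper_pos.le
  have hα1 : 0 < α - 1 := by linarith
  refine (norm_integral_le_lintegral_norm _).trans ?_
  refine ENNReal.toReal_le_of_le_ofReal (by positivity) ?_
  simp only [ofReal_norm]
  exact S.lintegral_linIntegrand_le ξ η

lemma linForm_add (S : Setting d α μm μp μ) (ξ : Eu d) (η₁ η₂ : perSobolev d (α / 2)) :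
    linForm α μ ξ ((η₁ + η₂ : perSobolev d (α / 2)) : L2Cell d) =
      linForm α μ ξ (η₁ : L2Cell d) + linForm α μ ξ (η₂ : L2Cell d) := by
  unfold linForm
  rw [← integral_add (S.integrable_linIntegrand ξ η₁) (S.integrable_linIntegrand ξ η₂)]
  refine integral_congr_ae ?_
  filter_upwards [twistDiff_add 0 (η₁ : L2Cell d) η₂] with p hp
  simp only [linIntegrand, Submodule.coe_add, hp, map_add]
  ring

lemma linForm_smul (ξ : Eu d) (c : ℂ) (η : perSobolev d (α / 2)) :
    linForm α μ ξ ((c • η : perSobolev d (α / 2)) : L2Cell d) =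
      (starRingEnd ℂ) c * linForm α μ ξ (η : L2Cell d) := by
  unfold linForm
  rw [← integral_const_mul]
  refine integral_congr_ae ?_
  filter_upwards [twistDiff_smul 0 c (η : L2Cell d)] with p hp
  simp only [linIntegrand, Submodule.coe_smul, hp, map_mul]
  ring

/-- The functional `η ↦ conj (linForm η)` on the form domain. -/
def linFunctional (S : Setting d α μm μp μ) (ξ : Eu d) : perSobolev d (α / 2) →ₗ[ℂ] ℂ where
  toFun η := (starRingEnd ℂ) (linForm α μ ξ (η : L2Cell d))
  map_add' η₁ η₂ := by rw [S.linForm_add, map_add]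
  map_smul' c η := by
    rw [linForm_smul, map_mul, Complex.conj_conj]
    rfl

lemma sum_linForm (S : Setting d α μm μp μ) (ξ : Eu d) (η : perSobolev d (α / 2)) :
    linForm α μ ξ (η : L2Cell d) =
      ∑ k, (ξ k : ℂ) * linForm α μ (EuclideanSpace.single k 1) (η : L2Cell d) := by
  unfold linForm
  simp_rw [← integral_const_mul]
  rw [← integral_finsetSum _ fun k _ => (S.integrable_linIntegrand _ η).const_mul _]
  refine integral_congr_ae (ae_of_all _ fun p => ?_)
  simp only [linIntegrand]
  rw [PiLp.inner_apply]
  simp only [EuclideanSpace.inner_single_left, RCLike.inner_apply, conj_trivial, one_mul]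
  push_cast
  rw [Finset.sum_mul, Finset.mul_sum]
  refine Finset.sum_congr rfl fun k _ => ?_
  ring

/-- The constant function as an element of the form domain. -/
def one (S : Setting d α μm μp μ) : perSobolev d (α / 2) :=
  ⟨oneCell d, oneCell_mem S.one_lt S.lt_two⟩

lemma twistDiff_oneCell (ξ : Eu d) :
    ∀ᵐ p ∂(pairMeasure d), twistDiff ξ (oneCell d) p = 1 - wave ξ (p.2 - p.1) := by
  have h : ∀ᵐ x : Eu d, perExt (oneCell d) x = 1 :=
    ae_fractVec (MemLp.coeFn_toLp (memLp_const (μ := cellMeasure d) (p := 2) (1 : ℂ)))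
  filter_upwards [ae_pair (ae_fst h), ae_pair (ae_snd h)] with p h1 h2
  rw [twistDiff, h1, h2, mul_one]

lemma formMap_zero_one (S : Setting d α μm μp μ) : S.formMap 0 S.one = 0 := by
  rw [Lp.eq_zero_iff_ae_eq_zero]
  filter_upwards [S.coeFn_formMap 0 S.one, twistDiff_oneCell (d := d) 0] with p h1 h2
  rw [h1, formFun]
  change _ * twistDiff 0 (oneCell d) p = 0
  rw [h2, wave_zero_left, sub_self, mul_zero]

lemma linForm_one (ξ : Eu d) : linForm α μ ξ (oneCell d) = 0 := by
  unfold linForm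
  rw [integral_eq_zero_of_ae]
  filter_upwards [twistDiff_oneCell (d := d) 0] with p h2
  rw [linIntegrand, h2, wave_zero_left]
  simp

/-- The integral splits because both parts converge absolutely on the form domain; the factor `2`
undoes the `1/2` in the form. -/
lemma cellSolution_iff (S : Setting d α μm μp μ) (k : Fin d) (w : L2Cell d) :
    IsCellSolution α μ k w ↔ ∃ h : w ∈ perSobolev d (α / 2), inner ℂ (oneCell d) w = 0 ∧
      ∀ η : perSobolev d (α / 2), 2 * inner ℂ (S.formMap 0 η) (S.formMap 0 ⟨w, h⟩) +
        linForm α μ (EuclideanSpace.single k 1) (η : L2Cell d) = 0 := by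
  rw [IsCellSolution, inner_oneCell, ← exists_prop]
  refine exists_congr fun h => and_congr Iff.rfl ?_
  refine Iff.trans (forall₂_congr fun η hη => ?_) Subtype.forall.symm
  have h1 := S.inner_formMap 0 ⟨w, h⟩ ⟨η, hη⟩
  have h2 := S.integrable_linIntegrand (EuclideanSpace.single k 1) ⟨η, hη⟩
  have e : ∫ p, (levyKernel α μ p : ℂ) *
        ((perExt w p.1 - perExt w p.2 + ((p.1 k - p.2 k : ℝ) : ℂ)) *
          (starRingEnd ℂ) (perExt η p.1 - perExt η p.2)) ∂(pairMeasure d) =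
      2 * inner ℂ (S.formMap 0 ⟨η, hη⟩) (S.formMap 0 ⟨w, h⟩) +
        linForm α μ (EuclideanSpace.single k 1) η := by
    rw [← h1.2, fiberForm, linForm, ← mul_assoc, show (2 : ℂ) * (1 / 2) = 1 by norm_num, one_mul,
      ← integral_add h1.1 h2]
    refine integral_congr_ae (ae_of_all _ fun p => ?_)
    simp only [formIntegrand, quasiDiff, linIntegrand, twistDiff, wave_zero_left, inner_zero_left,
      EuclideanSpace.inner_single_left, PiLp.sub_apply, conj_trivial, one_mul, Complex.ofReal_zero,
      mul_zero, Complex.exp_zero]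
    ring
  rw [e]

/-- A Poincaré inequality: `T(0)` annihilates constants and, by the spectral gap, controls the part
of zero mean. -/
lemma norm_le_constProj_add (S : Setting d α μm μp μ) (v : perSobolev d (α / 2)) :
    ‖v‖ ≤ (1 + (√(dZero d α μm))⁻¹) * (‖constProj d v‖ + ‖S.formMap 0 v‖) := by
  have hc := cZero_pos (d := d) S.one_lt S.lt_two
  have hd : 0 < dZero d α μm := by
    have := S.pos
    have := Real.pi_pos
    unfold dZero
    positivity
  set c := inner ℂ (oneCell d) (v : L2Cell d)
  have h0 : inner ℂ (oneCell d) ((v - c • S.one : perSobolev d (α / 2)) : L2Cell d) = 0 := by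
    rw [Submodule.coe_sub, Submodule.coe_smul, inner_sub_right, inner_smul_right]
    change c - c * inner ℂ (oneCell d) (oneCell d) = 0
    rw [inner_self_eq_norm_sq_to_K, norm_oneCell]
    simp
  have h1 := S.dZero_mul_le (ξ := 0) (by simpa using Real.pi_pos.le) _ h0
  rw [map_sub, map_smul, S.formMap_zero_one, smul_zero, sub_zero] at h1
  have h2 : ((v - c • S.one : perSobolev d (α / 2)) : L2Cell d) = v - constProj d v := by
    rw [constProj_apply]
    rfl
  rw [h2] at h1
  have h3 : ‖(v : L2Cell d) - constProj d v‖ ≤ (√(dZero d α μm))⁻¹ * ‖S.formMap 0 v‖ := by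
    rw [inv_mul_eq_div, le_div_iff₀ (Real.sqrt_pos.2 hd)]
    refine abs_le_of_sq_le_sq' ?_ (norm_nonneg _) |>.2
    rw [mul_pow, Real.sq_sqrt hd.le, mul_comm]
    exact h1
  have h4 : ‖(v : L2Cell d)‖ ≤ ‖(v : L2Cell d) - constProj d v‖ + ‖constProj d v‖ := by
    have := norm_add_le ((v : L2Cell d) - constProj d v) (constProj d v)
    rwa [sub_add_cancel] at this
  have h5 : 0 ≤ (√(dZero d α μm))⁻¹ := by positivity
  have h6 : ‖v‖ = ‖(v : L2Cell d)‖ := rfl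
  rw [h6]
  nlinarith [norm_nonneg (constProj d v), norm_nonneg (S.formMap 0 v), mul_nonneg h5 (norm_nonneg (constProj d v))]

/-- The cell problems are uniquely solvable. -/
lemma exists_cellSolution (S : Setting d α μm μp μ) (k : Fin d) :
    ∃ v : L2Cell d, ∀ w, IsCellSolution α μ k w ↔ w = v := by
  have hc := cZero_pos (d := d) S.one_lt S.lt_two
  have hω := (sphereArea_pos d).le
  have hp := S.upper_pos.le
  have hα1 : 0 < α - 1 := by linarith [S.one_lt]
  have hd : 0 < dZero d α μm := by
    have := S.pos
    have := Real.pi_pos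
    unfold dZero
    positivity
  -- Taking `B` to be the projection onto constants restores coercivity, which `T(0)` alone lacks.
  have hr := (exists_riesz (S.isClosedMapOn_formMap 0) (B := constProj d) (by positivity)
    S.norm_le_constProj_add).1
  set M := √(μp * (sphereArea d / (2 * (2 - α)))) + μp * (sphereArea d / (α - 1))
  have hM1 : √(μp * (sphereArea d / (2 * (2 - α)))) ≤ M := le_add_of_nonneg_right (by positivity)
  have hM2 : μp * (sphereArea d / (α - 1)) ≤ M := le_add_of_nonneg_left (Real.sqrt_nonneg _)
  have hM0 : 0 ≤ M := by positivity
  obtain ⟨u, hu⟩ := hr ((-(1 / 2) : ℂ) • S.linFunctional (EuclideanSpace.single k 1)) M (fun v => by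
      rw [LinearMap.smul_apply, norm_smul]
      have h1 := S.norm_linForm_le (EuclideanSpace.single k 1) v
      have h2 : ‖S.linFunctional (EuclideanSpace.single k 1) v‖ =
        ‖linForm α μ (EuclideanSpace.single k 1) (v : L2Cell d)‖ := RCLike.norm_conj _
      rw [h2]
      have h3 : ‖(-(1 / 2) : ℂ)‖ = 1 / 2 := by simp
      have h4 : ‖(EuclideanSpace.single k 1 : Eu d)‖ = 1 := by simp
      rw [h4] at h1
      rw [h3]
      have h5 : ‖v‖ = ‖(v : L2Cell d)‖ := rfl
      rw [h5]
      nlinarith [norm_nonneg (v : L2Cell d), norm_nonneg (S.formMap 0 v)]) hM0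
  -- Tested with `𝟏`, both `T(0)` and the functional vanish; what remains says that the mean of `u`
  -- is zero, so the added projection term disappears from the equation.
  have hu0 : inner ℂ (oneCell d) (u : L2Cell d) = 0 := by
    have h1 := hu S.one
    have h2 : S.linFunctional (EuclideanSpace.single k 1) S.one = 0 := by
      change (starRingEnd ℂ) (linForm α μ _ (oneCell d)) = 0
      rw [linForm_one, map_zero]
    rw [S.formMap_zero_one, inner_zero_right, add_zero, LinearMap.smul_apply, h2, smul_zero] at h1
    change inner ℂ (constProj d u) (constProj d (oneCell d)) = 0 at h1
    rw [constProj_apply, constProj_apply, inner_self_eq_norm_sq_to_K, norm_oneCell,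
      inner_smul_left, inner_smul_right, inner_self_eq_norm_sq_to_K, norm_oneCell] at h1
    refine inner_eq_zero_symm.1 ?_
    simpa using h1
  have hsol : IsCellSolution α μ k u := by
    refine (S.cellSolution_iff k u).2 ⟨u.2, hu0, fun η => ?_⟩
    have h1 := congrArg (starRingEnd ℂ) (hu η)
    rw [constProj_apply, hu0, zero_smul, inner_zero_left, zero_add, inner_conj_symm,
      LinearMap.smul_apply, smul_eq_mul, map_mul] at h1
    have h2 : (starRingEnd ℂ) (S.linFunctional (EuclideanSpace.single k 1) η) =
      linForm α μ (EuclideanSpace.single k 1) (η : L2Cell d) := Complex.conj_conj _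
    rw [h2] at h1
    have h3 : (starRingEnd ℂ) (-(1 / 2) : ℂ) = -(1 / 2) := by
      rw [show (-(1 / 2) : ℂ) = ((-(1 / 2) : ℝ) : ℂ) by push_cast; ring, Complex.conj_ofReal]
    rw [h3] at h1
    change 2 * inner ℂ (S.formMap 0 η) (S.formMap 0 u) + _ = 0
    rw [h1]
    ring
  refine ⟨u, fun w => ⟨fun hw => ?_, fun hw => hw ▸ hsol⟩⟩
  obtain ⟨h1, h10, h1s⟩ := (S.cellSolution_iff k w).1 hw
  obtain ⟨h2, h20, h2s⟩ := (S.cellSolution_iff k u).1 hsol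
  -- The difference of two solutions has zero energy and zero mean, so the Poincaré inequality
  -- annihilates it.
  set δ : perSobolev d (α / 2) := ⟨w, h1⟩ - ⟨u, h2⟩
  have h3 : inner ℂ (S.formMap 0 δ) (S.formMap 0 δ) = 0 := by
    have e : S.formMap 0 δ = S.formMap 0 ⟨w, h1⟩ - S.formMap 0 ⟨u, h2⟩ := map_sub _ _ _
    nth_rw 2 [e]
    rw [inner_sub_right]
    linear_combination (1 / 2 : ℂ) * h1s δ - (1 / 2 : ℂ) * h2s δ
  rw [inner_self_eq_zero] at h3
  have h4 : inner ℂ (oneCell d) (δ : L2Cell d) = 0 := by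
    change inner ℂ (oneCell d) (w - u : L2Cell d) = 0
    rw [inner_sub_right, h10, h20, sub_zero]
  have h5 := S.dZero_mul_le (ξ := 0) (by simpa using Real.pi_pos.le) δ h4
  rw [h3, norm_zero] at h5
  have h6 : ‖(δ : L2Cell d)‖ ^ 2 = 0 := by nlinarith [sq_nonneg ‖(δ : L2Cell d)‖]
  have h7 := norm_eq_zero.1 (pow_eq_zero_iff two_ne_zero |>.1 h6)
  exact sub_eq_zero.1 h7

/-- Second order remainder in the expansion of `a(ξ)[𝟏, η]` in `ξ`. -/
lemma norm_form_one_sub_le (S : Setting d α μm μp μ) (ξ : Eu d) (η : perSobolev d (α / 2)) :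
    ‖inner ℂ (S.formMap ξ η) (S.formMap ξ S.one) -
      Complex.I / 2 * linForm α μ ξ (η : L2Cell d)‖ ≤
      4 * μp * quadLinMass d α * ‖ξ‖ ^ α * ‖(η : L2Cell d)‖ := by
  have hp := S.upper_pos.le
  have hq := quadLin_scale (d := d) S.one_lt S.lt_two (norm_nonneg ξ)
  have hi := L2.integrable_inner (𝕜 := ℂ) (S.formMap ξ η) (S.formMap ξ S.one)
  have hl := (S.integrable_linIntegrand ξ η).const_mul (Complex.I / 2)
  rw [L2.inner_def, linForm, ← integral_const_mul, ← integral_sub hi hl]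
  -- The weights `1` and `3` come from the pointwise bound: the linear remainder charges `η(x)` and
  -- `η(y)` equally, and the term with `|1 - exp|²` charges `η(y)` twice more.
  have hb := norm_integral_pair_le (d := d)
    (G := fun z => μp * (quadLin (‖ξ‖ * ‖z‖) * radialKernel α z)) (by fun_prop)
    (fun z => mul_nonneg hp (mul_nonneg (quadLin_nonneg (by positivity)) (radialKernel_nonneg _ _)))
    (hq.1.const_mul μp) zero_le_one (zero_le_three) (η : L2Cell d)
    (F := fun p => inner ℂ (S.formMap ξ η p) (S.formMap ξ S.one p) -
      Complex.I / 2 * linIntegrand α μ ξ (η : L2Cell d) p) ?_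
  · refine hb.trans (le_of_eq ?_)
    rw [integral_const_mul, hq.2]
    ring
  · filter_upwards [S.coeFn_formMap ξ η, S.coeFn_formMap ξ S.one, twistDiff_oneCell ξ,
      S.formWeight_sq, S.ae_bounds] with p h1 h2 h3 h4 h5
    have h2' : S.formMap ξ S.one p = formWeight α μ p * (1 - wave ξ (p.2 - p.1)) := by
      rw [h2, formFun, ← h3]
      rfl
    set z := p.2 - p.1 with hz
    set b := wave ξ z with hb
    have hK : (levyKernel α μ p : ℂ) = 2 * (formWeight α μ p : ℂ) ^ 2 := by
      rw [← Complex.ofReal_pow, h4]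
      push_cast
      ring
    have hin : (inner ℝ ξ (p.1 - p.2) : ℝ) = -inner ℝ ξ z := by
      rw [← inner_neg_right, hz, neg_sub]
    -- Split the twisted difference of `η` into the plain one and `(1 - exp(i⟨ξ,z⟩))η(y)`.
    -- Subtracting the linear functional replaces `1 - exp(i⟨ξ,z⟩)` in the first product by its
    -- second order remainder.
    have e : inner ℂ (S.formMap ξ η p) (S.formMap ξ S.one p) -
        Complex.I / 2 * linIntegrand α μ ξ (η : L2Cell d) p =
        (levyKernel α μ p / 2 : ℝ) * ((1 - b + Complex.I * (inner ℝ ξ z : ℝ)) *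
          (starRingEnd ℂ) (perExt (η : L2Cell d) p.1 - perExt (η : L2Cell d) p.2) +
          (1 - b) * (starRingEnd ℂ) (1 - b) * (starRingEnd ℂ) (perExt (η : L2Cell d) p.2)) := by
      rw [h1, h2', linIntegrand, RCLike.inner_apply, formFun, hin, twistDiff_eq_add ξ, ← hz, ← hb]
      push_cast
      rw [hK]
      simp only [map_mul, map_add, Complex.conj_ofReal, twistDiff, wave_zero_left, one_mul, map_sub,
        map_one]
      ring
    rw [e]
    have hr := radialKernel_nonneg α z
    have hμ0 : 0 ≤ μ p := S.pos.le.trans h5.1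
    have n1 := norm_wave_sub_le ξ z
    have n2 := norm_one_sub_wave_sq_le ξ z
    have hq0 : 0 ≤ quadLin (‖ξ‖ * ‖z‖) := quadLin_nonneg (by positivity)
    rw [norm_mul, Complex.norm_real, levyKernel_eq, ← hz,
      Real.norm_of_nonneg (by positivity : 0 ≤ μ p * radialKernel α z / 2)]
    have hn : ‖(1 - b + Complex.I * (inner ℝ ξ z : ℝ)) *
          (starRingEnd ℂ) (perExt (η : L2Cell d) p.1 - perExt (η : L2Cell d) p.2) +
          (1 - b) * (starRingEnd ℂ) (1 - b) * (starRingEnd ℂ) (perExt (η : L2Cell d) p.2)‖ ≤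
        2 * quadLin (‖ξ‖ * ‖z‖) *
          (‖perExt (η : L2Cell d) p.1‖ + ‖perExt (η : L2Cell d) p.2‖) +
        4 * quadLin (‖ξ‖ * ‖z‖) * ‖perExt (η : L2Cell d) p.2‖ := by
      refine (norm_add_le _ _).trans ?_
      rw [norm_mul, norm_mul, norm_mul, RCLike.norm_conj, RCLike.norm_conj, RCLike.norm_conj, ← sq]
      gcongr
      exact norm_sub_le _ _
    calc _ ≤ μp * radialKernel α z / 2 * (2 * quadLin (‖ξ‖ * ‖z‖) *
          (‖perExt (η : L2Cell d) p.1‖ + ‖perExt (η : L2Cell d) p.2‖) +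
        4 * quadLin (‖ξ‖ * ‖z‖) * ‖perExt (η : L2Cell d) p.2‖) := by
          gcongr
          exact h5.2
      _ = _ := by ring

end Setting

/-! ### Sums over cells of integrals against a periodic function of zero mean -/

section Cells

variable {d : ℕ} [NeZero d]

lemma measurableSet_shiftedCell (n : Fin d → ℤ) : MeasurableSet (shiftedCell n : Set (Eu d)) :=
  (measurable_sub_const (latticeVec n)) (measurableSet_unitCell d)

lemma mem_shiftedCell_iff {n : Fin d → ℤ} {z : Eu d} :
    z ∈ (shiftedCell n : Set (Eu d)) ↔ ∀ i, ⌊z i⌋ = n i := by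
  refine forall_congr' fun i => ?_
  simp only [PiLp.sub_apply, latticeVec, mem_Ico, Int.floor_eq_iff]
  constructor <;> rintro ⟨h1, h2⟩ <;> constructor <;> linarith

lemma iUnion_shiftedCell : ⋃ n : Fin d → ℤ, (shiftedCell n : Set (Eu d)) = univ := by
  refine eq_univ_of_forall fun z => mem_iUnion.2 ⟨fun i => ⌊z i⌋, ?_⟩
  exact mem_shiftedCell_iff.2 fun i => rfl

lemma pairwise_disjoint_shiftedCell :
    Pairwise fun m n : Fin d → ℤ => Disjoint (shiftedCell m : Set (Eu d)) (shiftedCell n) := by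
  intro m n hmn
  refine disjoint_left.2 fun z hz hz' => hmn (funext fun i => ?_)
  rw [← mem_shiftedCell_iff.1 hz i, mem_shiftedCell_iff.1 hz' i]

lemma norm_sub_le_of_mem_shiftedCell {n : Fin d → ℤ} {z w : Eu d}
    (hz : z ∈ (shiftedCell n : Set (Eu d))) (hw : w ∈ (shiftedCell n : Set (Eu d))) :
    ‖z - w‖ ≤ √d := by
  rw [EuclideanSpace.norm_eq]
  refine Real.sqrt_le_sqrt ?_
  calc ∑ i, ‖(z - w) i‖ ^ 2 ≤ ∑ _i : Fin d, (1 : ℝ) := by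
        refine Finset.sum_le_sum fun i _ => ?_
        have h1 := hz i
        have h2 := hw i
        simp only [PiLp.sub_apply, mem_Ico] at h1 h2
        rw [Real.norm_eq_abs, sq_abs, PiLp.sub_apply]
        nlinarith
    _ = d := by simp

lemma measurePreserving_cell_shift (n : Fin d → ℤ) :
    MeasurePreserving (fun z : Eu d => z - latticeVec n) (volume.restrict (shiftedCell n))
      (cellMeasure d) :=
  (measurePreserving_sub_right volume (latticeVec n)).restrict_preimage (measurableSet_unitCell d)

instance isProbability_shiftedCell (n : Fin d → ℤ) :
    IsProbabilityMeasure ((volume : Measure (Eu d)).restrict (shiftedCell n)) :=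
  ⟨by
    have h := (measurePreserving_cell_shift n).measure_preimage MeasurableSet.univ.nullMeasurableSet
    rw [preimage_univ] at h
    rw [h]
    exact measure_univ⟩

/-- A bounded periodic function with zero mean. -/
structure IsMeanZero (m : Eu d → ℝ) (M : ℝ) : Prop where
  aesm : AEStronglyMeasurable m volume
  bound : ∀ᵐ z : Eu d, |m z| ≤ M
  periodic : ∀ᵐ z : Eu d, m (fractVec z) = m z
  mean : ∫ z, m z ∂(cellMeasure d) = 0

variable {m : Eu d → ℝ} {M : ℝ}

lemma IsMeanZero.nonneg (hm : IsMeanZero m M) : 0 ≤ M := by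
  obtain ⟨z, hz⟩ := hm.bound.exists
  exact (abs_nonneg _).trans hz

lemma IsMeanZero.setIntegral (hm : IsMeanZero m M) (n : Fin d → ℤ) :
    ∫ z in (shiftedCell n : Set (Eu d)), m z = 0 := by
  have h1 : ∫ z in (shiftedCell n : Set (Eu d)), m z =
      ∫ z in (shiftedCell n : Set (Eu d)), m (z - latticeVec n) := by
    refine integral_congr_ae ?_
    filter_upwards [ae_restrict_of_ae hm.periodic,
      ae_restrict_mem (measurableSet_shiftedCell n)] with z hz hz2
    rw [← hz, fractVec_eq]
    congr 2
    exact congrArg latticeVec (funext (mem_shiftedCell_iff.1 hz2))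
  rw [h1, integral_comp_of_measurePreserving (measurePreserving_cell_shift n)
    (hm.aesm.mono_measure Measure.restrict_le_self), hm.mean]

/-- The oscillation hypothesis under which cell sums converge. -/
structure CellDominated (R : ℝ) (F g₁ g₂ : Eu d → ℝ) : Prop where
  meas : Measurable F
  near : IntegrableOn F (Metric.ball 0 (R + √d))
  int₁ : IntegrableOn g₁ (Metric.ball 0 R)ᶜ
  int₂ : IntegrableOn g₂ (Metric.ball 0 R)ᶜ
  nonneg₁ : ∀ z, 0 ≤ g₁ z
  nonneg₂ : ∀ z, 0 ≤ g₂ z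
  osc : ∀ z w : Eu d, R ≤ ‖z‖ → R ≤ ‖w‖ → ‖z - w‖ ≤ √d → |F z - F w| ≤ g₁ z + g₂ w

variable {R : ℝ} {F g₁ g₂ : Eu d → ℝ}

/-- The function dominating the cell integrals. -/
def cellMajorant (R : ℝ) (F g₁ g₂ : Eu d → ℝ) (z : Eu d) : ℝ :=
  (Metric.ball 0 (R + √d)).indicator (fun z => |F z|) z +
    (Metric.ball 0 R)ᶜ.indicator (fun z => g₁ z + g₂ z) z

lemma CellDominated.integrable (h : CellDominated R F g₁ g₂) :
    Integrable (cellMajorant R F g₁ g₂) ∧ ∫ z, cellMajorant R F g₁ g₂ z =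
      (∫ z in Metric.ball 0 (R + √d), |F z|) +
        ((∫ z in (Metric.ball 0 R)ᶜ, g₁ z) + ∫ z in (Metric.ball 0 R)ᶜ, g₂ z) := by
  have h1 : Integrable ((Metric.ball 0 (R + √d)).indicator fun z => |F z|) :=
    (integrable_indicator_iff measurableSet_ball).2 h.near.abs
  have h2 : Integrable ((Metric.ball 0 R)ᶜ.indicator fun z => g₁ z + g₂ z) :=
    (integrable_indicator_iff measurableSet_ball.compl).2 (h.int₁.add h.int₂)
  refine ⟨h1.add h2, ?_⟩
  unfold cellMajorant
  rw [integral_add h1 h2, integral_indicator measurableSet_ball,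
    integral_indicator measurableSet_ball.compl, integral_add h.int₁ h.int₂]

/-- On a cell outside the ball, `F` may be replaced by `F - F(w)`, since `m` integrates to zero
there, so only the oscillation counts. A cell meeting the ball lies in the ball enlarged by the cell
diameter, where `F` itself is integrable. Both bounds are integrals of one majorant, which makes the
cell sums absolutely convergent. -/
lemma CellDominated.cell (h : CellDominated R F g₁ g₂) (hm : IsMeanZero m M) (n : Fin d → ℤ) :
    IntegrableOn (fun z => m z * F z) (shiftedCell n) ∧
      ‖∫ z in (shiftedCell n : Set (Eu d)), m z * F z‖ ≤
        ∫ z in (shiftedCell n : Set (Eu d)), M * cellMajorant R F g₁ g₂ z := by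
  have hQ := measurableSet_shiftedCell n
  have hM := hm.nonneg
  have hb : ∀ᵐ z ∂(volume.restrict (shiftedCell n : Set (Eu d))), ‖m z‖ ≤ M :=
    ae_restrict_of_ae hm.bound
  have hma := hm.aesm.restrict (s := (shiftedCell n : Set (Eu d)))
  have hmaj := h.integrable.1
  by_cases hout : ∀ z ∈ (shiftedCell n : Set (Eu d)), R ≤ ‖z‖
  · have hsub : (shiftedCell n : Set (Eu d)) ⊆ (Metric.ball 0 R)ᶜ := fun z hz => by
      simpa using hout z hz
    have hg1 := h.int₁.mono_set hsub
    have hg2 := h.int₂.mono_set hsub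
    -- The reference point is chosen where `g₂` does not exceed its mean over the cell of volume
    -- one; thus `g₂(w)` becomes an integral of `g₂`.
    obtain ⟨w, hwQ, hw⟩ : ∃ w ∈ (shiftedCell n : Set (Eu d)),
        g₂ w ≤ ∫ z in (shiftedCell n : Set (Eu d)), g₂ z := by
      have h0 : volume (shiftedCell n : Set (Eu d)) = 1 := by
        have := measure_univ (μ := (volume : Measure (Eu d)).restrict (shiftedCell n))
        rwa [Measure.restrict_apply_univ] at this
      have := exists_le_setAverage (μ := (volume : Measure (Eu d))) (s := shiftedCell n) (f := g₂)
        (by rw [h0]; simp) (by rw [h0]; simp) hg2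
      rwa [setAverage_eq, measureReal_def, h0, ENNReal.toReal_one, inv_one, one_smul] at this
    have hosc : ∀ᵐ z ∂(volume.restrict (shiftedCell n : Set (Eu d))), ‖F z - F w‖ ≤ g₁ z + g₂ w := by
      filter_upwards [ae_restrict_mem hQ] with z hz
      exact h.osc z w (hout z hz) (hout w hwQ) (norm_sub_le_of_mem_shiftedCell hz hwQ)
    have hdiff : Integrable (fun z => F z - F w) (volume.restrict (shiftedCell n)) :=
      (hg1.add (integrable_const (g₂ w))).mono' ((h.meas.sub_const _).aestronglyMeasurable) hosc
    have hmd : Integrable (fun z => m z * (F z - F w)) (volume.restrict (shiftedCell n)) :=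
      hdiff.bdd_mul hma hb
    have hmi : Integrable m (volume.restrict (shiftedCell n)) :=
      (integrable_const M).mono' hma hb
    have e : (fun z => m z * F z) = fun z => m z * (F z - F w) + m z * F w := by
      ext z; ring
    refine ⟨?_, ?_⟩
    · rw [e]
      exact hmd.add (hmi.mul_const _)
    · rw [e, integral_add hmd (hmi.mul_const _), integral_mul_const, hm.setIntegral, zero_mul,
        add_zero]
      calc ‖∫ z in (shiftedCell n : Set (Eu d)), m z * (F z - F w)‖
          ≤ ∫ z in (shiftedCell n : Set (Eu d)), M * (g₁ z + g₂ w) := by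
            refine norm_integral_le_of_norm_le ((hg1.add (integrable_const (g₂ w))).const_mul M) ?_
            filter_upwards [hb, hosc] with z h1 h2
            rw [norm_mul]
            exact mul_le_mul h1 h2 (norm_nonneg _) hM
        _ = M * ((∫ z in (shiftedCell n : Set (Eu d)), g₁ z) + g₂ w) := by
            rw [integral_const_mul, integral_add hg1 (integrable_const _), integral_const,
              probReal_univ, one_smul]
        _ ≤ M * ((∫ z in (shiftedCell n : Set (Eu d)), g₁ z) +
              ∫ z in (shiftedCell n : Set (Eu d)), g₂ z) := by gcongr
        _ = ∫ z in (shiftedCell n : Set (Eu d)), M * (g₁ z + g₂ z) := by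
            rw [integral_const_mul, integral_add hg1 hg2]
        _ ≤ _ := by
            refine setIntegral_mono_on ((hg1.add hg2).const_mul M)
              (hmaj.integrableOn.const_mul M) hQ fun z hz => ?_
            refine mul_le_mul_of_nonneg_left ?_ hM
            rw [cellMajorant, indicator_of_mem (hsub hz)]
            exact le_add_of_nonneg_left (indicator_nonneg (fun _ _ => abs_nonneg _) z)
  · push Not at hout
    obtain ⟨w, hw, hwR⟩ := hout
    have hsub : (shiftedCell n : Set (Eu d)) ⊆ Metric.ball 0 (R + √d) := fun z hz => by
      have h1 := norm_sub_le_of_mem_shiftedCell hz hw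
      have h2 := norm_add_le (z - w) w
      rw [sub_add_cancel] at h2
      exact mem_ball_zero_iff.2 (by linarith)
    have hF := h.near.mono_set hsub
    refine ⟨Integrable.bdd_mul hF hma hb, ?_⟩
    refine norm_integral_le_of_norm_le (hmaj.integrableOn.const_mul M) ?_
    filter_upwards [hb, ae_restrict_mem hQ] with z h1 hz
    rw [norm_mul]
    refine mul_le_mul h1 ?_ (norm_nonneg _) hM
    rw [cellMajorant, indicator_of_mem (hsub hz)]
    exact le_add_of_nonneg_right
      (indicator_nonneg (fun z _ => add_nonneg (h.nonneg₁ z) (h.nonneg₂ z)) z)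

lemma hasSum_shiftedCell {f : Eu d → ℝ} (hf : Integrable f) :
    HasSum (fun n : Fin d → ℤ => ∫ z in (shiftedCell n : Set (Eu d)), f z) (∫ z, f z) := by
  have h := hasSum_integral_iUnion (fun n => measurableSet_shiftedCell (d := d) n)
    pairwise_disjoint_shiftedCell (μ := volume) (f := f) hf.integrableOn
  rwa [iUnion_shiftedCell, setIntegral_univ] at h

lemma CellDominated.hasSum_majorant (h : CellDominated R F g₁ g₂) (M : ℝ) :
    HasSum (fun n : Fin d → ℤ => ∫ z in (shiftedCell n : Set (Eu d)), M * cellMajorant R F g₁ g₂ z)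
      (M * ((∫ z in Metric.ball 0 (R + √d), |F z|) +
        ((∫ z in (Metric.ball 0 R)ᶜ, g₁ z) + ∫ z in (Metric.ball 0 R)ᶜ, g₂ z))) := by
  have h1 := hasSum_shiftedCell (h.integrable.1.const_mul M)
  rwa [integral_const_mul, h.integrable.2] at h1

lemma CellDominated.summable (h : CellDominated R F g₁ g₂) (hm : IsMeanZero m M) :
    Summable fun n : Fin d → ℤ => ∫ z in (shiftedCell n : Set (Eu d)), m z * F z :=
  Summable.of_norm_bounded (h.hasSum_majorant M).summable fun n => (h.cell hm n).2

lemma CellDominated.norm_tsum_le (h : CellDominated R F g₁ g₂) (hm : IsMeanZero m M) :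
    |∑' n : Fin d → ℤ, ∫ z in (shiftedCell n : Set (Eu d)), m z * F z| ≤
      M * ((∫ z in Metric.ball 0 (R + √d), |F z|) +
        ((∫ z in (Metric.ball 0 R)ᶜ, g₁ z) + ∫ z in (Metric.ball 0 R)ᶜ, g₂ z)) :=
  tsum_of_norm_bounded (h.hasSum_majorant M) fun n => (h.cell hm n).2

end Cells

/-! ### Oscillation of homogeneous kernels over the cells -/

section Oscillation

variable {d : ℕ} [NeZero d] {α : ℝ}

lemma two_lt_exponent (hα₁ : 1 < α) : 2 < (d : ℝ) + α := by
  have : (1 : ℝ) ≤ d := by exact_mod_cast NeZero.one_le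
  linarith

lemma one_lt_ratio (hα₁ : 1 < α) : 1 < (2 : ℝ) ^ (1 / ((d : ℝ) + α)) := by
  have := two_lt_exponent (d := d) hα₁
  exact Real.one_lt_rpow one_lt_two (by positivity)

/-- Since `d + α > 2` the number is at most `√2`; `3/2` is a rational majorant used in the constants
below. -/
lemma ratio_le (hα₁ : 1 < α) : (2 : ℝ) ^ (1 / ((d : ℝ) + α)) ≤ 3 / 2 := by
  have := two_lt_exponent (d := d) hα₁
  calc (2 : ℝ) ^ (1 / ((d : ℝ) + α)) ≤ 2 ^ (1 / 2 : ℝ) := by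
        refine Real.rpow_le_rpow_of_exponent_le one_le_two ?_
        exact one_div_le_one_div_of_le two_pos this.le
    _ = √2 := (Real.sqrt_eq_rpow 2).symm
    _ ≤ 3 / 2 := by
        rw [Real.sqrt_le_left (by norm_num)]
        norm_num

lemma sqrt_dim_pos (d : ℕ) [NeZero d] : 0 < √(d : ℝ) :=
  Real.sqrt_pos.2 (by exact_mod_cast NeZero.pos d)

lemma bigR_pos (hα₁ : 1 < α) : 0 < bigR d α := by
  have h1 := one_lt_ratio (d := d) hα₁
  have h2 := sqrt_dim_pos d
  unfold bigR
  have : 0 < (2 : ℝ) ^ (1 / ((d : ℝ) + α)) - 1 := by linarith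
  positivity

/-- With `q` the right side, the choice of `R` means `√d/R = (q-1)/q`, which is at most `q - 1`. -/
lemma one_add_sqrt_div_bigR_le (hα₁ : 1 < α) :
    1 + √d / bigR d α ≤ (2 : ℝ) ^ (1 / ((d : ℝ) + α)) := by
  have h1 := one_lt_ratio (d := d) hα₁
  have h2 := sqrt_dim_pos d
  unfold bigR
  set q := (2 : ℝ) ^ (1 / ((d : ℝ) + α))
  have hq : 0 < q - 1 := by linarith
  have e : √d / (√d * q / (q - 1)) = (q - 1) / q := by
    field_simp
  rw [e]
  have : 1 + (q - 1) / q = q - (q - 1) ^ 2 / q := by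
    field_simp
    ring
  rw [this]
  have : 0 ≤ (q - 1) ^ 2 / q := by positivity
  linarith

/-- Two far points of a cell have comparable norms. -/
lemma norm_le_ratio_mul (hα₁ : 1 < α) {z w : Eu d} (hz : bigR d α ≤ ‖z‖) (hzw : ‖z - w‖ ≤ √d) :
    ‖w‖ ≤ (2 : ℝ) ^ (1 / ((d : ℝ) + α)) * ‖z‖ := by
  have hR := bigR_pos (d := d) hα₁
  have h1 := one_add_sqrt_div_bigR_le (d := d) hα₁
  have h2 : ‖w‖ ≤ ‖z‖ + √d := by
    have := norm_sub_le z (z - w)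
    rw [sub_sub_cancel] at this
    linarith
  have h3 : √d ≤ √d / bigR d α * ‖z‖ := by
    rw [div_mul_eq_mul_div, le_div_iff₀ hR]
    gcongr
  nlinarith [norm_nonneg z]

/-- The quotient of the kernel values is `t^p` with `t = ‖w‖/‖z‖` and `p = d+α`. Bernoulli's
inequality, for `t` or for `1/t`, bounds `|t^p - 1|` by `p√d/‖w‖` up to the factor `t^p`, and `R` is
chosen so that `t^p ≤ 2`. -/
lemma abs_radialKernel_sub_le (hα₁ : 1 < α) {z w : Eu d} (hz : bigR d α ≤ ‖z‖)
    (hw : bigR d α ≤ ‖w‖) (hzw : ‖z - w‖ ≤ √d) :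
    |radialKernel α z - radialKernel α w| ≤
      2 * ((d : ℝ) + α) * √d * (radialKernel α w / ‖w‖) := by
  have hR := bigR_pos (d := d) hα₁
  have hp := two_lt_exponent (d := d) hα₁
  set p := (d : ℝ) + α with hp_def
  have hz0 : 0 < ‖z‖ := hR.trans_le hz
  have hw0 : 0 < ‖w‖ := hR.trans_le hw
  have hd := sqrt_dim_pos d
  set t := ‖w‖ / ‖z‖ with ht
  have ht0 : 0 < t := by positivity
  have hr : radialKernel α z = radialKernel α w * t ^ p := by
    rw [radialKernel, radialKernel, ht, Real.div_rpow hw0.le hz0.le, ← hp_def]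
    have := Real.rpow_pos_of_pos hw0 p
    field_simp
  have ht2 : t ^ p ≤ 2 := by
    have h1 : t ≤ (2 : ℝ) ^ (1 / p) := by
      rw [ht, div_le_iff₀ hz0]
      exact norm_le_ratio_mul hα₁ hz hzw
    calc t ^ p ≤ ((2 : ℝ) ^ (1 / p)) ^ p := Real.rpow_le_rpow ht0.le h1 (by linarith)
      _ = 2 := by
          rw [← Real.rpow_mul zero_le_two, one_div_mul_cancel (by linarith), Real.rpow_one]
  have key : |t ^ p - 1| ≤ 2 * p * √d / ‖w‖ := by
    rcases le_total 1 t with h | h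
    · have hb := one_add_mul_self_le_rpow_one_add (s := 1 / t - 1) (p := p)
        (by have : 0 < 1 / t := by positivity
            linarith) (by linarith)
      rw [add_sub_cancel, Real.div_rpow zero_le_one ht0.le, Real.one_rpow] at hb
      have htp : 0 < t ^ p := by positivity
      have h1 : 1 ≤ t ^ p := Real.one_le_rpow h (by linarith)
      have hb2 : t ^ p + t ^ p * (p * (1 / t - 1)) ≤ 1 := by
        have := mul_le_mul_of_nonneg_left hb htp.le
        rw [mul_one_div_cancel htp.ne'] at this
        linarith
      have hs : 1 - 1 / t ≤ √d / ‖w‖ := by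
        have e : 1 - 1 / t = (‖w‖ - ‖z‖) / ‖w‖ := by
          rw [ht]
          field_simp
        rw [e]
        gcongr
        have := norm_sub_norm_le w z
        rw [norm_sub_rev] at this
        linarith
      have hs0 : 0 ≤ 1 - 1 / t := by
        rw [sub_nonneg, div_le_one ht0]
        exact h
      rw [abs_of_nonneg (by linarith)]
      calc t ^ p - 1 ≤ t ^ p * (p * (1 - 1 / t)) := by linarith
        _ ≤ 2 * (p * (√d / ‖w‖)) := by gcongr
        _ = _ := by ring
    · have hb := one_add_mul_self_le_rpow_one_add (s := t - 1) (p := p) (by linarith) (by linarith)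
      rw [add_sub_cancel] at hb
      have h1 : t ^ p ≤ 1 := Real.rpow_le_one ht0.le h (by linarith)
      have hwz : ‖w‖ ≤ ‖z‖ := by
        rwa [ht, div_le_one hz0] at h
      have hs : 1 - t ≤ √d / ‖w‖ := by
        have e : 1 - t = (‖z‖ - ‖w‖) / ‖z‖ := by
          rw [ht]
          field_simp
        rw [e]
        have := norm_sub_norm_le z w
        calc (‖z‖ - ‖w‖) / ‖z‖ ≤ √d / ‖z‖ := by gcongr; linarith
          _ ≤ _ := by gcongr
      have h0 : 0 ≤ √d / ‖w‖ := by positivity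
      rw [abs_of_nonpos (by linarith)]
      calc -(t ^ p - 1) ≤ p * (1 - t) := by linarith
        _ ≤ p * (√d / ‖w‖) := by gcongr
        _ ≤ 2 * (p * (√d / ‖w‖)) := by
            have : 0 ≤ p * (√d / ‖w‖) := by positivity
            linarith
        _ = _ := by ring
  have e : radialKernel α z - radialKernel α w = radialKernel α w * (t ^ p - 1) := by
    rw [hr]
    ring
  rw [e, abs_mul, abs_of_nonneg (radialKernel_nonneg _ _)]
  calc radialKernel α w * |t ^ p - 1| ≤ radialKernel α w * (2 * p * √d / ‖w‖) := by
        gcongr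
        exact radialKernel_nonneg _ _
    _ = _ := by ring

lemma abs_mul_radialKernel_sub_le (hα₁ : 1 < α) {z w : Eu d} (hz : bigR d α ≤ ‖z‖)
    (hw : bigR d α ≤ ‖w‖) (hzw : ‖z - w‖ ≤ √d) (a b : ℝ) :
    |a * radialKernel α z - b * radialKernel α w| ≤ |a - b| * radialKernel α z +
      |b| * (2 * ((d : ℝ) + α) * √d * (radialKernel α w / ‖w‖)) := by
  have h1 : a * radialKernel α z - b * radialKernel α w =
      (a - b) * radialKernel α z + b * (radialKernel α z - radialKernel α w) := by ring
  rw [h1]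
  refine (abs_add_le _ _).trans ?_
  rw [abs_mul, abs_mul, abs_of_nonneg (radialKernel_nonneg α z)]
  gcongr
  exact abs_radialKernel_sub_le hα₁ hz hw hzw

lemma abs_inner_sub_le (ξ : Eu d) {z w : Eu d} (hzw : ‖z - w‖ ≤ √d) :
    |inner ℝ ξ z - inner ℝ ξ w| ≤ ‖ξ‖ * √d := by
  rw [← inner_sub_right]
  exact (abs_real_inner_le_norm _ _).trans (by gcongr)

/-- The quadratic kernel `⟨ξ,z⟩² / (2 |z|^{d+α})`. -/
def quadKernel (α : ℝ) (ξ z : Eu d) : ℝ := (inner ℝ ξ z) ^ 2 / 2 * radialKernel α z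

/-- The remainder kernel `(1 - cos ⟨ξ,z⟩ - ⟨ξ,z⟩²/2) / |z|^{d+α}`. -/
def remKernel (α : ℝ) (ξ z : Eu d) : ℝ :=
  (1 - Real.cos (inner ℝ ξ z) - (inner ℝ ξ z) ^ 2 / 2) * radialKernel α z

/-- The rotation invariant density `|z|^{-d-α-1}` outside of the ball of radius `R`. -/
def farDensity (d : ℕ) (α R r : ℝ) : ℝ := (Ici R).indicator (fun r => (r ^ ((d : ℝ) + α))⁻¹ / r) r

/-- Rotation averages `⟨ξ,z⟩²` to `|ξ|²|z|²/d`. The gain `1/d` over Cauchy–Schwarz is what allows a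
comparison with `cFour`. -/
lemma integral_far_inner_sq (hα₁ : 1 < α) {R : ℝ} (hR : 0 < R) (ξ : Eu d) :
    IntegrableOn (fun z : Eu d => (inner ℝ ξ z) ^ 2 * (radialKernel α z / ‖z‖)) (Metric.ball 0 R)ᶜ ∧
      ∫ z in (Metric.ball (0 : Eu d) R)ᶜ, (inner ℝ ξ z) ^ 2 * (radialKernel α z / ‖z‖) =
        ‖ξ‖ ^ 2 / d * (sphereArea d * (R ^ (1 - α) / (α - 1))) := by
  have hf := radial_far (d := d) hα₁ hR
  have e1 : (fun z : Eu d => farDensity d α R ‖z‖ * ‖z‖ ^ 2) =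
      (Metric.ball 0 R)ᶜ.indicator fun z => ‖z‖ * radialKernel α z := by
    ext z
    by_cases hz : R ≤ ‖z‖
    · rw [indicator_of_mem (by simpa using hz), farDensity, indicator_of_mem (mem_Ici.2 hz),
        radialKernel]
      have : 0 < ‖z‖ := hR.trans_le hz
      field_simp
    · rw [indicator_of_notMem (by simpa using hz), farDensity, indicator_of_notMem (by simpa using hz),
        zero_mul]
  have e2 : (fun z : Eu d => farDensity d α R ‖z‖ * (inner ℝ ξ z) ^ 2) =
      (Metric.ball 0 R)ᶜ.indicator fun z => (inner ℝ ξ z) ^ 2 * (radialKernel α z / ‖z‖) := by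
    ext z
    by_cases hz : R ≤ ‖z‖
    · rw [indicator_of_mem (by simpa using hz), farDensity, indicator_of_mem (mem_Ici.2 hz),
        radialKernel, mul_comm]
    · rw [indicator_of_notMem (by simpa using hz), farDensity, indicator_of_notMem (by simpa using hz),
        zero_mul]
  have h := integral_mul_inner_sq (h := farDensity d α R) ξ
    (by rw [e1]; exact (integrable_indicator_iff measurableSet_ball.compl).2 hf.1)
    (Measurable.indicator (by fun_prop) measurableSet_Ici)
  rw [e1, e2, integral_indicator measurableSet_ball.compl,
    integral_indicator measurableSet_ball.compl, hf.2] at h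
  exact ⟨(integrable_indicator_iff measurableSet_ball.compl).1 h.1, h.2⟩

/-- Over a far cell `⟨ξ,·⟩²/2` changes by at most `½·|ξ|√d·|ξ|(1 + 3/2)|z|`, whence `5/4`; the
kernel changes by a factor of relative size `|w|⁻¹`. Each effect lowers the growth by one power,
enough for convergence as `α > 1`. -/
lemma quadKernel_dominated (hα₁ : 1 < α) (hα₂ : α < 2) (ξ : Eu d) :
    CellDominated (bigR d α) (quadKernel α ξ)
      (fun z => 5 / 4 * ‖ξ‖ ^ 2 * √d * (‖z‖ * radialKernel α z))
      (fun z => ((d : ℝ) + α) * √d * ((inner ℝ ξ z) ^ 2 * (radialKernel α z / ‖z‖))) where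
  meas := by unfold quadKernel; fun_prop
  near := by
    have hR := bigR_pos (d := d) hα₁
    refine ((radial_near (d := d) hα₂ (by positivity : 0 < bigR d α + √d)).1.const_mul
      (‖ξ‖ ^ 2)).mono' (Measurable.aestronglyMeasurable (by unfold quadKernel; fun_prop))
      (ae_of_all _ fun z => ?_)
    have h := pow_le_pow_left₀ (abs_nonneg _) (abs_real_inner_le_norm ξ z) 2
    rw [sq_abs] at h
    have hr := radialKernel_nonneg α z
    rw [quadKernel, Real.norm_of_nonneg (by positivity)]
    calc (inner ℝ ξ z) ^ 2 / 2 * radialKernel α z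
        ≤ (‖ξ‖ * ‖z‖) ^ 2 * radialKernel α z := by
          gcongr
          linarith [sq_nonneg (inner ℝ ξ z : ℝ)]
      _ = _ := by ring
  int₁ := (radial_far hα₁ (bigR_pos hα₁)).1.const_mul _
  int₂ := (integral_far_inner_sq hα₁ (bigR_pos hα₁) ξ).1.const_mul _
  nonneg₁ z := by
    have hr := radialKernel_nonneg α z
    positivity
  nonneg₂ z := by
    have hr := radialKernel_nonneg α z
    positivity
  osc z w hz hw hzw := by
    have hr := radialKernel_nonneg α z
    refine (abs_mul_radialKernel_sub_le hα₁ hz hw hzw _ _).trans (add_le_add ?_ (le_of_eq ?_))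
    · have h1 := abs_inner_sub_le ξ hzw
      have h2 := abs_real_inner_le_norm ξ z
      have h3 := abs_real_inner_le_norm ξ w
      have h4 : ‖w‖ ≤ 3 / 2 * ‖z‖ := (norm_le_ratio_mul hα₁ hz hzw).trans
        (by gcongr; exact ratio_le hα₁)
      have h5 : |inner ℝ ξ z + inner ℝ ξ w| ≤ ‖ξ‖ * (5 / 2 * ‖z‖) := by
        refine (abs_add_le _ _).trans ?_
        nlinarith [norm_nonneg ξ]
      have e : (inner ℝ ξ z) ^ 2 / 2 - (inner ℝ ξ w) ^ 2 / 2 =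
          1 / 2 * ((inner ℝ ξ z - inner ℝ ξ w) * (inner ℝ ξ z + inner ℝ ξ w)) := by ring
      rw [e, abs_mul, abs_mul]
      calc |1 / 2| * (|inner ℝ ξ z - inner ℝ ξ w| * |inner ℝ ξ z + inner ℝ ξ w|) * radialKernel α z
          ≤ |1 / 2| * ((‖ξ‖ * √d) * (‖ξ‖ * (5 / 2 * ‖z‖))) * radialKernel α z := by gcongr
        _ = _ := by
          rw [abs_of_pos (by norm_num : (0 : ℝ) < 1 / 2)]
          ring
    · rw [abs_of_nonneg (by positivity)]
      ring

/-- The bound for the quadratic form coming from `μ_*`. -/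
lemma abs_tsum_quadKernel_le (hα₁ : 1 < α) (hα₂ : α < 2) (ξ : Eu d) {m : Eu d → ℝ} {M : ℝ}
    (hm : IsMeanZero m M) :
    |∑' n : Fin d → ℤ, ∫ z in (shiftedCell n : Set (Eu d)), m z * quadKernel α ξ z| ≤
      5 / 4 * (cFour d α * M) * ‖ξ‖ ^ 2 := by
  refine ((quadKernel_dominated hα₁ hα₂ ξ).norm_tsum_le hm).trans ?_
  have hR := bigR_pos (d := d) hα₁
  have hM := hm.nonneg
  have hs := sqrt_dim_pos d
  have hω := (sphereArea_pos d).le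
  have hα1 : 0 < α - 1 := by linarith
  have hα2 : 0 < 2 - α := by linarith
  have hp := two_lt_exponent (d := d) hα₁
  have hnear := radial_near (d := d) hα₂ (by positivity : 0 < bigR d α + √d)
  have h1 : ∫ z in Metric.ball (0 : Eu d) (bigR d α + √d), |quadKernel α ξ z| ≤
      ‖ξ‖ ^ 2 * (sphereArea d * ((bigR d α + √d) ^ (2 - α) / (2 * (2 - α)))) := by
    have e : ‖ξ‖ ^ 2 * (sphereArea d * ((bigR d α + √d) ^ (2 - α) / (2 * (2 - α)))) =
        ‖ξ‖ ^ 2 / 2 * (sphereArea d * ((bigR d α + √d) ^ (2 - α) / (2 - α))) := by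
      field_simp
    rw [e, ← hnear.2, ← integral_const_mul]
    refine integral_mono (quadKernel_dominated hα₁ hα₂ ξ).near.abs (hnear.1.const_mul _) fun z => ?_
    have h := pow_le_pow_left₀ (abs_nonneg _) (abs_real_inner_le_norm ξ z) 2
    rw [sq_abs] at h
    have hr := radialKernel_nonneg α z
    simp only [quadKernel]
    rw [abs_of_nonneg (by positivity)]
    calc (inner ℝ ξ z) ^ 2 / 2 * radialKernel α z
        ≤ (‖ξ‖ * ‖z‖) ^ 2 / 2 * radialKernel α z := by gcongr
      _ = _ := by ring
  rw [integral_const_mul, integral_const_mul, (radial_far hα₁ hR).2,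
    (integral_far_inner_sq hα₁ hR ξ).2]
  have hneg : bigR d α ^ (1 - α) = (bigR d α ^ (α - 1))⁻¹ := by
    rw [← Real.rpow_neg hR.le, neg_sub]
  set T := sphereArea d * (bigR d α ^ (1 - α) / (α - 1)) with hT
  have hT0 : 0 ≤ T := by positivity
  have hx1 : 1 ≤ √(d : ℝ) := Real.one_le_sqrt.2 (by exact_mod_cast NeZero.one_le)
  have hxsq : √(d : ℝ) * √d = d := Real.mul_self_sqrt (Nat.cast_nonneg d)
  have hd0 : (0 : ℝ) < d := by exact_mod_cast NeZero.pos d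
  have h2 : 5 / 4 * ‖ξ‖ ^ 2 * √d * T + ((d : ℝ) + α) * √d * (‖ξ‖ ^ 2 / d * T) ≤
      5 / 4 * ‖ξ‖ ^ 2 * (((d : ℝ) + α + 1) * T) := by
    have hxp : √(d : ℝ) ≤ (d : ℝ) + α := by nlinarith
    -- The difference of the two sides is `(√d - 1)(d + α - √d)/√d`, nonnegative because `1 ≤ √d ≤ d
    -- + α`.
    have hk : √(d : ℝ) + ((d : ℝ) + α) / √d ≤ (d : ℝ) + α + 1 := by
      rw [← sub_nonneg]
      have : (d : ℝ) + α + 1 - (√(d : ℝ) + ((d : ℝ) + α) / √d) =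
          (√(d : ℝ) - 1) * ((d : ℝ) + α - √d) / √d := by
        field_simp
        ring
      rw [this]
      have a1 : 0 ≤ √(d : ℝ) - 1 := by linarith
      have a2 : 0 ≤ (d : ℝ) + α - √d := by linarith
      positivity
    have e : ((d : ℝ) + α) * √d * (‖ξ‖ ^ 2 / d * T) = ‖ξ‖ ^ 2 * (((d : ℝ) + α) / √d) * T := by
      nth_rw 3 [← hxsq]
      field_simp
    rw [e]
    have h3 : 0 ≤ ((d : ℝ) + α) / √d := by positivity
    calc 5 / 4 * ‖ξ‖ ^ 2 * √d * T + ‖ξ‖ ^ 2 * (((d : ℝ) + α) / √d) * T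
        ≤ 5 / 4 * ‖ξ‖ ^ 2 * √d * T + 5 / 4 * (‖ξ‖ ^ 2 * (((d : ℝ) + α) / √d) * T) := by
          have : 0 ≤ ‖ξ‖ ^ 2 * (((d : ℝ) + α) / √d) * T := by positivity
          linarith
      _ = 5 / 4 * ‖ξ‖ ^ 2 * ((√d + ((d : ℝ) + α) / √d) * T) := by ring
      _ ≤ _ := by gcongr
  have h3 : 0 ≤ sphereArea d * ((bigR d α + √d) ^ (2 - α) / (2 * (2 - α))) := by positivity
  have e : 5 / 4 * (cFour d α * M) * ‖ξ‖ ^ 2 = M * (5 / 4 * ‖ξ‖ ^ 2 *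
      (sphereArea d * ((bigR d α + √d) ^ (2 - α) / (2 * (2 - α)))) +
        5 / 4 * ‖ξ‖ ^ 2 * (((d : ℝ) + α + 1) * T)) := by
    rw [hT, hneg, cFour]
    field_simp
  rw [e]
  gcongr
  refine h1.trans ?_
  nlinarith [mul_nonneg (sq_nonneg ‖ξ‖) h3]

/-! ### The Taylor remainder -/

/-- The imaginary part of `norm_wave_sub_le` in dimension one. -/
lemma abs_sin_sub_le (t : ℝ) : |Real.sin t - t| ≤ 2 * quadLin |t| := by
  have h := norm_wave_sub_le (d := 1) (EuclideanSpace.single 0 1) (EuclideanSpace.single 0 t)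
  rw [inner_single_zero] at h
  have e1 : ‖(EuclideanSpace.single 0 1 : Eu 1)‖ * ‖(EuclideanSpace.single 0 t : Eu 1)‖ = |t| := by
    simp
  have e2 : (1 - wave (EuclideanSpace.single 0 1) (EuclideanSpace.single 0 t : Eu 1) +
      Complex.I * ((1 * (EuclideanSpace.single 0 t : Eu 1) 0 : ℝ) : ℂ)).im = -(Real.sin t - t) := by
    rw [wave, inner_single_zero, mul_comm Complex.I, Complex.exp_mul_I, ← Complex.ofReal_cos,
      ← Complex.ofReal_sin]
    have h1 : (Complex.sin (t : ℂ)).re = Real.sin t := Complex.sin_ofReal_re t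
    simp [h1]
    ring
  rw [e1] at h
  have h2 := (Complex.abs_im_le_norm _).trans h
  rwa [e2, abs_neg] at h2

/-- The Taylor remainder `1 - cos t - t²/2`. -/
def cosRem (t : ℝ) : ℝ := 1 - Real.cos t - t ^ 2 / 2

lemma hasDerivAt_cosRem (t : ℝ) : HasDerivAt cosRem (Real.sin t - t) t := by
  have h1 := ((hasDerivAt_const t (1 : ℝ)).sub (Real.hasDerivAt_cos t)).sub
    ((hasDerivAt_pow 2 t).div_const 2)
  refine h1.congr_deriv ?_
  norm_num

/-- Mean value inequality, the derivative of the remainder being `sin t - t`. -/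
lemma abs_cosRem_sub_le {a b L : ℝ} (ha : |a| ≤ L) (hb : |b| ≤ L) :
    |cosRem a - cosRem b| ≤ 2 * quadLin L * |a - b| := by
  have h := Convex.norm_image_sub_le_of_norm_hasDerivWithin_le (f := cosRem)
    (f' := fun t => Real.sin t - t) (s := Icc (-L) L) (C := 2 * quadLin L) (x := b) (y := a)
    (fun t _ => (hasDerivAt_cosRem t).hasDerivWithinAt)
    (fun t ht => (abs_sin_sub_le t).trans (by
      gcongr
      exact quadLin_mono (abs_nonneg _) (abs_le.2 ht)))
    (convex_Icc _ _) (abs_le.1 hb) (abs_le.1 ha)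
  exact h

lemma abs_cosRem_le (t : ℝ) : |cosRem t| ≤ 2 * quadLin |t| * |t| := by
  have h := abs_cosRem_sub_le (a := t) (b := 0) (L := |t|) le_rfl (by simp)
  have h0 : cosRem 0 = 0 := by simp [cosRem]
  rwa [h0, sub_zero, sub_zero] at h

lemma quadLin_mul_le {c t : ℝ} (hc : 1 ≤ c) (ht : 0 ≤ t) : quadLin (c * t) ≤ c ^ 2 * quadLin t := by
  rw [quadLin, quadLin, mul_min_of_nonneg _ _ (sq_nonneg c)]
  refine min_le_min (le_of_eq (by ring)) ?_
  nlinarith [mul_nonneg (by linarith : 0 ≤ c) ht]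

/-- Each majorant is `|ξ|` times `quadLin(|ξ||z|)` times the kernel: the extra `|ξ|` comes from the
cell size in `g₁` and from `|⟨ξ,w⟩| ≤ |ξ||w|` in `g₂`. The coefficient `9/2` is `2(3/2)²`, the cost
of comparing `|w|` with `|z|` inside `quadLin`. -/
lemma remKernel_dominated (hα₁ : 1 < α) (hα₂ : α < 2) (ξ : Eu d) :
    CellDominated (bigR d α) (remKernel α ξ)
      (fun z => 9 / 2 * ‖ξ‖ * √d * (quadLin (‖ξ‖ * ‖z‖) * radialKernel α z))
      (fun z => 4 * ((d : ℝ) + α) * √d * ‖ξ‖ * (quadLin (‖ξ‖ * ‖z‖) * radialKernel α z)) where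
  meas := by unfold remKernel; fun_prop
  near := by
    refine ((quadLin_scale (d := d) hα₁ hα₂ (norm_nonneg ξ)).1.const_mul
      (2 * (‖ξ‖ * (bigR d α + √d)))).integrableOn.mono'
      (Measurable.aestronglyMeasurable (by unfold remKernel; fun_prop)) ?_
    filter_upwards [ae_restrict_mem measurableSet_ball] with z hz
    have hz' : ‖z‖ ≤ bigR d α + √d := (mem_ball_zero_iff.1 hz).le
    have h1 := abs_cosRem_le (inner ℝ ξ z)
    have h2 := abs_real_inner_le_norm ξ z
    have h3 := quadLin_mono (abs_nonneg _) h2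
    have hq := quadLin_nonneg (abs_nonneg (inner ℝ ξ z))
    have hr := radialKernel_nonneg α z
    have hq2 := quadLin_nonneg (by positivity : 0 ≤ ‖ξ‖ * ‖z‖)
    rw [remKernel, norm_mul, Real.norm_of_nonneg hr, Real.norm_eq_abs]
    calc |1 - Real.cos (inner ℝ ξ z) - (inner ℝ ξ z) ^ 2 / 2| * radialKernel α z
        ≤ (2 * quadLin |inner ℝ ξ z| * |inner ℝ ξ z|) * radialKernel α z := by
          gcongr
          exact h1
      _ ≤ (2 * quadLin (‖ξ‖ * ‖z‖) * (‖ξ‖ * (bigR d α + √d))) * radialKernel α z := by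
          gcongr
          exact h2.trans (by gcongr)
      _ = _ := by ring
  int₁ := ((quadLin_scale hα₁ hα₂ (norm_nonneg ξ)).1.const_mul _).integrableOn
  int₂ := ((quadLin_scale hα₁ hα₂ (norm_nonneg ξ)).1.const_mul _).integrableOn
  nonneg₁ z := by
    have hr := radialKernel_nonneg α z
    have hq := quadLin_nonneg (by positivity : 0 ≤ ‖ξ‖ * ‖z‖)
    positivity
  nonneg₂ z := by
    have hr := radialKernel_nonneg α z
    have hq := quadLin_nonneg (by positivity : 0 ≤ ‖ξ‖ * ‖z‖)
    have : 0 < (d : ℝ) + α := by linarith [two_lt_exponent (d := d) hα₁]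
    positivity
  osc z w hz hw hzw := by
    have hp : 0 < (d : ℝ) + α := by linarith [two_lt_exponent (d := d) hα₁]
    have hr := radialKernel_nonneg α z
    have hrw := radialKernel_nonneg α w
    have hw0 : 0 < ‖w‖ := (bigR_pos hα₁).trans_le hw
    have h2 := abs_real_inner_le_norm ξ z
    have h3 := abs_real_inner_le_norm ξ w
    refine (abs_mul_radialKernel_sub_le hα₁ hz hw hzw _ _).trans (add_le_add ?_ ?_)
    · have h1 := abs_inner_sub_le ξ hzw
      have h4 : ‖w‖ ≤ 3 / 2 * ‖z‖ := (norm_le_ratio_mul hα₁ hz hzw).trans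
        (by gcongr; exact ratio_le hα₁)
      have h5 : |cosRem (inner ℝ ξ z) - cosRem (inner ℝ ξ w)| ≤
          2 * quadLin (3 / 2 * (‖ξ‖ * ‖z‖)) * |inner ℝ ξ z - inner ℝ ξ w| := by
        refine abs_cosRem_sub_le ?_ ?_
        · refine h2.trans ?_
          have : 0 ≤ ‖ξ‖ * ‖z‖ := by positivity
          linarith
        · refine h3.trans ?_
          nlinarith [norm_nonneg ξ]
      have h6 := quadLin_mul_le (c := 3 / 2) (by norm_num) (by positivity : 0 ≤ ‖ξ‖ * ‖z‖)
      have hq := quadLin_nonneg (by positivity : 0 ≤ ‖ξ‖ * ‖z‖)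
      have h7 : |cosRem (inner ℝ ξ z) - cosRem (inner ℝ ξ w)| ≤
          2 * ((3 / 2) ^ 2 * quadLin (‖ξ‖ * ‖z‖)) * (‖ξ‖ * √d) :=
        h5.trans (by gcongr)
      calc _ ≤ 2 * ((3 / 2) ^ 2 * quadLin (‖ξ‖ * ‖z‖)) * (‖ξ‖ * √d) * radialKernel α z :=
            mul_le_mul_of_nonneg_right h7 hr
        _ = _ := by ring
    · have h1 := abs_cosRem_le (inner ℝ ξ w)
      have h4 := quadLin_mono (abs_nonneg _) h3
      have hq := quadLin_nonneg (abs_nonneg (inner ℝ ξ w))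
      have hq2 := quadLin_nonneg (by positivity : 0 ≤ ‖ξ‖ * ‖w‖)
      have h5 : |cosRem (inner ℝ ξ w)| ≤ 2 * quadLin (‖ξ‖ * ‖w‖) * (‖ξ‖ * ‖w‖) :=
        h1.trans (by gcongr)
      calc _ ≤ 2 * quadLin (‖ξ‖ * ‖w‖) * (‖ξ‖ * ‖w‖) *
            (2 * ((d : ℝ) + α) * √d * (radialKernel α w / ‖w‖)) :=
            mul_le_mul_of_nonneg_right h5 (by positivity)
        _ = _ := by
            field_simp
            ring

/-- The constant in the remainder estimate. -/
def remConst (d : ℕ) (α : ℝ) : ℝ :=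
  quadLinMass d α * (2 * (bigR d α + √d) + 9 / 2 * √d + 4 * ((d : ℝ) + α) * √d)

/-- Scaling the `quadLin` integrals gives `|ξ|^α`, and the separate factor `|ξ|` makes the Taylor
error one order smaller than the main term. -/
lemma abs_tsum_remKernel_le (hα₁ : 1 < α) (hα₂ : α < 2) (ξ : Eu d) {m : Eu d → ℝ} {M : ℝ}
    (hm : IsMeanZero m M) :
    |∑' n : Fin d → ℤ, ∫ z in (shiftedCell n : Set (Eu d)), m z * remKernel α ξ z| ≤
      M * remConst d α * (‖ξ‖ * ‖ξ‖ ^ α) := by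
  refine ((remKernel_dominated hα₁ hα₂ ξ).norm_tsum_le hm).trans ?_
  have hR := bigR_pos (d := d) hα₁
  have hM := hm.nonneg
  have hp := two_lt_exponent (d := d) hα₁
  have hq := quadLin_scale (d := d) hα₁ hα₂ (norm_nonneg ξ)
  have hn : ∀ z : Eu d, 0 ≤ quadLin (‖ξ‖ * ‖z‖) * radialKernel α z := fun z =>
    mul_nonneg (quadLin_nonneg (by positivity)) (radialKernel_nonneg _ _)
  have hset : ∀ s : Set (Eu d), MeasurableSet s →
      ∫ z in s, quadLin (‖ξ‖ * ‖z‖) * radialKernel α z ≤ ‖ξ‖ ^ α * quadLinMass d α := fun s _ => by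
    rw [← hq.2]
    exact setIntegral_le_integral hq.1 (ae_of_all _ hn)
  have h1 : ∫ z in Metric.ball (0 : Eu d) (bigR d α + √d), |remKernel α ξ z| ≤
      2 * (‖ξ‖ * (bigR d α + √d)) * (‖ξ‖ ^ α * quadLinMass d α) := by
    refine le_trans ?_ (mul_le_mul_of_nonneg_left (hset (Metric.ball 0 (bigR d α + √d)) measurableSet_ball) (by positivity))
    rw [← integral_const_mul]
    refine setIntegral_mono_on (remKernel_dominated hα₁ hα₂ ξ).near.abs
      (hq.1.integrableOn.const_mul _) measurableSet_ball fun z hz => ?_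
    have hz' : ‖z‖ ≤ bigR d α + √d := (mem_ball_zero_iff.1 hz).le
    have h1 := abs_cosRem_le (inner ℝ ξ z)
    have h2 := abs_real_inner_le_norm ξ z
    have h3 := quadLin_mono (abs_nonneg _) h2
    have hq := quadLin_nonneg (abs_nonneg (inner ℝ ξ z))
    have hr := radialKernel_nonneg α z
    have hq2 := quadLin_nonneg (by positivity : 0 ≤ ‖ξ‖ * ‖z‖)
    rw [remKernel, abs_mul, abs_of_nonneg hr]
    calc |1 - Real.cos (inner ℝ ξ z) - (inner ℝ ξ z) ^ 2 / 2| * radialKernel α z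
        ≤ (2 * quadLin |inner ℝ ξ z| * |inner ℝ ξ z|) * radialKernel α z := by
          gcongr
          exact h1
      _ ≤ (2 * quadLin (‖ξ‖ * ‖z‖) * (‖ξ‖ * (bigR d α + √d))) * radialKernel α z := by
          gcongr
          exact h2.trans (by gcongr)
      _ = _ := by ring
  have h2 := hset _ (measurableSet_ball (x := (0 : Eu d)) (ε := bigR d α)).compl
  rw [integral_const_mul, integral_const_mul]
  calc _ ≤ M * (2 * (‖ξ‖ * (bigR d α + √d)) * (‖ξ‖ ^ α * quadLinMass d α) +
        (9 / 2 * ‖ξ‖ * √d * (‖ξ‖ ^ α * quadLinMass d α) +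
          4 * ((d : ℝ) + α) * √d * ‖ξ‖ * (‖ξ‖ ^ α * quadLinMass d α))) := by gcongr
    _ = _ := by
        rw [remConst]
        ring

end Oscillation

/-! ### The function `μ_*` and the form on the constants -/

lemma ae_ae_swap {d : ℕ} {m : Measure (Eu d)} [SFinite m] {p : Eu d × Eu d → Prop}
    (h : ∀ᵐ q ∂((cellMeasure d).prod m), p q) : ∀ᵐ z ∂m, ∀ᵐ x ∂(cellMeasure d), p (x, z) :=
  Measure.ae_ae_of_ae_prod
    ((Measure.measurePreserving_swap (μ := m) (ν := cellMeasure d)).quasiMeasurePreserving.ae h)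

lemma cell_prod_absolutelyContinuous (d : ℕ) :
    (cellMeasure d).prod (cellMeasure d) ≪ pairMeasure d :=
  Measure.AbsolutelyContinuous.prod Measure.AbsolutelyContinuous.rfl
    Measure.restrict_le_self.absolutelyContinuous

lemma muStar_eq {d : ℕ} (μ : Eu d × Eu d → ℝ) :
    muStar μ = fun z => (∫ x, μ (x, x + z) ∂(cellMeasure d)) - muZero μ := by
  ext z
  simp only [muStar, add_comm z]

namespace Setting

variable {d : ℕ} [NeZero d] {α μm μp : ℝ} {μ : Eu d × Eu d → ℝ}

lemma muZero_bounds (S : Setting d α μm μp μ) : μm ≤ muZero μ ∧ muZero μ ≤ μp := by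
  have hb : ∀ᵐ p ∂((cellMeasure d).prod (cellMeasure d)), μm ≤ μ p ∧ μ p ≤ μp :=
    (cell_prod_absolutelyContinuous d).ae_le S.ae_bounds
  unfold muZero
  have hi : Integrable μ ((cellMeasure d).prod (cellMeasure d)) := by
    refine (integrable_const μp).mono'
      (S.aemeasurable.aestronglyMeasurable.mono_ac (cell_prod_absolutelyContinuous d)) ?_
    filter_upwards [hb] with p hp
    rw [Real.norm_of_nonneg (S.pos.le.trans hp.1)]
    exact hp.2
  constructor
  · have := integral_mono_ae (integrable_const μm) hi (hb.mono fun p hp => hp.1)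
    simpa using this
  · have := integral_mono_ae hi (integrable_const μp) (hb.mono fun p hp => hp.2)
    simpa using this

lemma aestronglyMeasurable_shear (S : Setting d α μm μp μ) :
    AEStronglyMeasurable (fun p : Eu d × Eu d => μ (p.1, p.1 + p.2)) (pairMeasure d) :=
  S.aemeasurable.aestronglyMeasurable.comp_measurePreserving (measurePreserving_shear d)

lemma ae_bounds_shear (S : Setting d α μm μp μ) :
    ∀ᵐ p ∂(pairMeasure d), μm ≤ μ (p.1, p.1 + p.2) ∧ μ (p.1, p.1 + p.2) ≤ μp :=
  (measurePreserving_shear d).quasiMeasurePreserving.ae S.ae_bounds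

lemma ae_periodic (S : Setting d α μm μp μ) :
    ∀ᵐ p ∂(pairMeasure d), ∀ n : Fin d → ℤ, μ (p.1, p.2 + latticeVec n) = μ p := by
  refine ae_all_iff.2 fun n => ae_pair ?_
  have h := S.coeff.periodic 0 n
  have h0 : (latticeVec 0 : Eu d) = 0 := by ext i; simp [latticeVec]
  simpa only [h0, add_zero] using h

lemma ae_fractVec_snd (S : Setting d α μm μp μ) :
    ∀ᵐ p ∂(pairMeasure d), μ (p.1, fractVec p.2) = μ p := by
  filter_upwards [S.ae_periodic] with p hp
  have h := hp (fun i => -⌊p.2 i⌋)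
  rw [← h, fractVec_eq]
  congr 2
  ext i
  simp [latticeVec, sub_eq_add_neg]

/-- Periodicity of `μ` in the second variable passes to `μ_*`. Integrating `μ(x,x+z)` over `z` in
the cell gives, for fixed `x`, the integral of `μ(x,·)` by translation invariance, so the mean
cancels `μ⁰`. Both terms of `μ_*` lie in `[μm, μp]`, hence the bound. -/
lemma isMeanZero_muStar (S : Setting d α μm μp μ) : IsMeanZero (muStar μ) μp where
  aesm := by
    rw [muStar_eq]
    refine AEStronglyMeasurable.sub ?_ aestronglyMeasurable_const
    exact (S.aestronglyMeasurable_shear.prod_swap).integral_prod_right'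
  bound := by
    have hz := S.muZero_bounds
    filter_upwards [ae_ae_swap S.ae_bounds_shear,
      (S.aestronglyMeasurable_shear.prod_swap).prodMk_left] with z h1 h3
    have h3' : AEStronglyMeasurable (fun x => μ (x, x + z)) (cellMeasure d) := h3
    have hi : Integrable (fun x => μ (x, x + z)) (cellMeasure d) := by
      refine (integrable_const μp).mono' h3' ?_
      filter_upwards [h1] with x hx
      rw [Real.norm_of_nonneg (S.pos.le.trans hx.1)]
      exact hx.2
    have h4 := integral_mono_ae (integrable_const μm) hi (h1.mono fun p hp => hp.1)
    have h5 := integral_mono_ae hi (integrable_const μp) (h1.mono fun p hp => hp.2)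
    rw [integral_const, probReal_univ, one_smul] at h4 h5
    have := S.pos
    rw [muStar_eq]
    rw [abs_le]
    constructor <;> linarith [hz.1, hz.2]
  periodic := by
    filter_upwards [ae_ae_swap
      ((measurePreserving_shear d).quasiMeasurePreserving.ae S.ae_periodic)] with z hz
    rw [muStar, muStar]
    congr 1
    refine integral_congr_ae ?_
    filter_upwards [hz] with x hx
    have h := hx (fun i => -⌊z i⌋)
    rw [add_comm z, ← h]
    congr 2
    rw [fractVec_eq]
    ext i
    simp only [PiLp.add_apply, PiLp.sub_apply, latticeVec, Int.cast_neg]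
    ring
  mean := by
    have hac := cell_prod_absolutelyContinuous d
    have hb := hac.ae_le S.ae_bounds_shear
    have hi : Integrable (fun p : Eu d × Eu d => μ (p.1, p.1 + p.2))
        ((cellMeasure d).prod (cellMeasure d)) := by
      refine (integrable_const μp).mono' (S.aestronglyMeasurable_shear.mono_ac hac) ?_
      filter_upwards [hb] with p hp
      rw [Real.norm_of_nonneg (S.pos.le.trans hp.1)]
      exact hp.2
    have hiμ : Integrable μ ((cellMeasure d).prod (cellMeasure d)) := by
      refine (integrable_const μp).mono' (S.aemeasurable.aestronglyMeasurable.mono_ac hac) ?_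
      filter_upwards [hac.ae_le S.ae_bounds] with p hp
      rw [Real.norm_of_nonneg (S.pos.le.trans hp.1)]
      exact hp.2
    rw [muStar_eq]
    have hsw : Integrable (fun z => ∫ x, μ (x, x + z) ∂(cellMeasure d)) (cellMeasure d) :=
      hi.swap.integral_prod_left
    rw [integral_sub hsw (integrable_const _), integral_const, probReal_univ, one_smul, sub_eq_zero]
    have h1 := integral_prod_symm _ hi
    have h2 := integral_prod _ hi
    rw [← h1, h2, muZero, integral_prod _ hiμ]
    refine integral_congr_ae ?_
    have hp1 : ∀ᵐ p ∂((cellMeasure d).prod (cellMeasure d)),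
        μ (p.1, fractVec (p.1 + p.2)) = μ (p.1, p.1 + p.2) :=
      hac.ae_le ((measurePreserving_shear d).quasiMeasurePreserving.ae S.ae_fractVec_snd)
    filter_upwards [Measure.ae_ae_of_ae_prod hp1,
      (S.aemeasurable.aestronglyMeasurable.mono_ac hac).prodMk_left] with x hx hxm
    rw [← integral_comp_of_measurePreserving (measurePreserving_fractVec_add x) hxm]
    refine integral_congr_ae ?_
    filter_upwards [hx] with z hz
    rw [add_comm z x]
    exact hz.symm

/-- After the shear the integral over `x` replaces `μ` by `μ⁰ + μ_*(z)`. The mean part is computed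
exactly and the rest is expanded in `ξ`. -/
lemma norm_formMap_one_sq (S : Setting d α μm μp μ) (ξ : Eu d) :
    ‖S.formMap ξ S.one‖ ^ 2 = muZero μ * cZero d α * ‖ξ‖ ^ α +
      ((∑' n : Fin d → ℤ, ∫ z in (shiftedCell n : Set (Eu d)), muStar μ z * quadKernel α ξ z) +
        ∑' n : Fin d → ℤ, ∫ z in (shiftedCell n : Set (Eu d)), muStar μ z * remKernel α ξ z) := by
  have hα₁ := S.one_lt
  have hα₂ := S.lt_two
  have hm := S.isMeanZero_muStar
  set k : Eu d → ℝ := fun z => (1 - Real.cos (inner ℝ ξ z)) * radialKernel α z with hk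
  have hk0 : ∀ z, 0 ≤ k z := fun z =>
    mul_nonneg (sub_nonneg.2 (Real.cos_le_one _)) (radialKernel_nonneg _ _)
  have hki : Integrable k := integrable_one_sub_cos hα₁ hα₂ ξ
  have hkm : Measurable k := by fun_prop
  have hki2 : Integrable (fun p : Eu d × Eu d => k p.2) (pairMeasure d) :=
    hki.comp_snd (cellMeasure d)
  have hFi : Integrable (fun p : Eu d × Eu d => μ (p.1, p.1 + p.2) * k p.2) (pairMeasure d) := by
    refine hki2.bdd_mul (c := μp) S.aestronglyMeasurable_shear ?_
    filter_upwards [S.ae_bounds_shear] with p hp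
    rw [Real.norm_of_nonneg (S.pos.le.trans hp.1)]
    exact hp.2
  have hGm : AEStronglyMeasurable (fun p : Eu d × Eu d => μ p * k (p.2 - p.1)) (pairMeasure d) :=
    S.aemeasurable.aestronglyMeasurable.mul (Measurable.aestronglyMeasurable (by fun_prop))
  have hGi : Integrable (fun p : Eu d × Eu d => μ p * k (p.2 - p.1)) (pairMeasure d) := by
    rw [← (measurePreserving_shear d).integrable_comp hGm]
    simpa only [Function.comp_def, add_sub_cancel_left] using hFi
  have e1 : ‖S.formMap ξ S.one‖ ^ 2 = ∫ p, μ p * k (p.2 - p.1) ∂(pairMeasure d) := by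
    have h0 : 0 ≤ᵐ[pairMeasure d] fun p => μ p * k (p.2 - p.1) := by
      filter_upwards [S.ae_bounds] with p hp
      exact mul_nonneg (S.pos.le.trans hp.1) (hk0 _)
    have h : ENNReal.ofReal (‖S.formMap ξ S.one‖ ^ 2) =
        ENNReal.ofReal (∫ p, μ p * k (p.2 - p.1) ∂(pairMeasure d)) := by
      rw [S.ofReal_norm_formMap_sq, ofReal_integral_eq_lintegral_ofReal hGi h0]
      refine lintegral_congr_ae ?_
      filter_upwards [twistDiff_oneCell ξ, S.formWeight_sq] with p h3 h4
      have h5 : formFun α μ ξ (S.one : L2Cell d) p =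
          (formWeight α μ p : ℂ) * (1 - wave ξ (p.2 - p.1)) := by
        rw [formFun, ← h3]
        rfl
      rw [h5, ← ofReal_norm, ← ENNReal.ofReal_pow (norm_nonneg _), norm_mul, mul_pow,
        Complex.norm_real, Real.norm_eq_abs, sq_abs, h4, norm_one_sub_wave_sq, levyKernel_eq]
      congr 1
      simp only [hk]
      ring
    exact (ENNReal.ofReal_eq_ofReal_iff (sq_nonneg _) (integral_nonneg_of_ae h0)).1 h
  have e2 : ∫ p, μ p * k (p.2 - p.1) ∂(pairMeasure d) =
      ∫ z, (∫ x, μ (x, z + x) ∂(cellMeasure d)) * k z := by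
    rw [← integral_comp_of_measurePreserving (measurePreserving_shear d) hGm]
    simp only [add_sub_cancel_left]
    rw [pairMeasure, integral_prod_symm _ hFi]
    refine integral_congr_ae (ae_of_all _ fun z => ?_)
    simp only [integral_mul_const, add_comm z]
  have hsi : Integrable fun z => muStar μ z * k z :=
    hki.bdd_mul hm.aesm hm.bound
  have e3 : ∫ z, (∫ x, μ (x, z + x) ∂(cellMeasure d)) * k z =
      muZero μ * cZero d α * ‖ξ‖ ^ α + ∫ z, muStar μ z * k z := by
    rw [mul_assoc, ← integral_one_sub_cos hα₁ ξ, ← integral_const_mul,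
      ← integral_add (hki.const_mul _) hsi]
    refine integral_congr_ae (ae_of_all _ fun z => ?_)
    simp only [muStar, hk]
    ring
  -- Only the unsplit integrand is handled as an integral over `ℝ^d`; the quadratic part and the
  -- remainder are separated cell by cell, where each is integrable.
  rw [e1, e2, e3, ← (hasSum_shiftedCell hsi).tsum_eq,
    ← ((quadKernel_dominated hα₁ hα₂ ξ).summable hm).tsum_add
      ((remKernel_dominated hα₁ hα₂ ξ).summable hm)]
  congr 1
  refine tsum_congr fun n => ?_
  rw [← integral_add ((quadKernel_dominated hα₁ hα₂ ξ).cell hm n).1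
    ((remKernel_dominated hα₁ hα₂ ξ).cell hm n).1]
  refine integral_congr_ae (ae_of_all _ fun z => ?_)
  simp only [quadKernel, remKernel, hk]
  ring

end Setting

/-! ### The effective matrix -/

lemma inner_eq_sum {d : ℕ} (ξ z : Eu d) : (inner ℝ ξ z : ℝ) = ∑ k, ξ k * z k := by
  rw [PiLp.inner_apply]
  exact Finset.sum_congr rfl fun k _ => mul_comm _ _

namespace Setting

variable {d : ℕ} [NeZero d] {α μm μp : ℝ} {μ : Eu d × Eu d → ℝ}

/-- Polarization: the entries reduce to `quadKernel` at `e_j + e_k`, `e_j` and `e_k`, so their cell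
sums inherit convergence. -/
lemma muStar_entry_eq (α : ℝ) (μ : Eu d × Eu d → ℝ) (j k : Fin d) (z : Eu d) :
    muStar μ z * z j * z k / (2 * ‖z‖ ^ ((d : ℝ) + α)) =
      1 / 2 * (muStar μ z * quadKernel α (EuclideanSpace.single j 1 + EuclideanSpace.single k 1) z -
        muStar μ z * quadKernel α (EuclideanSpace.single j 1) z -
        muStar μ z * quadKernel α (EuclideanSpace.single k 1) z) := by
  simp only [quadKernel, radialKernel, inner_add_left, EuclideanSpace.inner_single_left,
    conj_trivial, one_mul]
  rw [div_eq_mul_inv, mul_inv]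
  ring

lemma integrableOn_muStar_entry (S : Setting d α μm μp μ) (j k : Fin d) (n : Fin d → ℤ) :
    IntegrableOn (fun z : Eu d => muStar μ z * z j * z k / (2 * ‖z‖ ^ ((d : ℝ) + α)))
      (shiftedCell n) := by
  simp_rw [muStar_entry_eq]
  have h : ∀ ζ : Eu d, IntegrableOn (fun z => muStar μ z * quadKernel α ζ z) (shiftedCell n) :=
    fun ζ => ((quadKernel_dominated S.one_lt S.lt_two ζ).cell S.isMeanZero_muStar n).1
  exact (((h _).sub (h _)).sub (h _)).const_mul _

lemma summable_muStar_entry (S : Setting d α μm μp μ) (j k : Fin d) :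
    Summable fun n : Fin d → ℤ =>
      ∫ z in shiftedCell n, muStar μ z * z j * z k / (2 * ‖z‖ ^ ((d : ℝ) + α)) := by
  have h : ∀ (ζ : Eu d) n, IntegrableOn (fun z => muStar μ z * quadKernel α ζ z) (shiftedCell n) :=
    fun ζ n => ((quadKernel_dominated S.one_lt S.lt_two ζ).cell S.isMeanZero_muStar n).1
  have hs : ∀ ζ : Eu d, Summable fun n : Fin d → ℤ =>
      ∫ z in (shiftedCell n : Set (Eu d)), muStar μ z * quadKernel α ζ z :=
    fun ζ => (quadKernel_dominated S.one_lt S.lt_two ζ).summable S.isMeanZero_muStar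
  refine ((((hs (EuclideanSpace.single j 1 + EuclideanSpace.single k 1)).sub
    (hs (EuclideanSpace.single j 1))).sub (hs (EuclideanSpace.single k 1))).mul_left
    (1 / 2)).congr fun n => ?_
  simp_rw [muStar_entry_eq]
  rw [integral_const_mul, ← integral_sub (h _ n) (h _ n)]
  exact congrArg _ (integral_sub ((h _ n).sub (h _ n)) (h _ n)).symm

lemma sum_muStar_entry (S : Setting d α μm μp μ) (ξ : Eu d) :
    ∑ j, ∑ k, (∑' n : Fin d → ℤ,
        ∫ z in shiftedCell n, muStar μ z * z j * z k / (2 * ‖z‖ ^ ((d : ℝ) + α))) * ξ k * ξ j =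
      ∑' n : Fin d → ℤ, ∫ z in (shiftedCell n : Set (Eu d)), muStar μ z * quadKernel α ξ z := by
  have hs : ∀ j k : Fin d, Summable fun n : Fin d → ℤ =>
      (∫ z in shiftedCell n, muStar μ z * z j * z k / (2 * ‖z‖ ^ ((d : ℝ) + α))) * ξ k * ξ j :=
    fun j k => ((S.summable_muStar_entry j k).mul_right _).mul_right _
  simp_rw [← tsum_mul_right]
  rw [Finset.sum_congr rfl fun j _ => (Summable.tsum_finsetSum fun k _ => hs j k).symm,
    ← Summable.tsum_finsetSum fun j _ => summable_sum fun k _ => hs j k]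
  refine tsum_congr fun n => ?_
  simp_rw [← integral_mul_const]
  have hi : ∀ j k : Fin d, Integrable (fun z : Eu d =>
      muStar μ z * z j * z k / (2 * ‖z‖ ^ ((d : ℝ) + α)) * ξ k * ξ j)
      (volume.restrict (shiftedCell n)) :=
    fun j k => ((S.integrableOn_muStar_entry j k n).mul_const _).mul_const _
  rw [Finset.sum_congr rfl fun j _ => (integral_finsetSum _ fun k _ => hi j k).symm,
    ← integral_finsetSum _ fun j _ => integrable_finsetSum _ fun k _ => hi j k]
  refine integral_congr_ae (ae_of_all _ fun z => ?_)
  simp only [quadKernel, radialKernel]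
  rw [inner_eq_sum, sq, Finset.sum_mul_sum, Finset.sum_div, Finset.sum_mul, Finset.mul_sum]
  refine Finset.sum_congr rfl fun j _ => ?_
  rw [Finset.sum_div, Finset.sum_mul, Finset.mul_sum]
  refine Finset.sum_congr rfl fun k _ => ?_
  rw [div_eq_mul_inv _ (2 * _), mul_inv]
  ring

lemma integral_entry_re (S : Setting d α μm μp μ) (j : Fin d) (w : perSobolev d (α / 2)) :
    Integrable (fun p : Eu d × Eu d => levyKernel α μ p * ((p.1 j - p.2 j) *
      (perExt (w : L2Cell d) p.1 - perExt (w : L2Cell d) p.2).re)) (pairMeasure d) ∧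
    ∫ p : Eu d × Eu d, levyKernel α μ p * ((p.1 j - p.2 j) *
      (perExt (w : L2Cell d) p.1 - perExt (w : L2Cell d) p.2).re) ∂(pairMeasure d) =
      (linForm α μ (EuclideanSpace.single j 1) (w : L2Cell d)).re := by
  have h := S.integrable_linIntegrand (EuclideanSpace.single j 1) w
  have e : (fun p => (linIntegrand α μ (EuclideanSpace.single j 1) (w : L2Cell d) p).re) =
      fun p : Eu d × Eu d => levyKernel α μ p * ((p.1 j - p.2 j) *
        (perExt (w : L2Cell d) p.1 - perExt (w : L2Cell d) p.2).re) := by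
    ext p
    rw [linIntegrand, Complex.re_ofReal_mul, Complex.re_ofReal_mul, Complex.conj_re, twistDiff,
      wave_zero_left, one_mul, EuclideanSpace.inner_single_left, conj_trivial, one_mul,
      PiLp.sub_apply]
  rw [← e]
  exact ⟨h.re, integral_re h⟩

/-- The corrector in the direction `ξ`, and the quadratic form of the effective matrix. -/
lemma exists_corrector (S : Setting d α μm μp μ) {v : Fin d → L2Cell d}
    (hv : ∀ k, IsCellSolution α μ k (v k)) (ξ : Eu d) :
    ∃ ψ : perSobolev d (α / 2), inner ℂ (oneCell d) (ψ : L2Cell d) = 0 ∧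
      (∀ η : perSobolev d (α / 2), linForm α μ ξ (η : L2Cell d) =
        -(2 * inner ℂ (S.formMap 0 η) (S.formMap 0 ψ))) ∧
      quadForm (gZero α μ v) ξ = -‖S.formMap 0 ψ‖ ^ 2 +
        ∑' n : Fin d → ℤ, ∫ z in (shiftedCell n : Set (Eu d)), muStar μ z * quadKernel α ξ z := by
  choose hmem hmean hsol using fun k => (S.cellSolution_iff k (v k)).1 (hv k)
  set w : Fin d → perSobolev d (α / 2) := fun k => ⟨v k, hmem k⟩
  set ψ : perSobolev d (α / 2) := ∑ k, (ξ k : ℂ) • w k with hψ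
  have hψ2 : ∀ η : perSobolev d (α / 2), linForm α μ ξ (η : L2Cell d) =
      -(2 * inner ℂ (S.formMap 0 η) (S.formMap 0 ψ)) := fun η => by
    rw [S.sum_linForm, hψ, map_sum, inner_sum, Finset.mul_sum, ← Finset.sum_neg_distrib]
    refine Finset.sum_congr rfl fun k _ => ?_
    rw [map_smul, inner_smul_right]
    linear_combination (ξ k : ℂ) * hsol k η
  refine ⟨ψ, ?_, hψ2, ?_⟩
  · rw [hψ, Submodule.coe_sum, inner_sum]
    refine Finset.sum_eq_zero fun k _ => ?_
    rw [Submodule.coe_smul, inner_smul_right]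
    change _ * inner ℂ (oneCell d) (v k) = 0
    rw [hmean, mul_zero]
  · have h1 : ∀ j k, gZero α μ v j k =
        1 / 4 * ((linForm α μ (EuclideanSpace.single j 1) (v k)).re +
          (linForm α μ (EuclideanSpace.single k 1) (v j)).re) +
        ∑' n : Fin d → ℤ,
          ∫ z in shiftedCell n, muStar μ z * z j * z k / (2 * ‖z‖ ^ ((d : ℝ) + α)) := fun j k => by
      have h2 := S.integral_entry_re j (w k)
      have h3 := S.integral_entry_re k (w j)
      rw [gZero, Matrix.of_apply, ← h2.2, ← h3.2, ← integral_add h2.1 h3.1]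
      simp only [mul_add]
      rfl
    -- The functional is linear in its direction and conjugate linear in its argument, so the double
    -- sum is its value at `ξ` and `ψ`; the corrector equation then evaluates it as `-2‖T(0)ψ‖²`.
    have h4 : ∑ j, ∑ k, ξ k * ξ j * (linForm α μ (EuclideanSpace.single j 1) (v k)).re =
        (linForm α μ ξ (ψ : L2Cell d)).re := by
      have h5 : linForm α μ ξ (ψ : L2Cell d) =
          ∑ k, (ξ k : ℂ) * linForm α μ ξ (v k) := by
        have h6 : S.linFunctional ξ ψ = ∑ k, (ξ k : ℂ) * S.linFunctional ξ (w k) := by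
          rw [hψ, map_sum]
          exact Finset.sum_congr rfl fun k _ => by rw [map_smul, smul_eq_mul]
        have h7 := congrArg (starRingEnd ℂ) h6
        refine (Complex.conj_conj _).symm.trans ((h7.trans (map_sum (starRingEnd ℂ) _ _)).trans
          (Finset.sum_congr rfl fun k _ => ?_))
        rw [map_mul, Complex.conj_ofReal]
        exact congrArg _ (Complex.conj_conj _)
      rw [h5, Finset.sum_comm, Complex.re_sum]
      refine Finset.sum_congr rfl fun k _ => ?_
      have h8 := S.sum_linForm ξ (w k)
      rw [Complex.re_ofReal_mul, h8, Complex.re_sum, Finset.mul_sum]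
      refine Finset.sum_congr rfl fun j _ => ?_
      rw [Complex.re_ofReal_mul, mul_assoc]
    have h9 : ∑ j, ∑ k, ξ k * ξ j * (linForm α μ (EuclideanSpace.single k 1) (v j)).re =
        (linForm α μ ξ (ψ : L2Cell d)).re := by
      rw [← h4, Finset.sum_comm]
      exact Finset.sum_congr rfl fun j _ => Finset.sum_congr rfl fun k _ => by
        rw [mul_comm (ξ j)]
    have h10 : (linForm α μ ξ (ψ : L2Cell d)).re = -(2 * ‖S.formMap 0 ψ‖ ^ 2) := by
      rw [hψ2, Complex.neg_re, ← Complex.ofReal_ofNat, Complex.re_ofReal_mul]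
      exact congrArg (fun t => -(2 * t)) (inner_self_eq_norm_sq (𝕜 := ℂ) _)
    rw [← S.sum_muStar_entry ξ, quadForm]
    have h11 : -‖S.formMap 0 ψ‖ ^ 2 = 1 / 4 * ((linForm α μ ξ (ψ : L2Cell d)).re +
        (linForm α μ ξ (ψ : L2Cell d)).re) := by
      rw [h10]
      ring
    rw [h11]
    nth_rw 1 [← h4]
    rw [← h9, ← Finset.sum_add_distrib, Finset.mul_sum, ← Finset.sum_add_distrib]
    refine Finset.sum_congr rfl fun j _ => ?_
    rw [← Finset.sum_add_distrib, Finset.mul_sum, ← Finset.sum_add_distrib]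
    refine Finset.sum_congr rfl fun k _ => ?_
    rw [h1]
    ring

/-! ### Bounds for the corrector and for the threshold denominator -/

lemma dZero_pos (S : Setting d α μm μp μ) : 0 < dZero d α μm := by
  have hc := cZero_pos (d := d) S.one_lt S.lt_two
  have := S.pos
  have := Real.pi_pos
  unfold dZero
  positivity

lemma norm_le_of_mean_zero (S : Setting d α μm μp μ) {ξ : Eu d} (hξ : ‖ξ‖ ≤ Real.pi)
    (u : perSobolev d (α / 2)) (hu : inner ℂ (oneCell d) (u : L2Cell d) = 0) :
    ‖(u : L2Cell d)‖ ≤ ‖S.formMap ξ u‖ / √(dZero d α μm) := by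
  rw [le_div_iff₀ (Real.sqrt_pos.2 S.dZero_pos)]
  refine abs_le_of_sq_le_sq' ?_ (norm_nonneg _) |>.2
  rw [mul_pow, Real.sq_sqrt S.dZero_pos.le, mul_comm]
  exact S.dZero_mul_le hξ u hu

/-- The left side is at most `2Xμp(A+B)²`, where `X = 3 + 3μp/D`, `A + B` is `cThree` and `D` is
`dZero`. Written as `X(3μp/D)·(A+B)²/μp·(3μp/D)·(2D²/9)`, this is dominated factor by factor by
`cSeven`. -/
lemma le_cSeven (S : Setting d α μm μp μ) :
    (√(μp * (sphereArea d / (2 * (2 - α)))) +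
      μp * (sphereArea d / (α - 1)) / √(dZero d α μm)) ^ 2 ≤ cSeven d α μm μp := by
  have hD := S.dZero_pos
  have hp := S.upper_pos
  have hα1 : 0 < α - 1 := by linarith [S.one_lt]
  have hα2 : 0 < 2 - α := by linarith [S.lt_two]
  have hω := sphereArea_pos d
  rw [cSeven, cThree]
  set D := dZero d α μm
  set A := √(sphereArea d / (2 * (2 - α)))
  set B := sphereArea d / (α - 1)
  have hA : 0 ≤ A := Real.sqrt_nonneg _
  have hB : 0 < B := by positivity
  set X := 3 + 3 * μp / D with hX
  have hX0 : 3 * μp / D ≤ X := by linarith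
  have ht : 0 < μp / D := by positivity
  have htX : 0 < 3 * μp / D := by positivity
  have hpi := Real.pi_pos
  have h1 : (√(μp * (sphereArea d / (2 * (2 - α)))) + μp * B / √D) ^ 2 ≤
      2 * X * μp * (A + B) ^ 2 := by
    rw [Real.sqrt_mul hp.le]
    have hs : μp / √D = √μp * √(μp / D) := by
      rw [Real.sqrt_div hp.le, ← mul_div_assoc, Real.mul_self_sqrt hp.le]
    have e : √μp * A + μp * B / √D = √μp * (A + √(μp / D) * B) := by
      rw [mul_div_right_comm, hs]
      ring
    rw [e, mul_pow, Real.sq_sqrt hp.le]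
    have hq : √(μp / D) ^ 2 = μp / D := Real.sq_sqrt ht.le
    have hq0 := Real.sqrt_nonneg (μp / D)
    have hXe : X = 3 + 3 * (μp / D) := by rw [hX, mul_div_assoc]
    have h2 : (A + √(μp / D) * B) ^ 2 ≤ 2 * X * (A + B) ^ 2 := by
      have h3 : A + √(μp / D) * B ≤ (1 + √(μp / D)) * (A + B) := by nlinarith
      have h4 : (1 + √(μp / D)) ^ 2 ≤ 2 * X := by
        rw [hXe]
        nlinarith [sq_nonneg (√(μp / D) - 1)]
      calc _ ≤ ((1 + √(μp / D)) * (A + B)) ^ 2 := by gcongr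
        _ ≤ _ := by
          rw [mul_pow]
          gcongr
    calc _ ≤ μp * (2 * X * (A + B) ^ 2) := by gcongr
      _ = _ := by ring
  refine h1.trans ?_
  have hX3 : 0 < X := htX.trans_le hX0
  have f1 : X * (3 * μp / D) ≤ X ^ 2 := by
    rw [sq]
    gcongr
  have f2 : 3 * μp / D ≤ 1 + (μp + 2 * D / 3) * X / μp := by
    refine hX0.trans ?_
    have : (μp + 2 * D / 3) * X / μp = X + 2 * D / 3 * X / μp := by
      field_simp
    rw [this]
    have : 0 ≤ 2 * D / 3 * X / μp := by positivity
    linarith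
  have f3 : 2 * D ^ 2 / 9 ≤ D * (2 * Real.pi + 2) / 3 * D / (3 * Real.pi) := by
    rw [div_le_div_iff₀ (by norm_num) (by positivity)]
    nlinarith [sq_nonneg D]
  calc 2 * X * μp * (A + B) ^ 2 =
      X * (3 * μp / D) * (A + B) ^ 2 / μp * (3 * μp / D) * (2 * D ^ 2 / 9) := by
        field_simp
        ring
    _ ≤ _ := by gcongr

/-- Test the corrector equation with `ψ` itself, bound `‖ψ‖` by the Poincaré inequality and cancel
one factor `‖T(0)ψ‖`. -/
lemma norm_corrector_sq_le (S : Setting d α μm μp μ) {ξ : Eu d} {ψ : perSobolev d (α / 2)}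
    (h0 : inner ℂ (oneCell d) (ψ : L2Cell d) = 0)
    (h : linForm α μ ξ (ψ : L2Cell d) = -(2 * inner ℂ (S.formMap 0 ψ) (S.formMap 0 ψ))) :
    ‖S.formMap 0 ψ‖ ^ 2 ≤ cSeven d α μm μp * ‖ξ‖ ^ 2 := by
  have h1 := S.norm_linForm_le ξ ψ
  have h2 := S.norm_le_of_mean_zero (ξ := 0) (by simpa using Real.pi_pos.le) ψ h0
  have hα1 : 0 < α - 1 := by linarith [S.one_lt]
  have hω := sphereArea_pos d
  have hp := S.upper_pos
  rw [h, inner_self_eq_norm_sq_to_K, norm_neg, norm_mul, norm_pow] at h1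
  have e : ‖(2 : ℂ)‖ * ‖((‖S.formMap 0 ψ‖ : ℝ) : ℂ)‖ ^ 2 = 2 * ‖S.formMap 0 ψ‖ ^ 2 := by
    rw [Complex.norm_real, norm_norm]
    norm_num
  have h1' := e.symm.trans_le h1
  set T := ‖S.formMap 0 ψ‖
  have hT : 0 ≤ T := norm_nonneg _
  set b := μp * (sphereArea d / (α - 1)) with hb
  have hb0 : 0 ≤ b := by positivity
  have h3 : T ^ 2 ≤ ‖ξ‖ * (√(μp * (sphereArea d / (2 * (2 - α)))) + b / √(dZero d α μm)) * T := by
    have : b * ‖(ψ : L2Cell d)‖ ≤ b * (T / √(dZero d α μm)) := by gcongr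
    calc T ^ 2 ≤ ‖ξ‖ * (√(μp * (sphereArea d / (2 * (2 - α)))) * T + b * ‖(ψ : L2Cell d)‖) := by
          linarith
      _ ≤ ‖ξ‖ * (√(μp * (sphereArea d / (2 * (2 - α)))) * T + b * (T / √(dZero d α μm))) := by
          gcongr
      _ = _ := by ring
  have h4 : T ≤ ‖ξ‖ * (√(μp * (sphereArea d / (2 * (2 - α)))) + b / √(dZero d α μm)) := by
    rcases hT.eq_or_lt with h | h
    · rw [← h]
      positivity
    · rw [sq] at h3
      exact le_of_mul_le_mul_right h3 h
  calc T ^ 2 ≤ (‖ξ‖ * (√(μp * (sphereArea d / (2 * (2 - α)))) + b / √(dZero d α μm))) ^ 2 := by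
        gcongr
    _ ≤ _ := by
        rw [mul_pow, mul_comm]
        gcongr
        exact S.le_cSeven

lemma cTwelve_pos (S : Setting d α μm μp μ) :
    0 < cTwelve d α μm μp ∧ 0 ≤ cSeven d α μm μp ∧ 0 ≤ cFour d α * μp := by
  have h7 : 0 ≤ cSeven d α μm μp := (sq_nonneg _).trans S.le_cSeven
  have hα1 : 0 < α - 1 := by linarith [S.one_lt]
  have hα2 : 0 < 2 - α := by linarith [S.lt_two]
  have hω := sphereArea_pos d
  have hR := bigR_pos (d := d) S.one_lt
  have hp := S.upper_pos
  have hα := S.one_lt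
  have h4 : 0 < cFour d α * μp := by
    unfold cFour
    positivity
  refine ⟨?_, h7, h4.le⟩
  unfold cTwelve
  positivity

/-- Write `|ξ|² = |ξ|^{2-α}|ξ|^α`; the second entry of the minimum bounds the first factor, and the
first entry is at most `π`. -/
lemma deltaStar_spec (S : Setting d α μm μp μ) {ξ : Eu d} (hξ : ‖ξ‖ ≤ deltaStar α μm μp μ) :
    ‖ξ‖ ≤ Real.pi ∧
      cTwelve d α μm μp * ‖ξ‖ ^ 2 ≤ muZero μ * cZero d α / 2 * ‖ξ‖ ^ α := by
  have hα1 := S.one_lt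
  have hα2 : 0 < 2 - α := by linarith [S.lt_two]
  have hp := S.upper_pos
  have hm := S.pos
  have hc := cZero_pos (d := d) S.one_lt S.lt_two
  have hμ0 : 0 < muZero μ := hm.trans_le S.muZero_bounds.1
  have hC := S.cTwelve_pos.1
  constructor
  · refine hξ.trans ((min_le_left _ _).trans ?_)
    unfold deltaZero
    have h1 : (μm / (3 * μp)) ^ (1 / α) ≤ 1 := by
      refine Real.rpow_le_one (by positivity) ?_ (by positivity)
      rw [div_le_one (by positivity)]
      linarith [S.le_upper]
    nlinarith [Real.pi_pos]
  · have h1 := hξ.trans (min_le_right _ _)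
    have h2 : ‖ξ‖ ^ (2 - α) ≤ muZero μ * cZero d α / (2 * cTwelve d α μm μp) := by
      calc ‖ξ‖ ^ (2 - α) ≤
          ((muZero μ * cZero d α / (2 * cTwelve d α μm μp)) ^ (1 / (2 - α))) ^ (2 - α) := by
            gcongr
        _ = _ := by
            rw [← Real.rpow_mul (by positivity), one_div_mul_cancel hα2.ne', Real.rpow_one]
    rw [le_div_iff₀ (by positivity)] at h2
    have h3 : ‖ξ‖ ^ 2 = ‖ξ‖ ^ (2 - α) * ‖ξ‖ ^ α := by
      rw [← Real.rpow_add_of_nonneg (norm_nonneg _) hα2.le (by linarith), sub_add_cancel,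
        Real.rpow_two]
    rw [h3]
    have h4 : 0 ≤ ‖ξ‖ ^ α := by positivity
    nlinarith

/-- Lower bound for the denominator of the threshold approximation. -/
lemma le_thresholdDenom (S : Setting d α μm μp μ) {v : Fin d → L2Cell d}
    (hv : ∀ k, IsCellSolution α μ k (v k)) {ξ : Eu d} (hξ : ‖ξ‖ ≤ deltaStar α μm μp μ) (ε : ℝ) :
    3 / 8 * (μm * cZero d α) * ‖ξ‖ ^ α + ε ^ α ≤ thresholdDenom α μ v ξ ε := by
  obtain ⟨ψ, h0, h1, h2⟩ := S.exists_corrector hv ξ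
  have h3 := S.norm_corrector_sq_le h0 (h1 ψ)
  have h4 := abs_tsum_quadKernel_le S.one_lt S.lt_two ξ S.isMeanZero_muStar
  have h5 := (S.deltaStar_spec hξ).2
  have h6 := neg_le_of_abs_le h4
  have hd : (1 : ℝ) ≤ d := by exact_mod_cast NeZero.one_le
  have hC := S.cTwelve_pos
  have hc := cZero_pos (d := d) S.one_lt S.lt_two
  -- Enlarging the corrector bound by `5/4` gives `⟨g⁰ξ,ξ⟩ ≥ -(5/4)C₁₂|ξ|²`, which is at least
  -- `-(5/8)μ⁰c₀|ξ|^α` by the choice of `δ_*`; thus `3/8` of the main term survives.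
  have h7 : cSeven d α μm μp ≤ 5 / 4 * (d * cSeven d α μm μp) := by nlinarith [hC.2.1]
  have h8 : 0 ≤ ‖ξ‖ ^ 2 := sq_nonneg _
  have h9 : 0 ≤ cZero d α * ‖ξ‖ ^ α := by positivity
  have h10 := mul_le_mul_of_nonneg_right h7 h8
  have h11 := mul_le_mul_of_nonneg_right S.muZero_bounds.1 h9
  rw [thresholdDenom, h2]
  rw [cTwelve] at h5
  nlinarith

end Setting

/-! ### Approximation of the resolvent near the threshold -/

section Abstract

variable {H G : Type*} [NormedAddCommGroup H] [InnerProductSpace ℂ H] [NormedAddCommGroup G]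
  [InnerProductSpace ℂ G] {V : Submodule ℂ H}

/-- The difference of two forms on a pair of elements. -/
lemma norm_inner_sub_inner_le (x x' y y' : G) :
    ‖inner ℂ x y - inner ℂ x' y'‖ ≤ ‖x - x'‖ * ‖y‖ + ‖x'‖ * ‖y - y'‖ := by
  have e : (inner ℂ x y - inner ℂ x' y' : ℂ) = inner ℂ (x - x') y + inner ℂ x' (y - y') := by
    rw [inner_sub_left, inner_sub_right]
    ring
  rw [e]
  exact (norm_add_le _ _).trans (add_le_add (norm_inner_le_norm _ _) (norm_inner_le_norm _ _))

set_option maxHeartbeats 1000000 in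
/-- The form `T` is compared with `T₀`, for which `one` is in the kernel, up to the corrector `ψ`.
The numbers `a`, `b` and `s` stand for `s^α`, `s^{α/2}` and `s`. -/
lemma norm_resolvent_sub_le {T T₀ : V →ₗ[ℂ] G} {one ψ u : V} {f : H} {K s a b e D t : ℝ}
    (hK : 1 ≤ K) (hs : 0 ≤ s) (ha : 0 ≤ a) (hb : 0 ≤ b) (he : 0 < e)
    (hsK : s ≤ K) (hbK : b ≤ K) (hsb : s * b ≤ K * a) (has : a ≤ K * s)
    (hone : ‖(one : H)‖ = 1) (hψ : inner ℂ (one : H) (ψ : H) = 0)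
    (hρ : ∀ η : V, ‖inner ℂ (T η) (T one) + inner ℂ (T₀ η) (T₀ ψ)‖ ≤ K * a * ‖(η : H)‖)
    (hψs : ‖T₀ ψ‖ ≤ K * s) (hψn : ‖(ψ : H)‖ ≤ K ^ 2 * s)
    (hmean : ∀ η : V, inner ℂ (one : H) (η : H) = 0 → ‖(η : H)‖ ≤ K * ‖T η‖)
    (hdiff : ∀ η : V, ‖T η - T₀ η‖ ≤ K * b * ‖(η : H)‖)
    (hu : ∀ v : V, inner ℂ (T v) (T u) + e * inner ℂ (v : H) (u : H) = inner ℂ (v : H) f)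
    (huf : ‖(u : H)‖ * (a + e) ≤ K * ‖f‖)
    (hD : a + e ≤ K * D) (hDe : |‖T one‖ ^ 2 - ‖T₀ ψ‖ ^ 2 + e - D| ≤ K * (s * a))
    (ht : 1 ≤ t) (hst : s ≤ t * (a + e)) :
    ‖(u : H) - ((D⁻¹ : ℝ) : ℂ) • inner ℂ (one : H) f • (one : H)‖ ≤ 27 * K ^ 13 * t * ‖f‖ := by
  have hK0 : 0 < K := by linarith
  have hae : 0 < a + e := by linarith
  have hD0 : 0 < D := by
    by_contra h
    nlinarith
  have hpow : ∀ {m n : ℕ}, m ≤ n → K ^ m ≤ K ^ n := fun h => pow_le_pow_right₀ hK h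
  set c : ℂ := inner ℂ (one : H) (u : H) with hc
  -- The remainder has zero mean, so its energy controls its norm uniformly in `ξ`.
  set r : V := u - c • one - c • ψ with hr
  have hcu : ‖c‖ ≤ ‖(u : H)‖ := by
    refine (norm_inner_le_norm _ _).trans (le_of_eq ?_)
    rw [hone, one_mul]
  have hcf : ‖c‖ * (a + e) ≤ K * ‖f‖ :=
    (mul_le_mul_of_nonneg_right hcu hae.le).trans huf
  have hoo : inner ℂ (one : H) (one : H) = 1 := by
    rw [inner_self_eq_norm_sq_to_K, hone]
    simp
  have hr0 : inner ℂ (one : H) (r : H) = 0 := by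
    rw [hr, Submodule.coe_sub, Submodule.coe_sub, Submodule.coe_smul, Submodule.coe_smul,
      inner_sub_right, inner_sub_right, inner_smul_right, inner_smul_right, hψ, hoo, ← hc]
    ring
  have hr0' : inner ℂ (r : H) (one : H) = 0 := inner_eq_zero_symm.1 hr0
  have hur : u = c • one + c • ψ + r := by rw [hr]; abel
  have huH : (u : H) = c • (one : H) + c • (ψ : H) + (r : H) := congrArg Subtype.val hur
  have hTu : T u = c • T one + c • T ψ + T r := by
    conv_lhs => rw [hur]
    rw [map_add, map_add, map_smul, map_smul]
  have hrT := hmean r hr0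
  set x := ‖T r‖ with hx
  have hx0 : 0 ≤ x := norm_nonneg _
  set F := ‖f‖ with hF
  have hF0 : 0 ≤ F := norm_nonneg _
  have hc0 : 0 ≤ ‖c‖ := norm_nonneg _
  have hTψ : ‖T ψ‖ ≤ 2 * K ^ 4 * s := by
    have h1 := norm_add_le (T ψ - T₀ ψ) (T₀ ψ)
    rw [sub_add_cancel] at h1
    have h2 : K * b * ‖(ψ : H)‖ ≤ K * K * (K ^ 2 * s) := by gcongr
    have h3 := mul_le_mul_of_nonneg_right (hpow (show 1 ≤ 4 by norm_num)) hs
    linarith [hdiff ψ]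
  have hT₀r : ‖T₀ r‖ ≤ 2 * K ^ 3 * x := by
    have h1 := norm_sub_le (T r) (T r - T₀ r)
    rw [sub_sub_cancel] at h1
    have h2 : K * b * ‖(r : H)‖ ≤ K * K * (K * x) := by gcongr
    have h3 := mul_le_mul_of_nonneg_right (hpow (show 0 ≤ 3 by norm_num)) hx0
    linarith [hdiff r]
  -- Replacing `T` by `T₀` costs a factor `b`, and the corrector contributes `s`; the hypothesis `sb
  -- ≤ Ka` brings the product to the order of `a`.
  have hDr : ‖inner ℂ (T r) (T ψ) - inner ℂ (T₀ r) (T₀ ψ)‖ ≤ 4 * K ^ 7 * (a * x) := by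
    refine (norm_inner_sub_inner_le _ _ _ _).trans ?_
    calc ‖T r - T₀ r‖ * ‖T ψ‖ + ‖T₀ r‖ * ‖T ψ - T₀ ψ‖
        ≤ (K * b * (K * x)) * (2 * K ^ 4 * s) + (2 * K ^ 3 * x) * (K * b * (K ^ 2 * s)) := by
          gcongr
          · exact (hdiff r).trans (by gcongr)
          · exact (hdiff ψ).trans (by gcongr)
      _ = 4 * K ^ 6 * x * (s * b) := by ring
      _ ≤ 4 * K ^ 6 * x * (K * a) := by gcongr
      _ = _ := by ring
  -- Test with `r`. The corrector removes the coupling to `𝟏` of order `s`; what remains is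
  -- `‖c‖(a+e)`, which the a priori bound `hcf` turns into `O(F)`.
  have hxF : x ≤ 6 * K ^ 8 * F := by
    have h1 : ((x ^ 2 + e * ‖(r : H)‖ ^ 2 : ℝ) : ℂ) = inner ℂ (r : H) f -
        c * (inner ℂ (T r) (T one) + inner ℂ (T₀ r) (T₀ ψ)) -
        c * (inner ℂ (T r) (T ψ) - inner ℂ (T₀ r) (T₀ ψ)) - e * (c * inner ℂ (r : H) (ψ : H)) := by
      have h2 := hu r
      rw [hTu, huH, inner_add_right, inner_add_right, inner_add_right, inner_add_right,
        inner_smul_right, inner_smul_right, inner_smul_right, inner_smul_right, hr0',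
        inner_self_eq_norm_sq_to_K, inner_self_eq_norm_sq_to_K] at h2
      rw [← h2]
      push_cast
      simp only [Complex.coe_algebraMap]
      ring
    have h3 : x ^ 2 + e * ‖(r : H)‖ ^ 2 ≤ K * x * F + ‖c‖ * (K * a * (K * x)) +
        ‖c‖ * (4 * K ^ 7 * (a * x)) + e * (‖c‖ * (K * x * (K ^ 2 * s))) := by
      have h4 := congrArg norm h1
      rw [Complex.norm_real, Real.norm_of_nonneg (by positivity)] at h4
      rw [h4]
      refine (norm_sub_le _ _).trans (add_le_add ((norm_sub_le _ _).trans (add_le_add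
        ((norm_sub_le _ _).trans (add_le_add ?_ ?_)) ?_)) ?_)
      · exact (norm_inner_le_norm _ _).trans (by gcongr)
      · rw [norm_mul]
        gcongr
        exact (hρ r).trans (by gcongr)
      · rw [norm_mul]
        gcongr
      · rw [norm_mul, norm_mul, Complex.norm_real, Real.norm_of_nonneg he.le]
        gcongr
        exact (norm_inner_le_norm _ _).trans (by gcongr)
    have h5 : x * x ≤ 6 * K ^ 8 * F * x := by
      have h6 : ‖c‖ * (K * a * (K * x)) + ‖c‖ * (4 * K ^ 7 * (a * x)) +
          e * (‖c‖ * (K * x * (K ^ 2 * s))) ≤ 5 * K ^ 7 * x * (‖c‖ * (a + e)) := by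
        have p1 : ‖c‖ * (K * a * (K * x)) ≤ K ^ 7 * x * (‖c‖ * a) := by
          have := mul_le_mul_of_nonneg_right (hpow (show 2 ≤ 7 by norm_num))
            (by positivity : 0 ≤ x * (‖c‖ * a))
          linarith
        have p2 : e * (‖c‖ * (K * x * (K ^ 2 * s))) ≤ 5 * K ^ 7 * x * (‖c‖ * e) := by
          have q1 : e * (‖c‖ * (K * x * (K ^ 2 * s))) ≤ e * (‖c‖ * (K * x * (K ^ 2 * K))) := by
            gcongr
          have := mul_le_mul_of_nonneg_right (hpow (show 4 ≤ 7 by norm_num))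
            (by positivity : 0 ≤ x * (‖c‖ * e))
          have : 0 ≤ K ^ 7 * (x * (‖c‖ * e)) := by positivity
          linarith
        linarith
      have h7 : 5 * K ^ 7 * x * (‖c‖ * (a + e)) ≤ 5 * K ^ 7 * x * (K * F) := by gcongr
      have h8 := mul_le_mul_of_nonneg_right (hpow (show 1 ≤ 8 by norm_num))
            (by positivity : 0 ≤ x * F)
      have h9 : 0 ≤ e * ‖(r : H)‖ ^ 2 := by positivity
      linarith
    rcases hx0.eq_or_lt with h | h
    · rw [← h]
      positivity
    · exact le_of_mul_le_mul_right h5 h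
  have hrF : ‖(r : H)‖ ≤ 6 * K ^ 9 * F := by
    calc ‖(r : H)‖ ≤ K * (6 * K ^ 8 * F) := hrT.trans (by gcongr)
      _ = _ := by ring
  have hρ' : ∀ η : V, ‖inner ℂ (T one) (T η) + inner ℂ (T₀ ψ) (T₀ η)‖ ≤ K * a * ‖(η : H)‖ :=
    fun η => by
      have h := hρ η
      rwa [← RCLike.norm_conj, map_add, inner_conj_symm, inner_conj_symm] at h
  -- Test with `𝟏`. The corrector equation turns `(T𝟏, Tψ)` into `-‖T₀ψ‖²`, the Schur complement;
  -- the coupling to `r` is of order `s` because `T₀ψ` is.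
  have hc1 : ‖c * D - inner ℂ (one : H) f‖ ≤ 20 * K ^ 12 * s * F := by
    have h1 : c * D - inner ℂ (one : H) f =
        -(c * ((‖T one‖ ^ 2 - ‖T₀ ψ‖ ^ 2 + e - D : ℝ) : ℂ)) -
          c * (inner ℂ (T one) (T ψ) + inner ℂ (T₀ ψ) (T₀ ψ)) -
          (inner ℂ (T one) (T r) + inner ℂ (T₀ ψ) (T₀ r)) + inner ℂ (T₀ ψ) (T₀ r) := by
      have h2 := hu one
      rw [hTu, ← hc, inner_add_right, inner_add_right, inner_smul_right, inner_smul_right,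
        inner_self_eq_norm_sq_to_K] at h2
      rw [← h2, inner_self_eq_norm_sq_to_K]
      push_cast
      simp only [Complex.coe_algebraMap]
      ring
    rw [h1]
    have h3 : ‖c‖ * a ≤ K * F := by nlinarith
    calc _ ≤ ‖c‖ * (K * (s * a)) + ‖c‖ * (K * a * (K ^ 2 * s)) + K * a * (6 * K ^ 9 * F) +
          (K * s) * (2 * K ^ 3 * (6 * K ^ 8 * F)) := by
          refine (norm_add_le _ _).trans (add_le_add ((norm_sub_le _ _).trans (add_le_add
            ((norm_sub_le _ _).trans (add_le_add ?_ ?_)) ?_)) ?_)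
          · rw [norm_neg, norm_mul, Complex.norm_real, Real.norm_eq_abs]
            gcongr
          · rw [norm_mul]
            gcongr
            exact (hρ' ψ).trans (by gcongr)
          · exact (hρ' r).trans (by gcongr)
          · exact (norm_inner_le_norm _ _).trans (by gcongr; exact hT₀r.trans (by gcongr))
      _ = (K + K ^ 3) * s * (‖c‖ * a) + K * a * (6 * K ^ 9 * F) + 12 * K ^ 12 * s * F := by ring
      _ ≤ (K ^ 11 + K ^ 11) * s * (K * F) + K * (K * s) * (6 * K ^ 9 * F) + 12 * K ^ 12 * s * F := by
          gcongr
          · exact le_self_pow₀ hK (by norm_num)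
          · norm_num
      _ = 14 * K ^ 12 * s * F + 6 * K ^ 11 * s * F := by ring
      _ ≤ 14 * K ^ 12 * s * F + 6 * K ^ 12 * s * F := by
          gcongr
          norm_num
      _ = _ := by ring
  have hst' : s * F ≤ t * F * (a + e) := by nlinarith
  -- Dividing by `D` is affordable because `s ≤ t(a+e) ≤ tKD`.
  have hc2 : ‖c - ((D⁻¹ : ℝ) : ℂ) * inner ℂ (one : H) f‖ ≤ 20 * K ^ 13 * t * F := by
    have h1 : c - ((D⁻¹ : ℝ) : ℂ) * inner ℂ (one : H) f =
        ((D⁻¹ : ℝ) : ℂ) * (c * D - inner ℂ (one : H) f) := by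
      have : (D : ℂ) ≠ 0 := by exact_mod_cast hD0.ne'
      push_cast
      field_simp
    rw [h1, norm_mul, Complex.norm_real, Real.norm_of_nonneg (inv_pos.2 hD0).le, inv_mul_le_iff₀ hD0]
    calc _ ≤ 20 * K ^ 12 * (s * F) := by linarith
      _ ≤ 20 * K ^ 12 * (t * F * (K * D)) :=
          mul_le_mul_of_nonneg_left (hst'.trans (by gcongr)) (by positivity)
      _ = _ := by ring
  have hc3 : ‖c‖ * ‖(ψ : H)‖ ≤ K ^ 3 * t * F := by
    calc ‖c‖ * ‖(ψ : H)‖ ≤ ‖c‖ * (K ^ 2 * (t * (a + e))) := by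
          gcongr
          exact hψn.trans (by gcongr)
      _ = K ^ 2 * t * (‖c‖ * (a + e)) := by ring
      _ ≤ K ^ 2 * t * (K * F) := by gcongr
      _ = _ := by ring
  have e1 : (u : H) - ((D⁻¹ : ℝ) : ℂ) • inner ℂ (one : H) f • (one : H) =
      (c - ((D⁻¹ : ℝ) : ℂ) * inner ℂ (one : H) f) • (one : H) + c • (ψ : H) + (r : H) := by
    conv_lhs => rw [huH]
    rw [sub_smul, mul_smul]
    abel
  rw [e1]
  have htF : 0 ≤ t * F := by positivity
  calc _ ≤ ‖c - ((D⁻¹ : ℝ) : ℂ) * inner ℂ (one : H) f‖ * 1 + ‖c‖ * ‖(ψ : H)‖ + ‖(r : H)‖ := by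
        refine (norm_add_le _ _).trans (add_le_add ((norm_add_le _ _).trans (le_of_eq ?_)) le_rfl)
        rw [norm_smul, norm_smul, hone]
    _ ≤ 20 * K ^ 13 * t * F * 1 + K ^ 13 * (t * F) + 6 * K ^ 13 * (t * F) := by
        refine add_le_add (add_le_add (mul_le_mul_of_nonneg_right hc2 zero_le_one) ?_) ?_
        · refine hc3.trans ?_
          rw [mul_assoc]
          exact mul_le_mul_of_nonneg_right (hpow (by norm_num)) htF
        · refine hrF.trans ?_
          have h1 : F ≤ t * F := le_mul_of_one_le_left hF0 ht
          have h2 := hpow (show 9 ≤ 13 by norm_num)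
          exact mul_le_mul (by linarith) h1 hF0 (by positivity)
    _ = _ := by ring

end Abstract

lemma rpow_le_four {s β : ℝ} (hs : 0 ≤ s) (hs4 : s ≤ 4) (hβ : 0 ≤ β) (hβ1 : β ≤ 1) : s ^ β ≤ 4 :=
  calc s ^ β ≤ 4 ^ β := Real.rpow_le_rpow hs hs4 hβ
    _ ≤ 4 ^ (1 : ℝ) := Real.rpow_le_rpow_of_exponent_le (by norm_num) hβ1
    _ = 4 := Real.rpow_one 4

/-- If `s ≤ ε`, use `ε = ε^{1-α}ε^α`. Otherwise `s = s^{1-α}s^α`, and the negative exponent gives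
`s^{1-α} ≤ ε^{1-α}`. -/
lemma le_rpow_mul_add {s ε α : ℝ} (hs : 0 ≤ s) (hε : 0 < ε) (hα : 1 < α) :
    s ≤ ε ^ (1 - α) * (s ^ α + ε ^ α) := by
  have h0 : 0 < ε ^ (1 - α) := Real.rpow_pos_of_pos hε _
  have hsα : 0 ≤ s ^ α := Real.rpow_nonneg hs _
  have hεα : 0 < ε ^ α := Real.rpow_pos_of_pos hε _
  rcases le_total s ε with h | h
  · have e : ε ^ (1 - α) * ε ^ α = ε := by
      rw [← Real.rpow_add hε, sub_add_cancel, Real.rpow_one]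
    have : 0 ≤ ε ^ (1 - α) * s ^ α := by positivity
    linarith
  · have hs0 : 0 < s := hε.trans_le h
    have e : s ^ (1 - α) * s ^ α = s := by
      rw [← Real.rpow_add hs0, sub_add_cancel, Real.rpow_one]
    have h1 : s ^ (1 - α) ≤ ε ^ (1 - α) :=
      Real.rpow_le_rpow_of_nonpos hε h (by linarith)
    have h2 := mul_le_mul_of_nonneg_right h1 hsα
    have : 0 ≤ ε ^ (1 - α) * ε ^ α := by positivity
    linarith

/-- A common bound for all the constants that enter the approximation of the resolvent. -/
def commonConst (d : ℕ) [NeZero d] (α μm μp : ℝ) : ℝ :=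
  max 4 (4 + 4 * μp * quadLinMass d α + √(cSeven d α μm μp) + (√(dZero d α μm))⁻¹ +
    √(2 * μp * quadLinMass d α) + 3 / (μm * cZero d α) + μp * remConst d α)

namespace Setting

variable {d : ℕ} [NeZero d] {α μm μp : ℝ} {μ : Eu d × Eu d → ℝ}

lemma le_commonConst (S : Setting d α μm μp μ) :
    4 ≤ commonConst d α μm μp ∧ 4 * μp * quadLinMass d α ≤ commonConst d α μm μp ∧
      √(cSeven d α μm μp) ≤ commonConst d α μm μp ∧
      (√(dZero d α μm))⁻¹ ≤ commonConst d α μm μp ∧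
      √(2 * μp * quadLinMass d α) ≤ commonConst d α μm μp ∧
      3 / (μm * cZero d α) ≤ commonConst d α μm μp ∧
      μp * remConst d α ≤ commonConst d α μm μp := by
  have hp := S.upper_pos
  have hm := S.pos
  have hα := S.one_lt
  have hc := cZero_pos (d := d) S.one_lt S.lt_two
  have hQ := quadLinMass_nonneg d α
  have hR := bigR_pos (d := d) S.one_lt
  have h1 : 0 ≤ 4 * μp * quadLinMass d α := by positivity
  have h2 : 0 ≤ √(cSeven d α μm μp) := Real.sqrt_nonneg _
  have h3 : 0 ≤ (√(dZero d α μm))⁻¹ := by positivity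
  have h4 : 0 ≤ √(2 * μp * quadLinMass d α) := Real.sqrt_nonneg _
  have h5 : 0 ≤ 3 / (μm * cZero d α) := by positivity
  have h6 : 0 ≤ μp * remConst d α := by
    unfold remConst
    positivity
  unfold commonConst
  refine ⟨le_max_left _ _, ?_, ?_, ?_, ?_, ?_, ?_⟩ <;> refine le_trans ?_ (le_max_right _ _) <;>
    linarith

/-- The a priori bound for the resolvent. -/
lemma norm_mul_le_of_resolvent (S : Setting d α μm μp μ) {ξ : Eu d} (hξ : ‖ξ‖ ≤ Real.pi) {e : ℝ}
    {u : perSobolev d (α / 2)} {f : L2Cell d}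
    (hu : ∀ v : perSobolev d (α / 2), inner ℂ (S.formMap ξ v) (S.formMap ξ u) +
      e * inner ℂ (v : L2Cell d) (u : L2Cell d) = inner ℂ (v : L2Cell d) f) :
    ‖(u : L2Cell d)‖ * (μm * cZero d α * ‖ξ‖ ^ α + e) ≤ ‖f‖ := by
  have h1 := S.le_norm_formMap_sq_of_norm_le hξ u
  have h2 : ‖S.formMap ξ u‖ ^ 2 + e * ‖(u : L2Cell d)‖ ^ 2 ≤ ‖(u : L2Cell d)‖ * ‖f‖ := by
    have h3 := hu u
    rw [inner_self_eq_norm_sq_to_K, inner_self_eq_norm_sq_to_K] at h3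
    have h4 : ((‖S.formMap ξ u‖ ^ 2 + e * ‖(u : L2Cell d)‖ ^ 2 : ℝ) : ℂ) =
        inner ℂ (u : L2Cell d) f := by
      rw [← h3]
      push_cast
      rfl
    have h5 := congrArg norm h4
    rw [Complex.norm_real] at h5
    exact (le_abs_self _).trans (h5.le.trans (norm_inner_le_norm _ _))
  rcases (norm_nonneg (u : L2Cell d)).eq_or_lt with h | h
  · rw [← h, zero_mul]
    exact norm_nonneg f
  · refine le_of_mul_le_mul_left ?_ h
    linarith

lemma norm_resolvent_sub_le_of_le_one (S : Setting d α μm μp μ) {v : Fin d → L2Cell d}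
    (hv : ∀ k, IsCellSolution α μ k (v k)) {ξ : Eu d} (hξ : ‖ξ‖ ≤ deltaStar α μm μp μ) {ε : ℝ}
    (hε : 0 < ε) (hε1 : ε ≤ 1) {u : perSobolev d (α / 2)} {f : L2Cell d}
    (hu : ∀ v : perSobolev d (α / 2), inner ℂ (S.formMap ξ v) (S.formMap ξ u) +
      (ε ^ α : ℝ) * inner ℂ (v : L2Cell d) (u : L2Cell d) = inner ℂ (v : L2Cell d) f) :
    ‖(u : L2Cell d) - (((thresholdDenom α μ v ξ ε)⁻¹ : ℝ) : ℂ) • constProj d f‖ ≤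
      27 * commonConst d α μm μp ^ 13 * ε ^ (1 - α) * ‖f‖ := by
  obtain ⟨ψ₀, hmean, hψ, hquad⟩ := S.exists_corrector hv ξ
  obtain ⟨k1, k2, k3, k4, k5, k6, k7⟩ := S.le_commonConst
  have hα₁ := S.one_lt
  have hα₂ := S.lt_two
  have hp := S.upper_pos
  have hc := cZero_pos (d := d) hα₁ hα₂
  have hm := mul_pos S.pos hc
  have hQ := quadLinMass_nonneg d α
  have hd := Real.sqrt_pos.2 S.dZero_pos
  have hπ := (S.deltaStar_spec hξ).1
  have hs4 : ‖ξ‖ ≤ 4 := hπ.trans Real.pi_le_four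
  have hs0 := norm_nonneg ξ
  have he : 0 < ε ^ α := Real.rpow_pos_of_pos hε _
  have ha : 0 ≤ ‖ξ‖ ^ α := by positivity
  have hb : 0 ≤ ‖ξ‖ ^ (α / 2) := by positivity
  set K := commonConst d α μm μp
  have hK0 : 0 < K := by linarith
  have hbb : ‖ξ‖ ^ (α / 2) * ‖ξ‖ ^ (α / 2) = ‖ξ‖ ^ α := by
    rw [← Real.rpow_add_of_nonneg hs0 (by linarith) (by linarith), add_halves]
  have hm3 : 3 ≤ K * (μm * cZero d α) := (div_le_iff₀ hm).1 k6
  have hT₀ψ : ‖S.formMap 0 ψ₀‖ ≤ K * ‖ξ‖ := by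
    refine le_trans ?_ (mul_le_mul_of_nonneg_right k3 hs0)
    refine abs_le_of_sq_le_sq' ?_ (by positivity) |>.2
    rw [mul_pow, Real.sq_sqrt S.cTwelve_pos.2.1]
    exact S.norm_corrector_sq_le hmean (hψ ψ₀)
  have hmean' : ∀ {ζ : Eu d}, ‖ζ‖ ≤ Real.pi → ∀ η : perSobolev d (α / 2),
      inner ℂ (oneCell d) (η : L2Cell d) = 0 → ‖(η : L2Cell d)‖ ≤ K * ‖S.formMap ζ η‖ :=
    fun hζ η hη => by
      refine (S.norm_le_of_mean_zero hζ η hη).trans ?_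
      rw [div_eq_inv_mul]
      gcongr
  -- The linear part of the coupling is `(i/2)` times the functional and the corrector equation
  -- represents it as `-i(T(0)η, T(0)ψ₀)`; hence the factor `i` in the corrector.
  have hIψ : S.formMap 0 (Complex.I • ψ₀) = Complex.I • S.formMap 0 ψ₀ := map_smul _ _ _
  have hT : ‖S.formMap 0 (Complex.I • ψ₀)‖ = ‖S.formMap 0 ψ₀‖ := by
    rw [hIψ, norm_smul, Complex.norm_I, one_mul]
  rw [constProj_apply]
  refine norm_resolvent_sub_le (T := S.formMap ξ) (T₀ := S.formMap 0) (one := S.one)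
    (ψ := Complex.I • ψ₀) (K := K) (s := ‖ξ‖) (a := ‖ξ‖ ^ α) (b := ‖ξ‖ ^ (α / 2)) (e := ε ^ α)
    (by linarith) hs0 ha hb he (hs4.trans k1)
    ((rpow_le_four hs0 hs4 (by linarith) (by linarith)).trans k1) ?_ ?_ norm_oneCell ?_
    (fun η => ?_) ?_ ?_ (hmean' hπ) (fun η => ?_) hu ?_ ?_ ?_ ?_ (le_rpow_mul_add hs0 hε hα₁)
  · have h1 : ‖ξ‖ * ‖ξ‖ ^ (α / 2) = ‖ξ‖ ^ (1 - α / 2) * ‖ξ‖ ^ α := by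
      rw [← Real.rpow_add_of_nonneg hs0 (by linarith) (by linarith)]
      nth_rw 1 [← Real.rpow_one ‖ξ‖]
      rw [← Real.rpow_add_of_nonneg hs0 (by linarith) (by linarith)]
      congr 1
      ring
    rw [h1]
    gcongr
    exact (rpow_le_four hs0 hs4 (by linarith) (by linarith)).trans k1
  · have h1 : ‖ξ‖ ^ α = ‖ξ‖ ^ (α - 1) * ‖ξ‖ := by
      nth_rw 3 [← Real.rpow_one ‖ξ‖]
      rw [← Real.rpow_add_of_nonneg hs0 (by linarith) (by linarith), sub_add_cancel]
    rw [h1]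
    gcongr
    exact (rpow_le_four hs0 hs4 (by linarith) (by linarith)).trans k1
  · rw [Submodule.coe_smul, inner_smul_right]
    change Complex.I * inner ℂ (oneCell d) (ψ₀ : L2Cell d) = 0
    rw [hmean, mul_zero]
  -- By the corrector equation the sum of the two products is exactly the coupling minus its linear
  -- part.
  · have h1 := S.norm_form_one_sub_le ξ η
    have h2 : inner ℂ (S.formMap ξ η) (S.formMap ξ S.one) +
        inner ℂ (S.formMap 0 η) (S.formMap 0 (Complex.I • ψ₀)) =
        inner ℂ (S.formMap ξ η) (S.formMap ξ S.one) -
          Complex.I / 2 * linForm α μ ξ (η : L2Cell d) := by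
      rw [hψ η, hIψ, inner_smul_right]
      ring
    rw [h2]
    exact h1.trans (by gcongr)
  · rw [hT]
    exact hT₀ψ
  · have h1 := hmean' (ζ := 0) (by simpa using Real.pi_pos.le) ψ₀ hmean
    rw [Submodule.coe_smul, norm_smul, Complex.norm_I, one_mul]
    calc ‖(ψ₀ : L2Cell d)‖ ≤ K * (K * ‖ξ‖) := h1.trans (by gcongr)
      _ = _ := by ring
  · have h1 := S.norm_formMap_sub_sq_le ξ η
    have h2 : 0 ≤ √(2 * μp * quadLinMass d α) := Real.sqrt_nonneg _
    have h3 : ‖S.formMap ξ η - S.formMap 0 η‖ ≤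
        √(2 * μp * quadLinMass d α) * ‖ξ‖ ^ (α / 2) * ‖(η : L2Cell d)‖ := by
      refine abs_le_of_sq_le_sq' ?_ (by positivity) |>.2
      rw [mul_pow, mul_pow, Real.sq_sqrt (by positivity), sq (‖ξ‖ ^ (α / 2)), hbb]
      exact h1
    exact h3.trans (by gcongr)
  · have h1 := S.norm_mul_le_of_resolvent hπ hu
    have h2 : ‖ξ‖ ^ α + ε ^ α ≤ K * (μm * cZero d α * ‖ξ‖ ^ α + ε ^ α) := by
      have := mul_le_mul_of_nonneg_right hm3 ha
      have := mul_le_mul_of_nonneg_right k1 he.le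
      linarith
    calc ‖(u : L2Cell d)‖ * (‖ξ‖ ^ α + ε ^ α)
        ≤ ‖(u : L2Cell d)‖ * (K * (μm * cZero d α * ‖ξ‖ ^ α + ε ^ α)) := by gcongr
      _ = K * (‖(u : L2Cell d)‖ * (μm * cZero d α * ‖ξ‖ ^ α + ε ^ α)) := by ring
      _ ≤ _ := by gcongr
  -- The constant dominates `3/(μ₋c₀)`, so multiplying `(3/8)μ₋c₀` by it gives at least `9/8`.
  · have h1 := mul_le_mul_of_nonneg_left (S.le_thresholdDenom hv hξ ε) hK0.le
    have := mul_le_mul_of_nonneg_right hm3 ha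
    have := mul_le_mul_of_nonneg_right k1 he.le
    linarith
  · rw [hT, S.norm_formMap_one_sq ξ, thresholdDenom, hquad]
    have h1 := abs_tsum_remKernel_le hα₁ hα₂ ξ S.isMeanZero_muStar
    refine le_trans (le_of_eq ?_) (h1.trans (by gcongr))
    congr 1
    ring
  · exact Real.one_le_rpow_of_pos_of_le_one_of_nonpos hε hε1 (by linarith)

/-- No cancellation is needed: each operator has norm at most `ε^{-α}`, and `ε^{-α} ≤ ε^{1-α}` when
`ε ≥ 1`. -/
lemma norm_resolvent_sub_le_of_one_le (S : Setting d α μm μp μ) {v : Fin d → L2Cell d}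
    (hv : ∀ k, IsCellSolution α μ k (v k)) {ξ : Eu d} (hξ : ‖ξ‖ ≤ deltaStar α μm μp μ) {ε : ℝ}
    (hε1 : 1 ≤ ε) {u : perSobolev d (α / 2)} {f : L2Cell d}
    (hu : ∀ v : perSobolev d (α / 2), inner ℂ (S.formMap ξ v) (S.formMap ξ u) +
      (ε ^ α : ℝ) * inner ℂ (v : L2Cell d) (u : L2Cell d) = inner ℂ (v : L2Cell d) f) :
    ‖(u : L2Cell d) - (((thresholdDenom α μ v ξ ε)⁻¹ : ℝ) : ℂ) • constProj d f‖ ≤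
      2 * ε ^ (1 - α) * ‖f‖ := by
  have hε : 0 < ε := by linarith
  have he : 0 < ε ^ α := Real.rpow_pos_of_pos hε _
  have hm := mul_pos S.pos (cZero_pos (d := d) S.one_lt S.lt_two)
  have ha : 0 ≤ ‖ξ‖ ^ α := by positivity
  have h1 := S.norm_mul_le_of_resolvent (S.deltaStar_spec hξ).1 hu
  have h2 := S.le_thresholdDenom hv hξ ε
  have hma : 0 ≤ μm * cZero d α * ‖ξ‖ ^ α := by positivity
  have hDe : ε ^ α ≤ thresholdDenom α μ v ξ ε := by linarith
  have h3 : ‖(u : L2Cell d)‖ ≤ (ε ^ α)⁻¹ * ‖f‖ := by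
    rw [le_inv_mul_iff₀ he]
    refine le_trans ?_ h1
    rw [mul_comm]
    gcongr
    linarith
  have h4 : ‖constProj d f‖ ≤ ‖f‖ := Submodule.norm_starProjection_apply_le _ _
  have h5 : (thresholdDenom α μ v ξ ε)⁻¹ ≤ (ε ^ α)⁻¹ := inv_anti₀ he hDe
  have h6 : (ε ^ α)⁻¹ ≤ ε ^ (1 - α) := by
    rw [← Real.rpow_neg hε.le]
    exact Real.rpow_le_rpow_of_exponent_le hε1 (by linarith)
  have h7 : ‖(((thresholdDenom α μ v ξ ε)⁻¹ : ℝ) : ℂ) • constProj d f‖ ≤ (ε ^ α)⁻¹ * ‖f‖ := by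
    rw [norm_smul, Complex.norm_real, Real.norm_of_nonneg (inv_nonneg.2 (he.le.trans hDe))]
    gcongr
  calc _ ≤ (ε ^ α)⁻¹ * ‖f‖ + (ε ^ α)⁻¹ * ‖f‖ := (norm_sub_le _ _).trans (add_le_add h3 h7)
    _ = 2 * (ε ^ α)⁻¹ * ‖f‖ := by ring
    _ ≤ _ := by gcongr

end Setting

end

end LevyType

open LevyType
theorem theorem4p3 (d : ℕ) [NeZero d] (α : ℝ) (hα₁ : 1 < α) (hα₂ : α < 2)
    (μm μp : ℝ) (hμm : 0 < μm) :
    ∃ C : ℝ, 0 < C ∧ ∀ μ : Eu d × Eu d → ℝ, IsCoefficient μm μp μ →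
      ∃ v : Fin d → L2Cell d,
        (∀ (k : Fin d) (w : L2Cell d), IsCellSolution α μ k w ↔ w = v k) ∧
        ∀ (ε : ℝ) (ξ : Eu d), 0 < ε → ‖ξ‖ ≤ deltaStar α μm μp μ →
          0 < thresholdDenom α μ v ξ ε ∧
          ∃ R : L2Cell d →L[ℂ] L2Cell d,
            IsShiftedInverse (fiberOperator α μ ξ) (ε ^ α) R ∧
            ‖R - (((thresholdDenom α μ v ξ ε)⁻¹ : ℝ) : ℂ) • constProj d‖ ≤ C * ε ^ (1 - α) := by
  have hK : 4 ≤ commonConst d α μm μp := le_max_left _ _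
  refine ⟨27 * commonConst d α μm μp ^ 13, by positivity, fun μ hμ => ?_⟩
  have S : Setting d α μm μp μ := ⟨hα₁, hα₂, hμm, hμ⟩
  choose v hv using S.exists_cellSolution
  have hv' : ∀ k, IsCellSolution α μ k (v k) := fun k => (hv k (v k)).2 rfl
  refine ⟨v, hv, fun ε ξ hε hξ => ?_⟩
  have he : 0 < ε ^ α := Real.rpow_pos_of_pos hε _
  have hm := mul_pos S.pos (cZero_pos (d := d) S.one_lt S.lt_two)
  refine ⟨lt_of_lt_of_le (by positivity) (S.le_thresholdDenom hv' hξ ε), ?_⟩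
  obtain ⟨R, hR, hR'⟩ := S.exists_resolvent ξ he
  have hK1 : 2 ≤ 27 * commonConst d α μm μp ^ 13 := by
    have := one_le_pow₀ (n := 13) (by linarith : 1 ≤ commonConst d α μm μp)
    linarith
  have ht : 0 ≤ ε ^ (1 - α) := by positivity
  refine ⟨R, hR, ContinuousLinearMap.opNorm_le_bound _ (by positivity) fun f => ?_⟩
  obtain ⟨h, hu⟩ := hR' f
  have e : (R - (((thresholdDenom α μ v ξ ε)⁻¹ : ℝ) : ℂ) • constProj d) f =
      R f - (((thresholdDenom α μ v ξ ε)⁻¹ : ℝ) : ℂ) • constProj d f := rfl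
  rw [e]
  -- The corrector expansion leaves an error `O(‖f‖)` that `ε^{1-α}` absorbs only for `ε ≤ 1`.
  rcases le_total ε 1 with h1 | h1
  · exact S.norm_resolvent_sub_le_of_le_one hv' hξ hε h1 (u := ⟨R f, h⟩) hu
  · refine (S.norm_resolvent_sub_le_of_one_le hv' hξ h1 (u := ⟨R f, h⟩) hu).trans ?_
    exact mul_le_mul_of_nonneg_right (mul_le_mul_of_nonneg_right hK1 ht) (norm_nonneg f)
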